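/- Let $K$ be a number field, let $W\subset\mathbb P^3_K$ be the cubic surface $t_0^2t_2=t_1^2t_3$, and let $V\subset W$ be the complement of the line $t_0=t_1=0$. For $\mathbf y=(y_0:y_1)\in\mathbb P^1(K)$ let $V_{\mathbf y}$ be the fibre over $\mathbf y$ of the morphism $V\to\mathbb P^1$, $(t_0:t_1:t_2:t_3)\mapsto(t_0:t_1)$, and let $V_0\subset V$ be the line $t_2=t_3=0$. Endow $V_{\mathbf y}$, $V_0\subset\mathbb P^3$ and $\mathbb P^1$ with the restriction $\mathcal L$ of the line bundle $\mathcal O(1)$ of the ambient projective space with its standard adelic metric, given at each place $\nu$ by $\|s(\mathbf x)\|_\nu=|s(\mathbf x)|_\nu/\max_i|x_i|_\nu$, where $|\cdot|_\nu$ is the normalized absolute value (so that the product formula holds); let $H_{\mathbb P^1}(x_0:x_1)=\prod_\nu\max(|x_0|_\nu,|x_1|_\nu)$ be the associated height on $\mathbb P^1(K)$. For a geometrically irreducible polarized curve $C$ of this kind (locally closed in a projective space) let $X$ be the desingularisation of $\operatorname{Proj}A(C,\mathcal L)$, where $A(C,\mathcal L)=\bigoplus_k \mathrm H^0_{\rm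 bd}(C,\mathcal L^{\otimes k})$ is the ring of regular sections with bounded norm on the complex points, and let $M$ be the pull-back of $\mathcal O(1)$ to $X$. The Batyrev–Tschinkel invariants are defined as follows. * $a(C)=\inf\{t\in\mathbb Q : t[M]+[K_X]\text{ is effective}\}$. * If $D$ is the effective rigid divisor in the class $a(C)[M]+[K_X]$, then $\operatorname{Pic}(C,\mathcal L)$ is the Picard group of $X_{\overline K}$ minus the support of $D$, and $b(C)$ is the rank of its Galois invariants. * $$c(C)=\frac{\gamma(C)}{a(C)\,(b(C)-1)!}\,\delta(C)\,\tau(C).$$ Here $\gamma(C)=\int e^{-\langle [M],y\rangle}dy$ over the dual cone of the effective cone in $\operatorname{Pic}(C,\mathcal L)^{\mathrm{Gal}}\otimes\mathbb R$ (the dual lattice having covolume one), and $\delta(C)=|\mathrm H^1(\mathrm{Gal}(\overline K/K),\operatorname{Pic}(C,\mathcal L))|$. The Tamagawa number $\tau(C)$ is the volume of the closure of $C(K)$ in $\prod_\nu C(K_\nu)$ for the measure $$\Bigl(\lim_{s\to1^+}(s-1)^{b(C)}L(s,\operatorname{Pic}(C,\mathcal L))\Bigr)\,|\mathrm{disc}\,K|^{-1/2}\prod_\nu\lambda_\nu^{-1}\omega_\nu,$$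 where $\lambda_\nu=L_\nu(1,\operatorname{Pic}(C,\mathcal L))$ at the finite unramified places and $\lambda_\nu=1$ elsewhere, $L$ is the product of the local factors at the finite unramified places, and $\omega_\nu$ is the measure on $C(K_\nu)$ given in a local coordinate $t$ by $\|z\|_\nu^{1/N}\,dt$ if $z\,dt^{\otimes N}$ is a $K$-rational section of $(M^{\otimes a(C)}\otimes\omega_X)^{\otimes N}$ with divisor $ND$ (the Haar measure $dt$ giving volume $1$ to the integers of $K_\nu$ at finite places, and being Lebesgue measure at real places and twice Lebesgue measure at complex places). Then, for all $\mathbf y\in\mathbb P^1(K)$, $$a(V_{\mathbf y})=a(V_0)=a(\mathbb P^1_K)=2,\qquad b(V_{\mathbf y})=b(V_0)=b(\mathbb P^1_K)=1,$$ the constants $c(\mathbb P^1_K)$, $c(V_0)$ and $c(V_{\mathbf y})$ exist (all limits and products in their definition converge, and $\tau$ does not depend on the choice of the section $z\,dt^{\otimes N}$), and $$c(V_0)=c(\mathbb P^1_K),\qquad c(V_{\mathbf y})=\frac{c(\mathbb P^1_K)}{H_{\mathbb P^1}(\mathbf y)^3}.$$ -/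

import Mathlib

open MvPolynomial MeasureTheory Filter Topology TensorProduct
open scoped Pointwise LinearAlgebra.Projectivization NumberField

noncomputable section

namespace BatyrevTschinkel

/-! ## Quasi-projective varieties, their function fields and their sections -/

/-- A quasi-projective variety in `ℙⁿ` over `K`: the locus where all the homogeneous forms in `eqs`
vanish and at least one of the homogeneous forms in `neqs` does not.  It is polarized by the
restriction of `𝒪(1)` with its standard adelic metric `‖s(x)‖ = |s(x)| / max |xᵢ|` at each place. -/
structure QuasiProj (K : Type*) [Field K] (n : ℕ) where
  eqs : Set (MvPolynomial (Fin (n + 1)) K)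
  neqs : Set (MvPolynomial (Fin (n + 1)) K)
  homogeneous : ∀ f ∈ eqs ∪ neqs, ∃ d, f.IsHomogeneous d

namespace QuasiProj

section Geometry

variable {K : Type*} [Field K] {n : ℕ} (V : QuasiProj K n)

/-- Homogeneous coordinate vectors of the points of `V` with values in `E`. -/
def cone {E : Type*} [Field E] (φ : K →+* E) : Set (Fin (n + 1) → E) :=
  {x | x ≠ 0 ∧ (∀ f ∈ V.eqs, f.eval₂ φ x = 0) ∧ ∃ g ∈ V.neqs, g.eval₂ φ x ≠ 0}

/-- The set `V(E)` of points of `V` with values in `E`. -/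
def Points {E : Type*} [Field E] (φ : K →+* E) : Type _ :=
  {P : ℙ E (Fin (n + 1) → E) // P.rep ∈ V.cone φ}

/-- The ideal of the closure of `V` in projective space over the algebraic closure of `K`. -/
def ideal : Ideal (MvPolynomial (Fin (n + 1)) (AlgebraicClosure K)) :=
  vanishingIdeal (AlgebraicClosure K) (V.cone (algebraMap K (AlgebraicClosure K)))

/-- `V` is geometrically irreducible (and non-empty). -/
class IsIrred : Prop where
  prime : V.ideal.IsPrime

/-- The homogeneous coordinate ring of the closure of `V` over the algebraic closure of `K`. -/
abbrev CoordRing : Type _ := MvPolynomial (Fin (n + 1)) (AlgebraicClosure K) ⧸ V.ideal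

variable [hV : V.IsIrred]

instance : IsDomain V.CoordRing :=
  haveI := hV.prime
  Ideal.Quotient.isDomain V.ideal

/-- The fraction field of the homogeneous coordinate ring.  It contains the rational functions and
the rational sections of the powers of `𝒪(1)`. -/
abbrev Frac : Type _ := FractionRing V.CoordRing

/-- The restriction of a form to `V`. -/
def form : MvPolynomial (Fin (n + 1)) (AlgebraicClosure K) →+* V.Frac :=
  (algebraMap V.CoordRing V.Frac).comp (Ideal.Quotient.mk V.ideal)

/-- The `j`-th homogeneous coordinate. -/
def coord (j : Fin (n + 1)) : V.Frac := V.form (X j)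

/-- The function field of `V` over the algebraic closure of `K`, generated by the quotients of
homogeneous coordinates. -/
def FunField : IntermediateField (AlgebraicClosure K) V.Frac :=
  IntermediateField.adjoin _ {z | ∃ i j, z = V.coord i / V.coord j}

/-- The rational function `xᵢ / xⱼ` on `V`. -/
def ratio (i j : Fin (n + 1)) : V.FunField :=
  ⟨V.coord i / V.coord j, IntermediateField.subset_adjoin _ _ ⟨i, j, rfl⟩⟩

/-- The function field `K(V)` of `V` over `K`, as a subfield of the geometric function field. -/
def RatField : IntermediateField K V.FunField :=
  IntermediateField.adjoin _ {z | ∃ i j, z = V.ratio i j}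

/-- The absolute Galois group of `K`, realised as the Galois group of the geometric function field
over `K(V)`; these agree by restriction since `V` is geometrically irreducible. -/
abbrev Gal : Type _ := V.FunField ≃ₐ[V.RatField] V.FunField

/-- Rational sections of `𝒪(w)` on `V` (over the algebraic closure of `K`). -/
def ratSec (w : ℕ) : Set V.Frac :=
  {z | ∀ j, z / V.coord j ^ w ∈ V.FunField}

/-- The rational section `z` is regular at all geometric points of `V`. -/
def IsRegular (z : V.Frac) : Prop :=
  ∀ x ∈ V.cone (algebraMap K (AlgebraicClosure K)),
    ∃ p q : MvPolynomial (Fin (n + 1)) (AlgebraicClosure K),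
      q.eval x ≠ 0 ∧ z * V.form q = V.form p

/-- The degree `m` part `H⁰_bd(V, L^m)` of the ring `A(V, ℒ)`: the regular sections of `𝒪(m)` on `V`
whose norm is bounded on the complex points of `V`, for every complex embedding.  (The inequality
states `|p(x) / q(x)| ≤ B · (max |xᵢ|) ^ m` for a local expression `p / q` of the section.) -/
def boundedSec (m : ℕ) : Set V.Frac :=
  {z | z ∈ V.ratSec m ∧ V.IsRegular z ∧
    ∀ σ : AlgebraicClosure K →+* ℂ, ∃ B : ℝ,
      ∀ x ∈ V.cone (σ.comp (algebraMap K (AlgebraicClosure K))),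
        ∀ p q : MvPolynomial (Fin (n + 1)) (AlgebraicClosure K), z * V.form q = V.form p →
          ‖p.eval₂ σ x‖ ≤ B * ‖x‖ ^ m * ‖q.eval₂ σ x‖}

end Geometry

end QuasiProj

/-! ## Orders of vanishing -/

section Order

variable {F : Type*} [Field F]

/-- `π` generates the maximal ideal of the valuation ring `O`. -/
def IsUnif (O : ValuationSubring F) (π : F) : Prop :=
  π ∈ O ∧ π⁻¹ ∉ O ∧ ∀ x ∈ O, x⁻¹ ∉ O → x / π ∈ O

/-- The normalized order of `f` with respect to a discrete valuation ring `O` of `F`: the integer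
`m` for which `f` is a unit times the `m`-th power of a uniformizer (and `0` for `f = 0`). -/
def ord (O : ValuationSubring F) (f : F) : ℤ :=
  open Classical in
  if f = 0 then 0 else
    Classical.epsilon fun m : ℤ => ∃ π, IsUnif O π ∧ f / π ^ m ∈ O ∧ (f / π ^ m)⁻¹ ∈ O

end Order

namespace QuasiProj

/-! ## The smooth projective model of a curve

From here on `V` is a curve.  The `ℒ`-primitive closure `Proj A(V, ℒ)` has a unique
desingularisation `X`, the smooth projective curve with the function field of `V`, whose closed
points are the places of that field. -/

section Model

variable {K : Type*} [Field K] {n : ℕ} (V : QuasiProj K n) [hV : V.IsIrred]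

/-- The closed points of the smooth projective model `X` over the algebraic closure of `K`: the
non-trivial valuation rings of the function field that contain the constants.  (A valuation ring is
integrally closed, so it contains the algebraic closure of `K` as soon as it contains `K`.) -/
def Place : Type _ :=
  {O : ValuationSubring V.FunField // (∀ c : K, algebraMap K V.FunField c ∈ O) ∧ O ≠ ⊤}

variable {V} in
theorem algebraMap_mem_smul (s : V.Gal) (O : ValuationSubring V.FunField) (c : K)
    (h : algebraMap K V.FunField c ∈ O) : algebraMap K V.FunField c ∈ s • O := by
  have h1 : s • algebraMap K V.FunField c = algebraMap K V.FunField c := by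
    rw [IsScalarTower.algebraMap_apply K V.RatField V.FunField]
    exact s.commutes _
  rw [← h1]
  exact ValuationSubring.smul_mem_pointwise_smul s _ O h

variable {V} in
theorem smul_ne_top (s : V.Gal) (O : ValuationSubring V.FunField) (h : O ≠ ⊤) : s • O ≠ ⊤ := by
  intro h1
  apply h
  rw [eq_top_iff]
  intro x _
  have h2 : s • x ∈ s • O := by rw [h1]; exact ValuationSubring.mem_top _
  exact (ValuationSubring.smul_mem_pointwise_smul_iff).1 h2

instance : MulAction V.Gal V.Place where
  smul s P := ⟨s • P.1, fun c => algebraMap_mem_smul s P.1 c (P.2.1 c), smul_ne_top s P.1 P.2.2⟩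
  one_smul P := Subtype.ext (one_smul V.Gal P.1)
  mul_smul s t P := Subtype.ext (mul_smul s t P.1)

/-- The order of a rational function at a point of `X`. -/
def ordFun (P : V.Place) (f : V.FunField) : ℤ := ord P.1 f

/-- The order of a rational differential at a point of `X`: if `ω = f dπ` for a uniformizer `π`,
it is the order of `f`. -/
def ordDiff (P : V.Place) (ω : Ω[V.FunField⁄AlgebraicClosure K]) : ℤ :=
  Classical.epsilon fun m : ℤ => ∃ π f : V.FunField, IsUnif P.1 π ∧
    ω = f • KaehlerDifferential.D (AlgebraicClosure K) V.FunField π ∧ V.ordFun P f = m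

/-- The order at a point of `X` of a rational section `z` of `M ^ w`, where `M` is the pull-back to
`X` of the polarization `𝒪(1)` of `Proj A(V, ℒ)`.  The line bundles `M ^ m` are generated, for
suitable `m ≥ 1`, by the elements of degree `m` of `A(V, ℒ)`; hence the order of `z` is the largest
value of `ord (z ^ m / u ^ w) / m` for such elements `u`. -/
def ordSec (P : V.Place) (w : ℕ) (z : V.Frac) : ℝ :=
  sSup {r : ℝ | ∃ m : ℕ, 1 ≤ m ∧ ∃ u ∈ V.boundedSec m, u ≠ 0 ∧ ∃ f : V.FunField,
    (f : V.Frac) = z ^ m / u ^ w ∧ r = (V.ordFun P f : ℝ) / m}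

/-! ## The invariants `a`, `b`, `γ` and `δ` -/

/-- Principal divisors with real coefficients: the divisors that are trivial in `Pic(X) ⊗ ℝ`. -/
def principalReal : Submodule ℝ (V.Place →₀ ℝ) :=
  Submodule.span ℝ {D | ∃ f : V.FunField, f ≠ 0 ∧ ∀ P, D P = V.ordFun P f}

/-- The invariant `a(V)`: the infimum of the rational numbers `t` for which the class
`t [M] + [K_X]` is effective. -/
def a : ℝ :=
  sInf {t : ℝ | ∃ q : ℚ, t = q ∧
    ∃ l ∈ V.ratSec 1, l ≠ 0 ∧ ∃ ω : Ω[V.FunField⁄AlgebraicClosure K], ω ≠ 0 ∧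
      ∃ D ∈ V.principalReal, ∀ P, 0 ≤ t * V.ordSec P 1 l + V.ordDiff P ω + D P}

/-- A non-zero section `sec ⊗ diff ^ N` of the line bundle `(M ^ a ⊗ ω_X) ^ N`, where `N * a` is the
integer `w`, whose divisor is effective and rigid.  The existence of such a section is the
`ℒ`-primitivity of `V`. -/
structure AdjointSection where
  N : ℕ
  w : ℕ
  one_le : 1 ≤ N
  weight : (w : ℝ) = N * V.a
  sec : V.Frac
  sec_mem : sec ∈ V.ratSec w
  sec_ne : sec ≠ 0
  diff : Ω[V.FunField⁄AlgebraicClosure K]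
  diff_ne : diff ≠ 0
  effective : ∀ P, 0 ≤ V.ordSec P w sec + N * V.ordDiff P diff
  rigid : ∀ (k : ℕ) (f : V.FunField), f ≠ 0 →
    (∀ P, 0 ≤ V.ordFun P f + k * (V.ordSec P w sec + N * V.ordDiff P diff)) →
      f ∈ Set.range (algebraMap (AlgebraicClosure K) V.FunField)

variable {V} in
/-- The order of vanishing of an adjoint section at a point of `X`. -/
def AdjointSection.order (g : V.AdjointSection) (P : V.Place) : ℝ :=
  V.ordSec P g.w g.sec + g.N * V.ordDiff P g.diff

/-- Divisors on `X`. -/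
abbrev Divisor : Type _ := V.Place →₀ ℤ

/-- The action of the Galois group on divisors. -/
def galDiv (s : V.Gal) : V.Divisor →+ V.Divisor :=
  Finsupp.mapDomain.addMonoidHom fun P : V.Place => s • P

/-- Generators of the relations in `Pic(V, ℒ)`: principal divisors, and the components of the
effective rigid divisor in the class `a [M] + [K_X]`. -/
def picGen : Set V.Divisor :=
  {D | (∃ f : V.FunField, f ≠ 0 ∧ ∀ P, D P = V.ordFun P f) ∨
    ∃ (g : V.AdjointSection) (P : V.Place), 0 < g.order P ∧ D = Finsupp.single P 1}

/-- The relations in `Pic(V, ℒ)`.  (The set of generators is stable under the Galois group, so that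
the translates add nothing to it.) -/
def picRel : AddSubgroup V.Divisor :=
  AddSubgroup.closure {D | ∃ s : V.Gal, ∃ D₀ ∈ V.picGen, D = V.galDiv s D₀}

/-- The group `Pic(V, ℒ)`: the geometric Picard group of the complement in `X` of the components of
the effective rigid divisor in the class `a [M] + [K_X]`. -/
abbrev Pic : Type _ := V.Divisor ⧸ V.picRel

theorem galDiv_mul (s t : V.Gal) (D : V.Divisor) : V.galDiv (s * t) D = V.galDiv s (V.galDiv t D) := by
  have h : (fun P : V.Place => (s * t) • P) = (fun P => s • P) ∘ fun P => t • P := by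
    funext P
    exact mul_smul s t P
  change Finsupp.mapDomain _ D = Finsupp.mapDomain _ (Finsupp.mapDomain _ D)
  rw [h, Finsupp.mapDomain_comp]

theorem picRel_le (s : V.Gal) : V.picRel ≤ V.picRel.comap (V.galDiv s) := by
  refine (AddSubgroup.closure_le _).2 ?_
  rintro D ⟨t, D₀, hD, rfl⟩
  refine AddSubgroup.subset_closure ⟨s * t, D₀, hD, ?_⟩
  rw [galDiv_mul]

/-- The action of the Galois group on `Pic(V, ℒ)`. -/
def galPic (s : V.Gal) : V.Pic →+ V.Pic :=
  QuotientAddGroup.map V.picRel V.picRel (V.galDiv s) (V.picRel_le s)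

/-- The Galois invariants of `Pic(V, ℒ)`. -/
def picInv : AddSubgroup V.Pic where
  carrier := {p | ∀ s, V.galPic s p = p}
  zero_mem' s := map_zero _
  add_mem' hp hq s := by rw [map_add, hp s, hq s]
  neg_mem' hp s := by rw [map_neg, hp s]

/-- The invariant `b(V)`: the rank of the Galois invariants of `Pic(V, ℒ)`. -/
def b : ℕ := Module.finrank ℤ V.picInv

/-- The class of the polarization `M` in `Pic(V, ℒ)`. -/
def polClass : V.picInv :=
  Classical.epsilon fun p : V.picInv => ∃ D : V.Divisor, (p : V.Pic) = QuotientAddGroup.mk D ∧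
    ∃ l ∈ V.ratSec 1, l ≠ 0 ∧ ∀ P, (D P : ℝ) = V.ordSec P 1 l

/-- The dual of the effective cone of `Pic(V, ℒ)`, in the coordinates on the dual of `Pic(V, ℒ)`
that are given by a basis of the dual lattice. -/
def dualCone (e : Module.Basis (Fin V.b) ℤ (V.picInv →+ ℤ)) : Set (Fin V.b → ℝ) :=
  {y | ∀ p : V.picInv, (∃ D : V.Divisor, 0 ≤ D ∧ (p : V.Pic) = QuotientAddGroup.mk D) →
    0 ≤ ∑ i, y i * (e i p : ℝ)}

open Classical in
/-- The invariant `γ(V)`: the characteristic function `∫ exp (-⟨[M], y⟩) dy` of the effective cone of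
`Pic(V, ℒ)` at the class of `M`, an integral over the dual cone with respect to the Lebesgue measure
for which the dual lattice has covolume one. -/
def gamma : ℝ :=
  if h : Nonempty (Module.Basis (Fin V.b) ℤ (V.picInv →+ ℤ)) then
    ∫ y in V.dualCone h.some, Real.exp (-∑ i, y i * (h.some i V.polClass : ℝ))
  else 0

/-- Continuous `1`-cocycles of the Galois group with values in the discrete module `Pic(V, ℒ)`. -/
def cocycles : AddSubgroup (V.Gal → V.Pic) where
  carrier := {c | IsLocallyConstant c ∧ ∀ s t, c (s * t) = c s + V.galPic s (c t)}
  zero_mem' := ⟨IsLocallyConstant.const 0, fun s t => by simp⟩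
  add_mem' := by
    rintro c d ⟨hc, hc'⟩ ⟨hd, hd'⟩
    refine ⟨hc.add hd, fun s t => ?_⟩
    simp only [Pi.add_apply, hc', hd', map_add]
    abel
  neg_mem' := by
    rintro c ⟨hc, hc'⟩
    refine ⟨hc.neg, fun s t => ?_⟩
    simp only [Pi.neg_apply, hc', map_neg]
    abel

/-- `1`-coboundaries of the Galois group with values in `Pic(V, ℒ)`. -/
def coboundaries : AddSubgroup (V.Gal → V.Pic) where
  carrier := {c | ∃ p, ∀ s, c s = V.galPic s p - p}
  zero_mem' := ⟨0, fun s => by simp⟩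
  add_mem' := by
    rintro c d ⟨p, hp⟩ ⟨q, hq⟩
    refine ⟨p + q, fun s => ?_⟩
    simp only [Pi.add_apply, hp, hq, map_add]
    abel
  neg_mem' := by
    rintro c ⟨p, hp⟩
    refine ⟨-p, fun s => ?_⟩
    simp only [Pi.neg_apply, hp, map_neg]
    abel

/-- The invariant `δ(V)`: the order of `H¹(Gal(K̄/K), Pic(V, ℒ))`. -/
def delta : ℕ := Nat.card (V.cocycles ⧸ V.coboundaries.addSubgroupOf V.cocycles)

end Model

/-! ## The `L`-function of `Pic(V, ℒ)` -/

section LFunction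

variable {K : Type*} [Field K] [NumberField K] {n : ℕ} (V : QuasiProj K n) [hV : V.IsIrred]

/-- The algebraic integers, as elements of the geometric function field. -/
abbrev AlgInt : Type _ := integralClosure ℤ V.FunField

/-- The prime ideal `Q` of the ring of algebraic integers lies over `v`. -/
def LiesOverPlace (v : IsDedekindDomain.HeightOneSpectrum (𝓞 K)) (Q : Ideal V.AlgInt) : Prop :=
  Q.IsPrime ∧ ∀ x : 𝓞 K, x ∈ v.asIdeal ↔ ∃ y ∈ Q, (y : V.FunField) = algebraMap K V.FunField x

/-- A Frobenius element of the Galois group at `v`. -/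
def frob (v : IsDedekindDomain.HeightOneSpectrum (𝓞 K)) : V.Gal :=
  Classical.epsilon fun s : V.Gal => ∃ Q : Ideal V.AlgInt, V.LiesOverPlace v Q ∧
    ∀ x : V.AlgInt, ∃ y ∈ Q,
      (y : V.FunField) = s (x : V.FunField) - (x : V.FunField) ^ Ideal.absNorm v.asIdeal

/-- The Galois module `Pic(V, ℒ)` is ramified at `v`: an inertia group at `v` acts non-trivially. -/
def IsRamified (v : IsDedekindDomain.HeightOneSpectrum (𝓞 K)) : Prop :=
  ∃ Q : Ideal V.AlgInt, V.LiesOverPlace v Q ∧ ∃ s : V.Gal,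
    (∀ x : V.AlgInt, ∃ y ∈ Q, (y : V.FunField) = s (x : V.FunField) - (x : V.FunField)) ∧
      V.galPic s ≠ AddMonoidHom.id V.Pic

open Classical in
/-- The local factor at `v` of the `L`-function of `Pic(V, ℒ)`; factors at the finitely many
ramified places are omitted. -/
def localL (v : IsDedekindDomain.HeightOneSpectrum (𝓞 K)) (s : ℝ) : ℝ :=
  if V.IsRamified v then 1 else
    (LinearMap.det (LinearMap.id - ((Ideal.absNorm v.asIdeal : ℝ) ^ (-s)) •
      LinearMap.baseChange ℝ (V.galPic (V.frob v)).toIntLinearMap))⁻¹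

end LFunction

/-! ## Tamagawa measures -/

/-- The Haar measure on a normed field for which the closed unit ball has volume `c`. -/
def haarBall (E : Type*) [NormedField E] (c : ENNReal) : @Measure E (borel E) :=
  open Classical in
  letI : MeasurableSpace E := borel E
  haveI : BorelSpace E := ⟨rfl⟩
  if h : IsCompact (Metric.closedBall (0 : E) 1) then
    c • Measure.addHaarMeasure
      ⟨⟨Metric.closedBall 0 1, h⟩, ⟨0, Metric.ball_subset_interior_closedBall
        (Metric.mem_ball_self one_pos)⟩⟩
  else 0

section Tamagawa

variable {K : Type*} [Field K] {n : ℕ} {V : QuasiProj K n}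

/-- The topology of `V(E)`, as a subspace of projective space. -/
instance {E : Type*} [NormedField E] (φ : K →+* E) : TopologicalSpace (V.Points φ) :=
  TopologicalSpace.induced (fun P => P.1)
    (TopologicalSpace.coinduced
      (Projectivization.mk' E : {x : Fin (n + 1) → E // x ≠ 0} → ℙ E (Fin (n + 1) → E))
      inferInstance)

instance {E : Type*} [NormedField E] (φ : K →+* E) : MeasurableSpace (V.Points φ) := borel _

/-- The affine coordinate `xᵢ / xⱼ` of a point. -/
def affineCoord {E : Type*} [NormedField E] (φ : K →+* E) (i j : Fin (n + 1)) (P : V.Points φ) : E :=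
  P.1.rep i / P.1.rep j

variable [hV : V.IsIrred]

/-- The section `z` is defined over `K`, regular at the point with coordinates `x` and takes the
value `c` there. -/
def HasValue {E : Type*} [Field E] (z : V.Frac) (φ : K →+* E) (x : Fin (n + 1) → E) (c : E) : Prop :=
  ∃ p q : MvPolynomial (Fin (n + 1)) K,
    z * V.form (q.map (algebraMap K (AlgebraicClosure K))) =
        V.form (p.map (algebraMap K (AlgebraicClosure K))) ∧
      q.eval₂ φ x ≠ 0 ∧ c = p.eval₂ φ x / q.eval₂ φ x

/-- An adjoint section is defined over `K`. -/
def AdjointSection.IsRational (g : V.AdjointSection) : Prop :=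
  (∃ p q : MvPolynomial (Fin (n + 1)) K,
    V.form (q.map (algebraMap K (AlgebraicClosure K))) ≠ 0 ∧
      g.sec * V.form (q.map (algebraMap K (AlgebraicClosure K))) =
        V.form (p.map (algebraMap K (AlgebraicClosure K)))) ∧
  ∃ f ∈ V.RatField, ∃ t ∈ V.RatField,
    g.diff = f • KaehlerDifferential.D (AlgebraicClosure K) V.FunField t

/-- A chart of `V(E)`: an open subset which is mapped homeomorphically onto an open subset of `E` by
an affine coordinate `t = xᵢ / xⱼ`.  The function `f` is the quotient of `g.diff` by `dt`. -/
structure Chart {E : Type*} [NormedField E] (g : V.AdjointSection) (φ : K →+* E) where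
  i : Fin (n + 1)
  j : Fin (n + 1)
  f : V.FunField
  diff_eq : g.diff = f • KaehlerDifferential.D (AlgebraicClosure K) V.FunField (V.ratio i j)
  dom : Set (V.Points φ)
  isOpen_dom : IsOpen dom
  rep_ne : ∀ P ∈ dom, P.1.rep j ≠ 0
  isOpenEmbedding : IsOpenEmbedding fun P : dom => affineCoord φ i j P.1

variable {E : Type*} [NormedField E]

open Classical in
/-- The density with respect to `dt` of the Tamagawa measure.  In the chart `g = z dt ^ N`, where
`z = sec * f ^ N` is a section of `M ^ w`, and the density is `‖z‖ ^ (1 / N)`, where `‖z‖` is the norm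
`|z(x)| / (max |xᵢ|) ^ w`.  The normalized absolute value of `E` is the `e`-th power of its norm. -/
def Chart.density {g : V.AdjointSection} {φ : K →+* E} (c : Chart g φ) (e : ℕ) (P : V.Points φ) : ℝ :=
  if h : ∃ r, HasValue (g.sec * (c.f : V.Frac) ^ g.N) φ P.1.rep r then
    (‖h.choose‖ / ‖P.1.rep‖ ^ g.w) ^ ((e : ℝ) / g.N)
  else 0

/-- The Tamagawa measure on the domain of a chart. -/
def Chart.measure {g : V.AdjointSection} {φ : K →+* E} (c : Chart g φ) (e : ℕ) (vol : ENNReal) :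
    Measure (V.Points φ) :=
  letI : MeasurableSpace E := borel E
  Measure.map (fun P : c.dom => P.1)
    ((Measure.comap (fun P : c.dom => affineCoord φ c.i c.j P.1) (haarBall E vol)).withDensity
      fun P => ENNReal.ofReal (c.density e P.1))

/-- The Tamagawa measure on `V(E)` that is defined by an adjoint section.  It is glued from the
measures on the domains of the charts; as these agree on overlaps, this is their supremum. -/
def AdjointSection.measure (g : V.AdjointSection) (φ : K →+* E) (e : ℕ) (vol : ENNReal) :
    Measure (V.Points φ) :=
  ⨆ c : Chart g φ, c.measure e vol

end Tamagawa

section Global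

variable {K : Type*} [Field K] [NumberField K] {n : ℕ} (V : QuasiProj K n)

/-- The points of `V` over the completion at an infinite place. -/
abbrev PointsInf (v : NumberField.InfinitePlace K) : Type _ :=
  V.Points (algebraMap K v.Completion)

/-- The points of `V` over the completion at a finite place. -/
abbrev PointsFin (v : IsDedekindDomain.HeightOneSpectrum (𝓞 K)) : Type _ :=
  V.Points (NumberField.FinitePlace.embedding (K := K) v)

/-- The set `V(K)`, embedded diagonally in the product of all the sets `V(K_v)`. -/
def diagonal : Set ((∀ v, V.PointsInf v) × ∀ v, V.PointsFin v) :=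
  {Q | ∃ x ∈ V.cone (RingHom.id K),
    (∀ v, ∃ h, (Q.1 v).1 = Projectivization.mk v.Completion
      (fun i => algebraMap K v.Completion (x i)) h) ∧
    ∀ v, ∃ h, (Q.2 v).1 = Projectivization.mk (v.adicCompletion K)
      (fun i => NumberField.FinitePlace.embedding (K := K) v (x i)) h}

variable {V} [hV : V.IsIrred]

/-- The Tamagawa measure at an infinite place.  The Haar measure is Lebesgue measure at a real place,
and twice Lebesgue measure at a complex place. -/
def AdjointSection.measureInf (g : V.AdjointSection) (v : NumberField.InfinitePlace K) :
    Measure (V.PointsInf v) :=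
  open Classical in
  g.measure (algebraMap K v.Completion) v.mult
    (if v.IsReal then 2 else ENNReal.ofReal (2 * Real.pi))

/-- The Tamagawa measure at a finite place.  The Haar measure gives volume one to the integers, and
the norm of the completion is the normalized absolute value. -/
def AdjointSection.measureFin (g : V.AdjointSection)
    (v : IsDedekindDomain.HeightOneSpectrum (𝓞 K)) : Measure (V.PointsFin v) :=
  g.measure (NumberField.FinitePlace.embedding (K := K) v) 1 1

/-- The product of the local Tamagawa measures, each rescaled to total mass one. -/
def AdjointSection.probability (g : V.AdjointSection) :
    Measure ((∀ v, V.PointsInf v) × ∀ v, V.PointsFin v) :=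
  (Measure.pi fun v => (g.measureInf v Set.univ)⁻¹ • g.measureInf v).prod
    (Measure.infinitePi fun v => (g.measureFin v Set.univ)⁻¹ • g.measureFin v)

variable (V)

/-- The Tamagawa number `τ(V)` exists and has the value `τ`.  It is the volume of the closure of
`V(K)` with respect to the measure
`(lim_{s → 1} (s - 1) ^ b L(s, Pic(V, ℒ))) · |disc K| ^ (-1/2) · ∏_v λ_v⁻¹ ω_v`,
where `λ_v` is the local factor `L_v(1, Pic(V, ℒ))` at a finite place and `1` at an infinite place, and
the measures `ω_v` are defined by a rational adjoint section; every choice of it must give `τ`. -/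
def HasTamagawaNumber (τ : ℝ) : Prop :=
  (∃ g : V.AdjointSection, g.IsRational) ∧
  ∃ r : ℝ,
    (∀ s : ℝ, 1 < s → Multipliable fun v => V.localL v s) ∧
    Tendsto (fun s : ℝ => (s - 1) ^ V.b * ∏' v, V.localL v s) (𝓝[>] 1) (𝓝 r) ∧
    ∀ g : V.AdjointSection, g.IsRational →
      (∀ v, g.measureInf v Set.univ ≠ 0 ∧ g.measureInf v Set.univ ≠ ⊤) ∧
      (∀ v, g.measureFin v Set.univ ≠ 0 ∧ g.measureFin v Set.univ ≠ ⊤) ∧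
      ∃ m : ℝ, HasProd (fun v => (V.localL v 1)⁻¹ * (g.measureFin v Set.univ).toReal) m ∧
        τ = r * (Real.sqrt |(NumberField.discr K : ℝ)|)⁻¹ *
          ((∏ v, (g.measureInf v Set.univ).toReal) * m) *
            (g.probability (closure V.diagonal)).toReal

/-- The expected constant `c(V) = γ(V) / (a(V) (b(V) - 1)!) · δ(V) · τ(V)` exists and has the
value `c`. -/
def HasExpectedConstant (c : ℝ) : Prop :=
  ∃ τ : ℝ, V.HasTamagawaNumber τ ∧
    c = V.gamma / (V.a * (Nat.factorial (V.b - 1) : ℝ)) * V.delta * τ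

end Global

end QuasiProj

/-! ## The projective line and the lines on the cubic surface `t₀² t₂ = t₁² t₃` -/

section Lines

variable (K : Type*) [Field K]

/-- The projective line. -/
def projLine : QuasiProj K 1 where
  eqs := ∅
  neqs := {1}
  homogeneous := by
    rintro f (hf | rfl)
    · exact hf.elim
    · exact ⟨0, isHomogeneous_one _ _⟩

/-- The complement `V` of the singular line `t₀ = t₁ = 0` in the surface `t₀² t₂ = t₁² t₃`. -/
def cubicV : QuasiProj K 3 where
  eqs := {X 0 ^ 2 * X 2 - X 1 ^ 2 * X 3}
  neqs := {X 0, X 1}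
  homogeneous := by
    rintro f (rfl | rfl | rfl)
    · exact ⟨3, (((isHomogeneous_X K 0).pow 2).mul (isHomogeneous_X K 2)).sub
        (((isHomogeneous_X K 1).pow 2).mul (isHomogeneous_X K 3))⟩
    · exact ⟨1, isHomogeneous_X K 0⟩
    · exact ⟨1, isHomogeneous_X K 1⟩

/-- The base line `V₀`, given on `V` by `t₂ = t₃ = 0`. -/
def baseLine : QuasiProj K 3 where
  eqs := (cubicV K).eqs ∪ {X 2, X 3}
  neqs := (cubicV K).neqs
  homogeneous := by
    rintro f ((hf | rfl | rfl) | hf)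
    · exact (cubicV K).homogeneous f (Or.inl hf)
    · exact ⟨1, isHomogeneous_X K 2⟩
    · exact ⟨1, isHomogeneous_X K 3⟩
    · exact (cubicV K).homogeneous f (Or.inr hf)

variable {K}

/-- The fibre `V_y` over `y = (y₀ : y₁)` of the morphism `V → ℙ¹` given by `(t₀ : t₁)`. -/
def fibre (y : ℙ K (Fin 2 → K)) : QuasiProj K 3 where
  eqs := (cubicV K).eqs ∪ {C (y.rep 1) * X 0 - C (y.rep 0) * X 1}
  neqs := (cubicV K).neqs
  homogeneous := by
    rintro f ((hf | rfl) | hf)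
    · exact (cubicV K).homogeneous f (Or.inl hf)
    · refine ⟨1, ?_⟩
      have h := ((isHomogeneous_C (Fin 4) (y.rep 1)).mul (isHomogeneous_X K (0 : Fin 4))).sub
        ((isHomogeneous_C (Fin 4) (y.rep 0)).mul (isHomogeneous_X K (1 : Fin 4)))
      simpa using h
    · exact (cubicV K).homogeneous f (Or.inr hf)

/-- A variety which is parametrized by polynomials is irreducible. -/
theorem isIrred_of_param {n : ℕ} (V : QuasiProj K n)
    (p : Fin (n + 1) → MvPolynomial (Fin 2) (AlgebraicClosure K))
    (q : MvPolynomial (Fin 2) (AlgebraicClosure K)) (hq : q ≠ 0)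
    (h1 : ∀ z : Fin 2 → AlgebraicClosure K, q.eval z ≠ 0 →
      (fun i => (p i).eval z) ∈ V.cone (algebraMap K (AlgebraicClosure K)))
    (h2 : ∀ x ∈ V.cone (algebraMap K (AlgebraicClosure K)), ∃ z, x = fun i => (p i).eval z) :
    V.IsIrred := by
  have hcomp : ∀ (f : MvPolynomial (Fin (n + 1)) (AlgebraicClosure K))
      (z : Fin 2 → AlgebraicClosure K),
      (aeval p f).eval z = f.eval fun i => (p i).eval z := by
    intro f z
    induction f using MvPolynomial.induction_on with
    | C a => simp
    | add f g hf hg => rw [map_add, map_add, map_add, hf, hg]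
    | mul_X f i hf => rw [map_mul, map_mul, map_mul, hf, aeval_X, eval_X]
  have key : V.ideal = RingHom.ker (aeval p :
      MvPolynomial (Fin (n + 1)) (AlgebraicClosure K) →ₐ[AlgebraicClosure K] _) := by
    ext f
    rw [RingHom.mem_ker, QuasiProj.ideal, mem_vanishingIdeal_iff]
    constructor
    · intro hf
      have h0 : q * aeval p f = 0 := by
        apply MvPolynomial.funext
        intro z
        by_cases hz : q.eval z = 0
        · simp [hz]
        · have := hf _ (h1 z hz)
          rw [MvPolynomial.aeval_eq_eval] at this
          simp only [map_mul, map_zero, hcomp, mul_eq_zero]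
          exact Or.inr this
      exact (mul_eq_zero.1 h0).resolve_left hq
    · rintro hf x hx
      obtain ⟨z, rfl⟩ := h2 x hx
      rw [MvPolynomial.aeval_eq_eval]
      rw [← hcomp, hf, map_zero]
  exact ⟨key ▸ RingHom.ker_isPrime _⟩

instance : (projLine K).IsIrred := by
  refine isIrred_of_param _ ![X 0, X 1] (X 0) (X_ne_zero 0) ?_ ?_
  · intro z hz
    refine ⟨fun h => hz ?_, by simp [projLine], 1, rfl, by simp⟩
    simpa using congrFun h 0
  · intro x _
    refine ⟨x, ?_⟩
    funext i
    fin_cases i <;> simp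

instance : (baseLine K).IsIrred := by
  refine isIrred_of_param _ ![X 0, X 1, 0, 0] (X 0) (X_ne_zero 0) ?_ ?_
  · intro z hz
    refine ⟨fun h => hz ?_, ?_, X 0, Or.inl rfl, by simpa using hz⟩
    · simpa using congrFun h 0
    · rintro f (rfl | rfl | rfl) <;> simp
  · rintro x ⟨_, hx, _⟩
    have h2 := hx (X 2) (Or.inr (Or.inl rfl))
    have h3 := hx (X 3) (Or.inr (Or.inr rfl))
    simp only [eval₂_X] at h2 h3
    refine ⟨![x 0, x 1], ?_⟩
    funext i
    fin_cases i <;> simp [h2, h3]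

instance (y : ℙ K (Fin 2 → K)) : (fibre y).IsIrred := by
  set φ := algebraMap K (AlgebraicClosure K) with hφ
  have hy : φ (y.rep 0) ≠ 0 ∨ φ (y.rep 1) ≠ 0 := by
    by_contra! h
    apply y.rep_nonzero
    funext i
    fin_cases i
    · simpa using h.1
    · simpa using h.2
  set a := φ (y.rep 0) with ha
  set b := φ (y.rep 1) with hb
  refine isIrred_of_param _ ![C a * X 0, C b * X 0, C (b ^ 2) * X 1, C (a ^ 2) * X 1] (X 0)
    (X_ne_zero 0) ?_ ?_
  · intro z hz
    have hz' : z 0 ≠ 0 := by simpa using hz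
    have hne : a * z 0 ≠ 0 ∨ b * z 0 ≠ 0 :=
      hy.imp (fun h => mul_ne_zero h hz') (fun h => mul_ne_zero h hz')
    refine ⟨fun h => ?_, ?_, ?_⟩
    · rcases hne with h' | h'
      · exact h' (by simpa using congrFun h 0)
      · exact h' (by simpa using congrFun h 1)
    · rintro f (rfl | rfl)
      · simp
        ring
      · simp [← hφ, ← ha, ← hb]
        ring
    · rcases hne with h' | h'
      · exact ⟨X 0, Or.inl rfl, by simpa using h'⟩
      · exact ⟨X 1, Or.inr rfl, by simpa using h'⟩
  · rintro x ⟨_, hx, hx'⟩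
    have e1 := hx _ (Or.inl rfl)
    have e2 := hx _ (Or.inr rfl)
    have e3 : x 0 ≠ 0 ∨ x 1 ≠ 0 := by
      obtain ⟨g, (rfl | rfl), hg⟩ := hx'
      · exact Or.inl (by simpa using hg)
      · exact Or.inr (by simpa using hg)
    simp only [eval₂_sub, eval₂_mul, eval₂_pow, eval₂_X, eval₂_C] at e1 e2
    rw [← hφ, ← ha, ← hb] at e2
    by_cases h0 : a = 0
    · have hb0 : b ≠ 0 := hy.resolve_left (by simpa using h0)
      have hx0 : x 0 = 0 := by
        rw [h0] at e2
        simpa [hb0] using e2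
      have hx1 : x 1 ≠ 0 := e3.resolve_left (by simpa using hx0)
      have hx3 : x 3 = 0 := by
        rw [hx0] at e1
        simpa [hx1] using e1
      refine ⟨![x 1 / b, x 2 / b ^ 2], ?_⟩
      funext i
      fin_cases i <;> simp [h0, hx0, hx3] <;> field_simp
    · have hx1 : x 1 = b * x 0 / a := by
        field_simp
        linear_combination -e2
      have hx0 : x 0 ≠ 0 := by
        intro h
        rw [h] at hx1
        simp [h, hx1] at e3
      have hx2 : x 2 = b ^ 2 * x 3 / a ^ 2 := by
        rw [hx1] at e1
        have h3 : x 0 ^ 2 * (x 2 * a ^ 2 - b ^ 2 * x 3) = 0 := by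
          field_simp at e1
          linear_combination e1
        have h4 := (mul_eq_zero.1 h3).resolve_left (pow_ne_zero 2 hx0)
        field_simp
        linear_combination h4
      refine ⟨![x 0 / a, x 3 / a ^ 2], ?_⟩
      funext i
      fin_cases i <;> simp [hx1, hx2] <;> field_simp

end Lines

end BatyrevTschinkel

end

noncomputable section

namespace BatyrevTschinkel

/-! ## Discrete valuation rings and orders -/

section DiscreteOrder

variable {F : Type*} [Field F] {O : ValuationSubring F} {π f g : F}

/-! Each of the curves is a line xᵣ = cᵣ s + dᵣ t, possibly with the point s = 0 removed, where c
and d are vectors over K and every coordinate involves only one of s = xⱼ and t = xᵢ (`IsLine`). All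
invariants are computed for such a line in terms of c and d, and the vectors are inserted at the
end.

Geometry. The function field is K̄(T) with T = xᵢ / xⱼ. Boundedness of the norm near the possibly
missing point forces the sections of degree m in A(V, ℒ) to be polynomials in T of degree at most m
(`exists_polynomial_of_mem_boundedSec`). Hence the model is the full projective line and M has
degree 1, whether or not a point was removed. As dT has degree -2, the class t[M] + [K_X] has degree
t - 2. So a = 2, the rigid divisor is zero, and the degree identifies Pic with ℤ, with trivial
Galois action (`picRel_eq_ker`, `galPic_eq_id`). It follows that b = 1, that γ is the integral of
exp(-y) over a half-line, that δ = 1 because continuous homomorphisms from the Galois group to ℤ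
vanish, and that the L-function is the Dedekind zeta function of K.

Measures. An adjoint section is a xⱼ^(2N) (dT)^N with a constant a, which lies in K if the section
is rational (`exists_rational_const`). Since the coordinates separate, the maximum norm on the line
is max(‖c‖|s|, ‖d‖|t|), and the Tamagawa measure at a place is |a|^(1/N) max(‖c‖, ‖d‖|T|)^(-2) dT in
normalized absolute values (`measure_eq`). Rescaling T gives |a|^(1/N) / (‖c‖‖d‖) times the mass for
the projective line (`measure_univ`). In the product over all places a disappears by the product
formula, and 1 / (H(c) H(d)) remains. A finite place contributes (1 - 1/q)(1 + 1/q) = 1 - q^(-2), so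
the product converges. The class number formula gives the limit of the L-function at 1. By weak
approximation the closure of the rational points is the whole product (`closure_diagonal`).
Therefore the expected constant is C / (H(c) H(d)) with C depending on K only
(`hasExpectedConstant`).

For ℙ¹ and V₀ both vectors are unit vectors, of height 1. For the fibre over (1 : u) they are (1, u,
0, 0) and (0, 0, u², 1), of heights H(y) and H(y)², which yields the cube; over (0 : 1) everything
has height 1. -/

theorem mem_and_inv_notMem_iff {x : F} :
    (x ∈ O ∧ x⁻¹ ∉ O) ↔ x ≠ 0 ∧ O.valuation x < 1 := by
  rw [← O.valuation_le_one_iff, ← O.valuation_le_one_iff, map_inv₀]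
  constructor
  · rintro ⟨h1, h2⟩
    have hx : x ≠ 0 := by rintro rfl; simp at h2
    refine ⟨hx, lt_of_le_of_ne h1 fun h => h2 ?_⟩
    simp [h]
  · rintro ⟨hx, h⟩
    refine ⟨h.le, fun h2 => ?_⟩
    have h0 : 0 < O.valuation x := by simpa [zero_lt_iff] using hx
    exact absurd ((inv_le_one₀ h0).1 h2) (not_le.2 h)

/-- In terms of the value group, a uniformizer is a non-zero element with the largest value below 1.
This turns membership conditions into inequalities. -/
theorem isUnif_iff : IsUnif O π ↔ π ≠ 0 ∧ O.valuation π < 1 ∧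
    ∀ x, O.valuation x < 1 → O.valuation x ≤ O.valuation π := by
  rw [IsUnif, ← and_assoc, mem_and_inv_notMem_iff, and_assoc]
  refine and_congr_right fun hπ => and_congr_right fun _ => ?_
  have h0 : 0 < O.valuation π := by simpa [zero_lt_iff] using hπ
  have key : ∀ x, x / π ∈ O ↔ O.valuation x ≤ O.valuation π := fun x => by
    rw [← O.valuation_le_one_iff, map_div₀, div_le_one₀ h0]
  constructor
  · intro h x hx
    rcases eq_or_ne x 0 with rfl | hx0
    · simp
    · have := mem_and_inv_notMem_iff.2 ⟨hx0, hx⟩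
      exact (key x).1 (h x this.1 this.2)
  · intro h x h1 h2
    exact (key x).2 (h x (mem_and_inv_notMem_iff.1 ⟨h1, h2⟩).2)

theorem valuation_eq_zpow_iff (hπ : π ≠ 0) (hf : f ≠ 0) (m : ℤ) :
    (f / π ^ m ∈ O ∧ (f / π ^ m)⁻¹ ∈ O) ↔ O.valuation f = O.valuation π ^ m := by
  have h0 : 0 < O.valuation π ^ m := by
    have : 0 < O.valuation π := by simpa [zero_lt_iff] using hπ
    exact zpow_pos this m
  have h1 : 0 < O.valuation f := by simpa [zero_lt_iff] using hf
  rw [← O.valuation_le_one_iff, ← O.valuation_le_one_iff, map_inv₀, map_div₀, map_zpow₀,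
    div_le_one₀ h0, inv_div, div_le_one₀ h1]
  exact ⟨fun h => le_antisymm h.1 h.2, fun h => ⟨h.le, h.ge⟩⟩

theorem IsUnif.valuation_eq {π' : F} (h : IsUnif O π) (h' : IsUnif O π') :
    O.valuation π = O.valuation π' := by
  rw [isUnif_iff] at h h'
  exact le_antisymm (h'.2.2 _ h.2.1) (h.2.2 _ h'.2.1)

theorem IsUnif.zpow_injective (h : IsUnif O π) :
    Function.Injective fun m : ℤ => O.valuation π ^ m := by
  rw [isUnif_iff] at h
  have h0 : 0 < O.valuation π := by simpa [zero_lt_iff] using h.1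
  exact (zpow_right_strictAnti₀ h0 h.2.1).injective

/-- The choice in `ord` is harmless: all uniformizers have the same value, and the powers of this
value are distinct, so only one integer qualifies. -/
theorem ord_eq (hπ : IsUnif O π) (hf : f ≠ 0) {m : ℤ}
    (h : O.valuation f = O.valuation π ^ m) : ord O f = m := by
  have hu := isUnif_iff.1 hπ
  rw [ord, if_neg hf]
  have hex : ∃ m : ℤ, ∃ π, IsUnif O π ∧ f / π ^ m ∈ O ∧ (f / π ^ m)⁻¹ ∈ O :=
    ⟨m, π, hπ, (valuation_eq_zpow_iff hu.1 hf m).2 h⟩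
  obtain ⟨π', h1, h2⟩ := Classical.epsilon_spec hex
  rw [valuation_eq_zpow_iff (isUnif_iff.1 h1).1 hf, ← hπ.valuation_eq h1, h] at h2
  exact (hπ.zpow_injective h2).symm

/-- `O` is a discrete valuation ring with uniformizer `π`. -/
structure IsParam (O : ValuationSubring F) (π : F) : Prop where
  unif : IsUnif O π
  exists_zpow : ∀ f : F, f ≠ 0 → ∃ m : ℤ, O.valuation f = O.valuation π ^ m

namespace IsParam

theorem ne_zero (h : IsParam O π) : π ≠ 0 := (isUnif_iff.1 h.unif).1

theorem valuation_eq (h : IsParam O π) (hf : f ≠ 0) :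
    O.valuation f = O.valuation π ^ ord O f := by
  obtain ⟨m, hm⟩ := h.exists_zpow f hf
  rw [ord_eq h.unif hf hm, hm]

theorem ord_mul (h : IsParam O π) (hf : f ≠ 0) (hg : g ≠ 0) :
    ord O (f * g) = ord O f + ord O g := by
  have h0 : O.valuation π ≠ 0 := by simpa using h.ne_zero
  refine ord_eq h.unif (mul_ne_zero hf hg) ?_
  rw [map_mul, h.valuation_eq hf, h.valuation_eq hg, zpow_add₀ h0]

theorem ord_inv (h : IsParam O π) (hf : f ≠ 0) : ord O f⁻¹ = -ord O f := by
  refine ord_eq h.unif (inv_ne_zero hf) ?_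
  rw [map_inv₀, h.valuation_eq hf, zpow_neg]

theorem ord_div (h : IsParam O π) (hf : f ≠ 0) (hg : g ≠ 0) :
    ord O (f / g) = ord O f - ord O g := by
  rw [div_eq_mul_inv, h.ord_mul hf (inv_ne_zero hg), h.ord_inv hg, sub_eq_add_neg]

theorem ord_one (h : IsParam O π) : ord O 1 = 0 :=
  ord_eq h.unif one_ne_zero (by simp)

theorem ord_pow (h : IsParam O π) (hf : f ≠ 0) (n : ℕ) : ord O (f ^ n) = n * ord O f := by
  induction n with
  | zero => simpa using h.ord_one
  | succ n ih =>
    rw [pow_succ, h.ord_mul (pow_ne_zero n hf) hf, ih]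
    push_cast
    ring

theorem ord_param (h : IsParam O π) : ord O π = 1 :=
  ord_eq h.unif h.ne_zero (by simp)

theorem ord_nonneg_iff (h : IsParam O π) (hf : f ≠ 0) : 0 ≤ ord O f ↔ f ∈ O := by
  have hu := isUnif_iff.1 h.unif
  have h0 : 0 < O.valuation π := by simpa [zero_lt_iff] using hu.1
  rw [← O.valuation_le_one_iff, h.valuation_eq hf]
  have := (zpow_right_strictAnti₀ h0 hu.2.1).le_iff_ge (a := ord O f) (b := 0)
  rw [zpow_zero] at this
  exact this.symm

theorem ord_eq_zero_of_mem (h : IsParam O π) (hf : f ≠ 0) (h1 : f ∈ O) (h2 : f⁻¹ ∈ O) :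
    ord O f = 0 := by
  have h3 := (h.ord_nonneg_iff hf).2 h1
  have h4 := (h.ord_nonneg_iff (inv_ne_zero hf)).2 h2
  rw [h.ord_inv hf] at h4
  omega

end IsParam

end DiscreteOrder

/-! ## Rational function fields -/

section Generator

variable {k F : Type*} [Field k] [Field F] [Algebra k F]

/-- `F` is the field of rational functions over `k` in the variable `t`. -/
structure IsGenerator (k : Type*) {F : Type*} [Field k] [Field F] [Algebra k F] (t : F) : Prop where
  transcendental : Transcendental k t
  adjoin_eq : IntermediateField.adjoin k {t} = ⊤

namespace IsGenerator

variable {t : F}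

theorem aeval_ne_zero (h : IsGenerator k t) {p : Polynomial k} (hp : p ≠ 0) :
    Polynomial.aeval t p ≠ 0 := fun h0 =>
  hp ((transcendental_iff.1 h.transcendental) p h0)

theorem ne_zero (h : IsGenerator k t) : t ≠ 0 := by
  have := h.aeval_ne_zero (Polynomial.X_ne_zero (R := k))
  simpa using this

theorem exists_div (h : IsGenerator k t) (f : F) :
    ∃ p q : Polynomial k, q ≠ 0 ∧ f = Polynomial.aeval t p / Polynomial.aeval t q := by
  have hf : f ∈ IntermediateField.adjoin k {t} := by rw [h.adjoin_eq]; trivial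
  rw [IntermediateField.mem_adjoin_simple_iff] at hf
  obtain ⟨p, q, rfl⟩ := hf
  rcases eq_or_ne q 0 with rfl | hq
  · exact ⟨0, 1, one_ne_zero, by simp⟩
  · exact ⟨p, q, hq, rfl⟩

theorem inv (h : IsGenerator k t) : IsGenerator k t⁻¹ := by
  refine ⟨fun h0 => h.transcendental ?_, ?_⟩
  · simpa using h0.inv
  · refine eq_top_iff.2 (h.adjoin_eq ▸ ?_)
    rw [IntermediateField.adjoin_simple_le_iff]
    have := IntermediateField.mem_adjoin_simple_self k t⁻¹
    simpa using inv_mem this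

theorem sub_algebraMap (h : IsGenerator k t) (α : k) : IsGenerator k (t - algebraMap k F α) := by
  refine ⟨fun h0 => h.transcendental ?_, ?_⟩
  · simpa using h0.add (isAlgebraic_algebraMap α)
  · refine eq_top_iff.2 (h.adjoin_eq ▸ ?_)
    rw [IntermediateField.adjoin_simple_le_iff]
    have := IntermediateField.mem_adjoin_simple_self k (t - algebraMap k F α)
    simpa using add_mem this (IntermediateField.algebraMap_mem _ α)

/-- Over an algebraically closed field all rational functions are products of linear ones. -/
theorem induction [IsAlgClosed k] (h : IsGenerator k t) {P : F → Prop}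
    (const : ∀ c : k, c ≠ 0 → P (algebraMap k F c)) (linear : ∀ α : k, P (t - algebraMap k F α))
    (mul : ∀ f g, f ≠ 0 → g ≠ 0 → P f → P g → P (f * g)) (inv : ∀ f, f ≠ 0 → P f → P f⁻¹)
    {f : F} (hf : f ≠ 0) : P f := by
  have key : ∀ p : Polynomial k, p ≠ 0 → P (Polynomial.aeval t p) := by
    intro p hp
    have hs := (IsAlgClosed.splits p).eq_prod_roots
    have hm : ∀ s : Multiset k, (s.map fun a => t - algebraMap k F a).prod ≠ 0 ∧
        P (s.map fun a => t - algebraMap k F a).prod := by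
      intro s
      induction s using Multiset.induction_on with
      | empty => simpa using const 1 one_ne_zero
      | cons a s ih =>
        rw [Multiset.map_cons, Multiset.prod_cons]
        have h1 := (h.sub_algebraMap a).ne_zero
        exact ⟨mul_ne_zero h1 ih.1, mul _ _ h1 ih.1 (linear a) ih.2⟩
    rw [hs, map_mul, Polynomial.aeval_C, map_multiset_prod, Multiset.map_map]
    have hc : p.leadingCoeff ≠ 0 := Polynomial.leadingCoeff_ne_zero.2 hp
    have he : ((Polynomial.aeval t) ∘ fun a : k => Polynomial.X - Polynomial.C a) =
        fun a => t - algebraMap k F a := by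
      funext a; simp
    rw [he]
    exact mul _ _ (by simpa using hc) (hm _).1 (const _ hc) (hm _).2
  obtain ⟨p, q, hq, rfl⟩ := h.exists_div f
  have hp : p ≠ 0 := by rintro rfl; simp at hf
  rw [div_eq_mul_inv]
  exact mul _ _ (h.aeval_ne_zero hp) (inv_ne_zero (h.aeval_ne_zero hq)) (key p hp)
    (inv _ (h.aeval_ne_zero hq) (key q hq))

end IsGenerator

/-- The valuation ring `O` contains the constants, and `t` lies in its maximal ideal. -/
structure IsCentre (k : Type*) {F : Type*} [Field k] [Field F] [Algebra k F]
    (O : ValuationSubring F) (t : F) : Prop where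
  const_mem : ∀ c : k, algebraMap k F c ∈ O
  mem : t ∈ O
  inv_notMem : t⁻¹ ∉ O

namespace IsCentre

variable {O : ValuationSubring F} {t : F}

theorem aeval_mem (h : IsCentre k O t) (p : Polynomial k) : Polynomial.aeval t p ∈ O := by
  induction p using Polynomial.induction_on' with
  | add p q hp hq => rw [map_add]; exact add_mem hp hq
  | monomial n a =>
    rw [Polynomial.aeval_monomial]
    exact mul_mem (h.const_mem a) (pow_mem h.mem n)

theorem valuation_lt (h : IsCentre k O t) : O.valuation t < 1 :=
  (mem_and_inv_notMem_iff.1 ⟨h.mem, h.inv_notMem⟩).2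

theorem ne_zero (h : IsCentre k O t) : t ≠ 0 :=
  (mem_and_inv_notMem_iff.1 ⟨h.mem, h.inv_notMem⟩).1

theorem valuation_const (h : IsCentre k O t) {c : k} (hc : c ≠ 0) :
    O.valuation (algebraMap k F c) = 1 := by
  refine le_antisymm ((O.valuation_le_one_iff _).2 (h.const_mem c)) ?_
  have h1 := (O.valuation_le_one_iff _).2 (h.const_mem c⁻¹)
  rw [map_inv₀, map_inv₀] at h1
  have h0 : 0 < O.valuation (algebraMap k F c) := by simpa [zero_lt_iff] using hc
  exact (inv_le_one₀ h0).1 h1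

/-- The constant term has value 1 and the rest is a multiple of t, of value less than 1; the
constant term dominates. -/
theorem valuation_aeval (h : IsCentre k O t) {p : Polynomial k} (hp : p.coeff 0 ≠ 0) :
    O.valuation (Polynomial.aeval t p) = 1 := by
  have h1 : O.valuation (Polynomial.aeval t p.divX * t) < 1 := by
    rw [map_mul]
    exact (mul_le_of_le_one_left' ((O.valuation_le_one_iff _).2 (h.aeval_mem _))).trans_lt
      h.valuation_lt
  have h2 : Polynomial.aeval t p =
      Polynomial.aeval t p.divX * t + algebraMap k F (p.coeff 0) := by
    conv_lhs => rw [← Polynomial.divX_mul_X_add p]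
    simp
  have h3 := h.valuation_const hp
  rw [h2, Valuation.map_add_eq_of_lt_right _ (by rwa [h3]), h3]

/-- A polynomial is a power of the variable times a polynomial with non-zero constant term. -/
theorem exists_pow_mul {p : Polynomial k} (hp : p ≠ 0) :
    ∃ (n : ℕ) (q : Polynomial k), q.coeff 0 ≠ 0 ∧ p = Polynomial.X ^ n * q := by
  obtain ⟨q, hq, h⟩ := Polynomial.exists_eq_pow_rootMultiplicity_mul_and_not_dvd p hp 0
  rw [Polynomial.C_0, sub_zero] at hq h
  exact ⟨_, q, fun h0 => h (Polynomial.X_dvd_iff.2 h0), hq⟩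

/-- A non-zero polynomial in t is a power of t times one with non-zero constant term, which is a
unit. So all values are powers of the value of t. -/
theorem isParam (h : IsCentre k O t) (ht : IsGenerator k t) : IsParam O t := by
  have key : ∀ p : Polynomial k, p ≠ 0 →
      ∃ n : ℕ, O.valuation (Polynomial.aeval t p) = O.valuation t ^ n := by
    intro p hp
    obtain ⟨n, q, hq, rfl⟩ := exists_pow_mul hp
    exact ⟨n, by rw [map_mul, map_pow, Polynomial.aeval_X, map_mul, map_pow,
      h.valuation_aeval hq, mul_one]⟩
  have h0 : O.valuation t ≠ 0 := by simpa using h.ne_zero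
  have hz : ∀ f : F, f ≠ 0 → ∃ m : ℤ, O.valuation f = O.valuation t ^ m := by
    intro f hf
    obtain ⟨p, q, hq, rfl⟩ := ht.exists_div f
    have hp : p ≠ 0 := by rintro rfl; simp at hf
    obtain ⟨m, hm⟩ := key p hp
    obtain ⟨n, hn⟩ := key q hq
    exact ⟨m - n, by rw [map_div₀, hm, hn, zpow_sub₀ h0, zpow_natCast, zpow_natCast]⟩
  refine ⟨isUnif_iff.2 ⟨h.ne_zero, h.valuation_lt, fun x hx => ?_⟩, hz⟩
  rcases eq_or_ne x 0 with rfl | hx0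
  · simp
  obtain ⟨m, hm⟩ := hz x hx0
  have hpos : 0 < O.valuation t := zero_lt_iff.2 h0
  have hm1 : 1 ≤ m := by
    by_contra hlt
    have : m ≤ 0 := by omega
    rw [hm] at hx
    exact absurd hx (not_lt.2 (one_le_zpow_of_nonpos₀ hpos h.valuation_lt.le this))
  rw [hm]
  have := (zpow_right_strictAnti₀ hpos h.valuation_lt).antitone hm1
  simpa using this

/-- This identifies O with the localization of k[t] at the origin; hence at most one valuation ring
is centred at t. -/
theorem mem_iff (h : IsCentre k O t) (ht : IsGenerator k t) (f : F) :
    f ∈ O ↔ ∃ p q : Polynomial k, q.coeff 0 ≠ 0 ∧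
      f = Polynomial.aeval t p / Polynomial.aeval t q := by
  constructor
  · intro hf
    obtain ⟨p, q, hq, rfl⟩ := ht.exists_div f
    rcases eq_or_ne p 0 with rfl | hp
    · exact ⟨0, 1, by simp, by simp⟩
    obtain ⟨m, p', hp', rfl⟩ := exists_pow_mul hp
    obtain ⟨n, q', hq', rfl⟩ := exists_pow_mul hq
    have hv := (O.valuation_le_one_iff _).2 hf
    simp only [map_mul, map_pow, Polynomial.aeval_X, map_div₀, h.valuation_aeval hp',
      h.valuation_aeval hq', mul_one] at hv
    have h0 : 0 < O.valuation t := by simpa [zero_lt_iff] using h.ne_zero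
    rw [div_le_one₀ (pow_pos h0 n)] at hv
    have hnm : n ≤ m := (pow_right_strictAnti₀ h0 h.valuation_lt).le_iff_ge.1 hv
    refine ⟨Polynomial.X ^ (m - n) * p', q', hq', ?_⟩
    have ht0 := h.ne_zero
    have hq0 : Polynomial.aeval t q' ≠ 0 := ht.aeval_ne_zero (by rintro rfl; simp at hq')
    simp only [map_mul, map_pow, Polynomial.aeval_X]
    rw [div_eq_div_iff (mul_ne_zero (pow_ne_zero _ ht0) hq0) hq0]
    rw [← Nat.sub_add_cancel hnm, pow_add]
    simp only [Nat.add_sub_cancel]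
    ring
  · rintro ⟨p, q, hq, rfl⟩
    rw [← O.valuation_le_one_iff, map_div₀, h.valuation_aeval hq, div_one, O.valuation_le_one_iff]
    exact h.aeval_mem p

theorem eq_of_isCentre {O' : ValuationSubring F} (h : IsCentre k O t) (h' : IsCentre k O' t)
    (ht : IsGenerator k t) : O = O' := by
  ext f
  rw [h.mem_iff ht, h'.mem_iff ht]

end IsCentre

namespace IsGenerator

variable {t : F}

theorem exists_isCentre (ht : IsGenerator k t) : ∃ O : ValuationSubring F, IsCentre k O t := by
  let A : Subring F := (Polynomial.aeval (R := k) t).range.toSubring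
  have hA : ∀ p : Polynomial k, Polynomial.aeval t p ∈ A := fun p => ⟨p, rfl⟩
  let τ : A := ⟨t, by simpa using hA Polynomial.X⟩
  -- A relation 1 = t q(t) would contradict transcendence, so t generates a proper ideal of k[t],
  -- and some valuation ring makes this ideal consist of non-units.
  have hI : Ideal.span {τ} ≠ ⊤ := by
    rw [Ne, Ideal.eq_top_iff_one, Ideal.mem_span_singleton]
    rintro ⟨⟨_, q, rfl⟩, hq⟩
    have h1 : (1 : F) = t * Polynomial.aeval t q := congrArg Subtype.val hq
    refine ht.aeval_ne_zero (p := 1 - Polynomial.X * q) (fun h0 => ?_) ?_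
    · have := congrArg (fun p => Polynomial.coeff p 0) h0
      simp at this
    · simpa [sub_eq_zero] using h1
  obtain ⟨O, hO, hτ⟩ := Ideal.image_subset_nonunits_valuationSubring (Ideal.span {τ}) hI
  have h1 : t ∈ O.nonunits := hτ ⟨τ, Ideal.mem_span_singleton_self τ, rfl⟩
  rw [ValuationSubring.mem_nonunits_iff] at h1
  have h2 := mem_and_inv_notMem_iff.2 ⟨ht.ne_zero, h1⟩
  exact ⟨O, fun c => hO (by simpa using hA (Polynomial.C c)), h2.1, h2.2⟩

/-- If t is integral and every t - α is a unit of O, then all products of linear factors and their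
inverses lie in O, so O is the whole field. If t is not integral, then its inverse is a non-unit. -/
theorem isCentre_or [IsAlgClosed k] (ht : IsGenerator k t) {O : ValuationSubring F}
    (hO : ∀ c : k, algebraMap k F c ∈ O) (htop : O ≠ ⊤) :
    IsCentre k O t⁻¹ ∨ ∃ α : k, IsCentre k O (t - algebraMap k F α) := by
  by_cases h : t ∈ O
  · right
    by_contra! hα
    refine htop (eq_top_iff.2 fun f _ => ?_)
    have hlin : ∀ α : k, t - algebraMap k F α ∈ O ∧ (t - algebraMap k F α)⁻¹ ∈ O := by
      intro α
      refine ⟨sub_mem h (hO α), ?_⟩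
      by_contra hn
      exact hα α ⟨hO, sub_mem h (hO α), hn⟩
    rcases eq_or_ne f 0 with rfl | hf
    · exact zero_mem O
    refine (ht.induction (P := fun f => f ∈ O ∧ f⁻¹ ∈ O) (fun c _ => ⟨hO c, ?_⟩) hlin ?_ ?_ hf).1
    · rw [← map_inv₀]; exact hO _
    · rintro f g _ _ ⟨h1, h2⟩ ⟨h3, h4⟩
      exact ⟨mul_mem h1 h3, by rw [mul_inv]; exact mul_mem h2 h4⟩
    · rintro f _ ⟨h1, h2⟩
      exact ⟨h2, by rwa [inv_inv]⟩
  · left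
    refine ⟨hO, (O.mem_or_inv_mem t).resolve_left h, by rwa [inv_inv]⟩

/-- Rational functions have a derivation `d / dt`. -/
theorem exists_derivation (ht : IsGenerator k t) : ∃ d : Derivation k F F, d t = 1 := by
  let _ : Algebra (Polynomial k) F := (Polynomial.aeval t).toAlgebra
  have hal : ∀ p : Polynomial k, algebraMap (Polynomial k) F p = Polynomial.aeval t p := fun _ => rfl
  have : FaithfulSMul (Polynomial k) F := by
    rw [faithfulSMul_iff_algebraMap_injective, injective_iff_map_eq_zero]
    intro p hp
    by_contra h
    exact ht.aeval_ne_zero h hp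
  have : IsFractionRing (Polynomial k) F := by
    refine IsFractionRing.of_field (Polynomial k) F fun f => ?_
    obtain ⟨p, q, hq, rfl⟩ := ht.exists_div f
    exact ⟨p, q, by rw [hal, hal]⟩
  -- A derivation is the ε-part of a homomorphism to the dual numbers. Here t goes to t + ε;
  -- non-zero polynomials become units, so the map extends from k[t] to F.
  let g : Polynomial k →ₐ[k] DualNumber F :=
    Polynomial.aeval (TrivSqZeroExt.inl t + TrivSqZeroExt.inr 1)
  have hfst : ∀ p, (g p).fst = Polynomial.aeval t p := by
    intro p
    have : (TrivSqZeroExt.fstHom k F F).comp g = Polynomial.aeval t := by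
      ext; simp [g]
    exact DFunLike.congr_fun this p
  have hg : ∀ y : nonZeroDivisors (Polynomial k), IsUnit (g y) := by
    intro y
    rw [TrivSqZeroExt.isUnit_iff_isUnit_fst, hfst]
    exact (ht.aeval_ne_zero (nonZeroDivisors.ne_zero y.2)).isUnit
  let L : F →+* DualNumber F := IsLocalization.lift (M := nonZeroDivisors (Polynomial k))
    (g := (g : Polynomial k →+* DualNumber F)) hg
  have hL : ∀ p, L (Polynomial.aeval t p) = g p := fun p => by
    rw [← hal]; exact IsLocalization.lift_eq hg p
  have hLf : ∀ f, (L f).fst = f := by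
    intro f
    have : ((TrivSqZeroExt.fstHom F F F : DualNumber F →+* F)).comp L = RingHom.id F := by
      refine IsLocalization.ringHom_ext (nonZeroDivisors (Polynomial k)) (RingHom.ext fun p => ?_)
      simp only [RingHom.comp_apply, hal, hL, RingHom.id_apply]
      exact hfst p
    exact DFunLike.congr_fun this f
  have hLc : ∀ c : k, L (algebraMap k F c) = TrivSqZeroExt.inl (algebraMap k F c) := by
    intro c
    have := hL (Polynomial.C c)
    rw [Polynomial.aeval_C] at this
    rw [this]
    simp [g, TrivSqZeroExt.algebraMap_eq_inl']
  let d : F →ₗ[k] F :=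
    { toFun := fun f => (L f).snd
      map_add' := fun f g => by rw [map_add, TrivSqZeroExt.snd_add]
      map_smul' := fun c f => by
        rw [Algebra.smul_def, map_mul, hLc, RingHom.id_apply, Algebra.smul_def]
        simp }
  refine ⟨Derivation.mk' d fun f g => ?_, ?_⟩
  · change (L (f * g)).snd = f * (L g).snd + g * (L f).snd
    rw [map_mul, TrivSqZeroExt.snd_mul, hLf, hLf]
    simp [mul_comm]
  · change (L t).snd = 1
    have := hL Polynomial.X
    rw [Polynomial.aeval_X] at this
    rw [this]
    simp [g]

/-- The derivation `d / dt`. -/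
def deriv (ht : IsGenerator k t) : Derivation k F F := ht.exists_derivation.choose

@[simp] theorem deriv_self (ht : IsGenerator k t) : ht.deriv t = 1 :=
  ht.exists_derivation.choose_spec

/-- By the quotient rule a derivation of k(t) is determined by its value at t. Applied to the
universal derivation, this shows that the differentials are spanned by dt. -/
theorem derivation_eq (ht : IsGenerator k t) {M : Type*} [AddCommGroup M] [Module k M] [Module F M]
    [IsScalarTower k F M] (D : Derivation k F M) (f : F) : D f = ht.deriv f • D t := by
  obtain ⟨p, q, hq, rfl⟩ := ht.exists_div f
  rw [D.leibniz_div, ht.deriv.leibniz_div, D.map_aeval, D.map_aeval, ht.deriv.map_aeval,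
    ht.deriv.map_aeval, deriv_self]
  simp only [smul_smul, ← sub_smul, smul_eq_mul, mul_one]

theorem exists_smul_D (ht : IsGenerator k t) (ω : Ω[F⁄k]) :
    ∃ f : F, ω = f • KaehlerDifferential.D k F t := by
  have h : ω ∈ Submodule.span F (Set.range (KaehlerDifferential.D k F)) := by
    rw [KaehlerDifferential.span_range_derivation]; trivial
  induction h using Submodule.span_induction with
  | mem x hx =>
    obtain ⟨f, rfl⟩ := hx
    exact ⟨_, ht.derivation_eq _ f⟩
  | zero => exact ⟨0, by simp⟩
  | add x y _ _ hx hy =>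
    obtain ⟨f, rfl⟩ := hx
    obtain ⟨g, rfl⟩ := hy
    exact ⟨f + g, by rw [add_smul]⟩
  | smul a x _ hx =>
    obtain ⟨f, rfl⟩ := hx
    exact ⟨a * f, by rw [mul_smul]⟩

/-- The derivation d/dt induces a linear form on the differentials that takes the value 1 at dt. -/
theorem smul_D_injective (ht : IsGenerator k t) {f g : F}
    (h : f • KaehlerDifferential.D k F t = g • KaehlerDifferential.D k F t) : f = g := by
  have h1 := congrArg ht.deriv.liftKaehlerDifferential h
  simpa using h1

theorem D_ne_zero (ht : IsGenerator k t) : KaehlerDifferential.D k F t ≠ 0 := by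
  intro h
  exact one_ne_zero (ht.smul_D_injective (f := 1) (g := 0) (by rw [h, smul_zero, smul_zero]))

end IsGenerator

namespace IsCentre

variable {O : ValuationSubring F} {t : F}

theorem deriv_mem (h : IsCentre k O t) (ht : IsGenerator k t) {f : F} (hf : f ∈ O) :
    ht.deriv f ∈ O := by
  obtain ⟨p, q, hq, rfl⟩ := (h.mem_iff ht f).1 hf
  rw [ht.deriv.leibniz_div, ht.deriv.map_aeval, ht.deriv.map_aeval, ht.deriv_self]
  have hinv : (Polynomial.aeval t q)⁻¹ ∈ O := by
    rw [← O.valuation_le_one_iff, map_inv₀, h.valuation_aeval hq, inv_one]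
  simp only [smul_eq_mul, mul_one]
  exact mul_mem (pow_mem hinv 2) (sub_mem (mul_mem (h.aeval_mem _) (h.aeval_mem _))
    (mul_mem (h.aeval_mem _) (h.aeval_mem _)))

/-- Write π = t u with a unit u. Then dπ/dt = u + t du/dt, and the second term lies in the maximal
ideal because d/dt preserves O. -/
theorem valuation_deriv_unif (h : IsCentre k O t) (ht : IsGenerator k t) {π : F}
    (hπ : IsUnif O π) : O.valuation (ht.deriv π) = 1 := by
  have hu : O.valuation (π / t) = 1 := by
    rw [map_div₀, hπ.valuation_eq (h.isParam ht).unif]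
    exact div_self (by simpa using h.ne_zero)
  have hm : π / t ∈ O := (O.valuation_le_one_iff _).1 hu.le
  have h1 : ht.deriv π = t * ht.deriv (π / t) + π / t := by
    have h0 := h.ne_zero
    have h2 : π = t * (π / t) := by field_simp
    conv_lhs => rw [h2]
    rw [Derivation.leibniz, ht.deriv_self]
    simp
  rw [h1, Valuation.map_add_eq_of_lt_right, hu]
  rw [hu, map_mul]
  exact (mul_le_of_le_one_right' ((O.valuation_le_one_iff _).2 (h.deriv_mem ht hm))).trans_lt
    h.valuation_lt

/-- The order of `f dπ` is the order of `f`, for every uniformizer `π`. -/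
theorem ord_eq_of_smul_D_eq (h : IsCentre k O t) (ht : IsGenerator k t) {π f g : F}
    (hπ : IsUnif O π) (hf : f ≠ 0)
    (he : f • KaehlerDifferential.D k F t = g • KaehlerDifferential.D k F π) :
    ord O g = ord O f := by
  rw [ht.derivation_eq (KaehlerDifferential.D k F) π, smul_smul] at he
  have h1 := ht.smul_D_injective he
  have hg : g ≠ 0 := by rintro rfl; simp [hf] at h1
  have hd : ht.deriv π ≠ 0 := by rintro h0; simp [hf, h0] at h1
  have hp := h.isParam ht
  rw [h1, hp.ord_mul hg hd, ord_eq hp.unif hd (m := 0) (by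
    rw [zpow_zero, h.valuation_deriv_unif ht hπ]), add_zero]

end IsCentre

end Generator

namespace QuasiProj

/-! ### Algebraic structures on the function field and on the fraction field -/

section Shortcuts

variable {K : Type*} [Field K] {n : ℕ} (V : QuasiProj K n) [hV : V.IsIrred]

instance : Field V.Frac := inferInstance
instance : CommRing V.Frac := inferInstance
instance : DivisionRing V.Frac := inferInstance
instance : Semiring V.Frac := inferInstance
instance : GroupWithZero V.Frac := inferInstance
instance : MonoidWithZero V.Frac := inferInstance
instance : Div V.Frac := inferInstance
instance : Algebra (AlgebraicClosure K) V.Frac := inferInstance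
instance : Algebra K V.Frac := inferInstance
instance : IsScalarTower K (AlgebraicClosure K) V.Frac := inferInstance
instance : CommRing V.FunField := inferInstance
instance : Field V.FunField := inferInstance
instance : DivisionRing V.FunField := inferInstance
instance : Semiring V.FunField := inferInstance
instance : CommSemiring V.FunField := inferInstance
instance : GroupWithZero V.FunField := inferInstance
instance : MonoidWithZero V.FunField := inferInstance
instance : AddCommGroup V.FunField := inferInstance
instance : Algebra (AlgebraicClosure K) V.FunField := inferInstance
instance : Algebra K V.FunField := inferInstance
instance : Algebra V.FunField V.Frac := inferInstance
instance : IsScalarTower (AlgebraicClosure K) V.FunField V.Frac := inferInstance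
instance : Module V.FunField (Ω[V.FunField⁄AlgebraicClosure K]) := inferInstance
instance : Algebra V.RatField V.FunField := inferInstance
instance : IsScalarTower K V.RatField V.FunField := inferInstance

end Shortcuts

/-! ## Lines -/

section Line

universe u

/-- The vector with coordinates `cᵣ s + dᵣ t`. -/
def lineVec {K E : Type*} [Field K] [Field E] {n : ℕ} (c d : Fin (n + 1) → K) (φ : K →+* E)
    (s t : E) : Fin (n + 1) → E := fun r => φ (c r) * s + φ (d r) * t

/-- The points of `V` over `E` lie on the line `xᵣ = cᵣ xⱼ + dᵣ xᵢ`, and they include all points of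
this line with `xⱼ ≠ 0`. -/
structure IsLineOver {K E : Type*} [Field K] [Field E] {n : ℕ} (V : QuasiProj K n)
    (i j : Fin (n + 1)) (c d : Fin (n + 1) → K) (φ : K →+* E) : Prop where
  eq_lineVec : ∀ x ∈ V.cone φ, x = lineVec c d φ (x j) (x i)
  mem_cone : ∀ s t : E, s ≠ 0 → lineVec c d φ s t ∈ V.cone φ

/-- `V` is the line `xᵣ = cᵣ xⱼ + dᵣ xᵢ`, possibly without the point `xⱼ = 0`. -/
structure IsLine {K : Type u} [Field K] {n : ℕ} (V : QuasiProj K n)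
    (i j : Fin (n + 1)) (c d : Fin (n + 1) → K) : Prop where
  c_j : c j = 1
  d_j : d j = 0
  c_i : c i = 0
  d_i : d i = 1
  -- No coordinate mixes the two parameters. This makes the maximum norm on the line split, at
  -- archimedean places too.
  c_or_d : ∀ r, c r = 0 ∨ d r = 0
  -- The algebraic closure and the completions of K live in the universe of K, whereas ℂ need not;
  -- hence the separate field for ℂ.
  isLineOver : ∀ {E : Type u} [Field E] (φ : K →+* E), V.IsLineOver i j c d φ
  isLineOver_complex : ∀ φ : K →+* ℂ, V.IsLineOver i j c d φ

variable {K : Type u} [Field K] {n : ℕ} {V : QuasiProj K n} {i j : Fin (n + 1)}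
  {c d : Fin (n + 1) → K}

/-- The homogenization of degree `N` of a polynomial in one variable. -/
def homog {k : Type*} [Field k] (i j : Fin (n + 1)) (N : ℕ) (p : Polynomial k) :
    MvPolynomial (Fin (n + 1)) k :=
  ∑ m ∈ Finset.range (N + 1), C (p.coeff m) * X i ^ m * X j ^ (N - m)

/-- The ring map is arbitrary so that the identity serves both for restricting forms to V
(`form_homog`) and for evaluating them at a point (`eval_homog`). -/
theorem map_homog {k L : Type*} [Field k] [Field L] (Φ : MvPolynomial (Fin (n + 1)) k →+* L)
    (i j : Fin (n + 1)) {N : ℕ} {p : Polynomial k} (hp : p.natDegree ≤ N) (hj : Φ (X j) ≠ 0) :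
    Φ (homog i j N p) =
      Φ (X j) ^ N * p.eval₂ (Φ.comp C) (Φ (X i) / Φ (X j)) := by
  rw [Polynomial.eval₂_eq_sum_range' _ (Nat.lt_succ_of_le hp), homog, map_sum, Finset.mul_sum]
  refine Finset.sum_congr rfl fun m hm => ?_
  have hm' : m ≤ N := Nat.lt_succ_iff.1 (Finset.mem_range.1 hm)
  obtain ⟨l, rfl⟩ := Nat.exists_eq_add_of_le hm'
  simp only [map_mul, map_pow, RingHom.comp_apply, Nat.add_sub_cancel_left, div_pow, pow_add]
  field_simp

/-- The restriction of forms to a line. -/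
def lineSubst (c d : Fin (n + 1) → K) (r : Fin (n + 1)) :
    MvPolynomial (Fin 2) (AlgebraicClosure K) :=
  C (algebraMap K (AlgebraicClosure K) (c r)) * X 0 +
    C (algebraMap K (AlgebraicClosure K) (d r)) * X 1

theorem eval₂_lineSubst (c d : Fin (n + 1) → K) {E : Type*} [Field E]
    (σ : AlgebraicClosure K →+* E) (x : Fin 2 → E)
    (f : MvPolynomial (Fin (n + 1)) (AlgebraicClosure K)) :
    (aeval (lineSubst c d) f).eval₂ σ x =
      f.eval₂ σ (lineVec c d (σ.comp (algebraMap K (AlgebraicClosure K))) (x 0) (x 1)) := by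
  induction f using MvPolynomial.induction_on with
  | C a => simp
  | add f g hf hg => rw [map_add, eval₂_add, hf, hg, eval₂_add]
  | mul_X f r hf => rw [map_mul, eval₂_mul, hf, eval₂_mul, aeval_X]; simp [lineVec, lineSubst]

theorem exists_isCoprime_mul {k : Type*} [Field k] (P : Polynomial k) {Q : Polynomial k}
    (hQ : Q ≠ 0) : ∃ g P' Q', IsCoprime P' Q' ∧ P = P' * g ∧ Q = Q' * g := by
  classical
  let _ := EuclideanDomain.gcdMonoid (Polynomial k)
  have hg : GCDMonoid.gcd P Q ≠ 0 := gcd_ne_zero_of_right hQ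
  have h1 : P = P / GCDMonoid.gcd P Q * GCDMonoid.gcd P Q := by
    rw [mul_comm, EuclideanDomain.mul_div_cancel' hg (gcd_dvd_left P Q)]
  have h2 : Q = Q / GCDMonoid.gcd P Q * GCDMonoid.gcd P Q := by
    rw [mul_comm, EuclideanDomain.mul_div_cancel' hg (gcd_dvd_right P Q)]
  exact ⟨_, _, _, isCoprime_div_gcd_div_gcd hQ, h1, h2⟩

namespace IsLine

theorem lineVec_j (h : V.IsLine i j c d) {E : Type*} [Field E] (φ : K →+* E) (s t : E) :
    lineVec c d φ s t j = s := by simp [lineVec, h.c_j, h.d_j]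

theorem lineVec_i (h : V.IsLine i j c d) {E : Type*} [Field E] (φ : K →+* E) (s t : E) :
    lineVec c d φ s t i = t := by simp [lineVec, h.c_i, h.d_i]

variable (h : V.IsLine i j c d)

include h

theorem eval_eq_zero {f : MvPolynomial (Fin (n + 1)) (AlgebraicClosure K)} (hf : f ∈ V.ideal)
    {s : AlgebraicClosure K} (hs : s ≠ 0) (t : AlgebraicClosure K) :
    f.eval (lineVec c d (algebraMap K (AlgebraicClosure K)) s t) = 0 := by
  rw [QuasiProj.ideal, mem_vanishingIdeal_iff] at hf
  have := hf _ ((h.isLineOver _).mem_cone s t hs)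
  rwa [MvPolynomial.aeval_eq_eval] at this

/-- Forms which vanish on `V` vanish at the points over all fields. -/
theorem eval₂_eq_zero {f : MvPolynomial (Fin (n + 1)) (AlgebraicClosure K)} (hf : f ∈ V.ideal)
    {E : Type*} [Field E] (σ : AlgebraicClosure K →+* E) (s t : E) :
    f.eval₂ σ (lineVec c d (σ.comp (algebraMap K (AlgebraicClosure K))) s t) = 0 := by
  -- Only parameters with s ≠ 0 are known to give points of V; the factor X 0 covers the rest. The
  -- resulting identity of polynomials can then be transported by σ to any field.
  have h0 : X 0 * aeval (lineSubst c d) f = 0 := by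
    apply MvPolynomial.funext
    intro z
    rw [map_mul, eval_X, map_zero, mul_eq_zero]
    by_cases hz : z 0 = 0
    · exact Or.inl hz
    · right
      have h1 := eval₂_lineSubst c d (RingHom.id (AlgebraicClosure K)) z f
      have h2 := h.eval_eq_zero hf hz (z 1)
      rw [MvPolynomial.eval, coe_eval₂Hom] at h2 ⊢
      rw [h1]
      exact h2
  have h1 := (mul_eq_zero.1 h0).resolve_left (X_ne_zero 0)
  have h2 := eval₂_lineSubst c d σ ![s, t] f
  rw [h1, eval₂_zero] at h2
  exact h2.symm

variable [hV : V.IsIrred]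

omit h hV in
theorem form_eq_iff [V.IsIrred] {f g : MvPolynomial (Fin (n + 1)) (AlgebraicClosure K)} :
    V.form f = V.form g ↔ f - g ∈ V.ideal := by
  rw [form, RingHom.comp_apply, RingHom.comp_apply, (IsFractionRing.injective _ _).eq_iff,
    Ideal.Quotient.eq]

theorem eval₂_eq_of_form_eq {f g : MvPolynomial (Fin (n + 1)) (AlgebraicClosure K)}
    (hfg : V.form f = V.form g) {E : Type*} [Field E] (σ : AlgebraicClosure K →+* E) (s t : E) :
    f.eval₂ σ (lineVec c d (σ.comp (algebraMap K (AlgebraicClosure K))) s t) =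
      g.eval₂ σ (lineVec c d (σ.comp (algebraMap K (AlgebraicClosure K))) s t) := by
  have := h.eval₂_eq_zero (form_eq_iff.1 hfg) σ s t
  rwa [eval₂_sub, sub_eq_zero] at this

omit h hV in
theorem form_C [V.IsIrred] (a : AlgebraicClosure K) :
    V.form (C a) = algebraMap (AlgebraicClosure K) V.Frac a := rfl

theorem coord_eq (r : Fin (n + 1)) :
    V.coord r = algebraMap K V.Frac (c r) * V.coord j + algebraMap K V.Frac (d r) * V.coord i := by
  have h1 : X r - (C (algebraMap K (AlgebraicClosure K) (c r)) * X j +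
      C (algebraMap K (AlgebraicClosure K) (d r)) * X i) ∈ V.ideal := by
    rw [QuasiProj.ideal, mem_vanishingIdeal_iff]
    intro x hx
    have := congrFun ((h.isLineOver _).eq_lineVec x hx) r
    simp only [map_sub, map_add, map_mul, aeval_X, aeval_C, Algebra.algebraMap_self,
      RingHom.id_apply]
    rw [this]
    simp [lineVec]
  have h2 := form_eq_iff.2 h1
  simpa [coord, form_C, ← IsScalarTower.algebraMap_apply] using h2

theorem coord_ne_zero_of_eval {r : Fin (n + 1)} {s : AlgebraicClosure K} (hs : s ≠ 0)
    (t : AlgebraicClosure K)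
    (hr : lineVec c d (algebraMap K (AlgebraicClosure K)) s t r ≠ 0) : V.coord r ≠ 0 := by
  intro h0
  rw [coord, ← map_zero V.form, form_eq_iff, sub_zero] at h0
  have := h.eval_eq_zero h0 hs t
  rw [eval_X] at this
  exact hr this

theorem coord_j_ne_zero : V.coord j ≠ 0 :=
  h.coord_ne_zero_of_eval one_ne_zero 0 (by rw [h.lineVec_j]; exact one_ne_zero)

theorem coord_i_ne_zero : V.coord i ≠ 0 :=
  h.coord_ne_zero_of_eval one_ne_zero 1 (by rw [h.lineVec_i]; exact one_ne_zero)

theorem form_homog {N : ℕ} {p : Polynomial (AlgebraicClosure K)} (hp : p.natDegree ≤ N) :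
    V.form (homog i j N p) = V.coord j ^ N * Polynomial.aeval (V.coord i / V.coord j) p :=
  map_homog V.form i j hp h.coord_j_ne_zero

omit hV in
theorem eval_homog {N : ℕ} {p : Polynomial (AlgebraicClosure K)} (hp : p.natDegree ≤ N)
    {E : Type*} [Field E] (σ : AlgebraicClosure K →+* E) (t : E) :
    (homog i j N p).eval₂ σ (lineVec c d (σ.comp (algebraMap K (AlgebraicClosure K))) 1 t) =
      p.eval₂ σ t := by
  have h1 := map_homog (eval₂Hom σ
    (lineVec c d (σ.comp (algebraMap K (AlgebraicClosure K))) 1 t)) i j hp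
    (by rw [eval₂Hom_X', h.lineVec_j]; exact one_ne_zero)
  rw [eval₂Hom_X', h.lineVec_j, eval₂Hom_X', h.lineVec_i, one_pow, one_mul, div_one] at h1
  rw [← coe_eval₂Hom, h1]
  congr 1
  ext a
  simp

/-- An algebraic relation p homogenizes to a form vanishing on V; at the point with parameters (1,
τ) this form takes the value p(τ), so p vanishes everywhere. -/
theorem ratio_transcendental : Transcendental (AlgebraicClosure K) (V.coord i / V.coord j) := by
  rw [transcendental_iff]
  intro p hp
  have h1 := h.form_homog le_rfl (p := p)
  rw [hp, mul_zero, ← map_zero V.form] at h1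
  apply Polynomial.funext
  intro τ
  have h2 := h.eval₂_eq_of_form_eq h1 (RingHom.id _) 1 τ
  rw [h.eval_homog le_rfl, eval₂_zero] at h2
  rw [Polynomial.eval_zero, ← h2]
  rfl

theorem coord_div_coord_mem (r s : Fin (n + 1)) : V.coord r / V.coord s ∈
    IntermediateField.adjoin (AlgebraicClosure K) {V.coord i / V.coord j} := by
  have h1 : ∀ r, V.coord r / V.coord j ∈
      IntermediateField.adjoin (AlgebraicClosure K) {V.coord i / V.coord j} := by
    intro r
    have : V.coord r / V.coord j = algebraMap K V.Frac (c r) +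
        algebraMap K V.Frac (d r) * (V.coord i / V.coord j) := by
      have := h.coord_j_ne_zero
      rw [h.coord_eq r]
      field_simp
    rw [this]
    rw [IsScalarTower.algebraMap_apply K (AlgebraicClosure K) V.Frac,
      IsScalarTower.algebraMap_apply K (AlgebraicClosure K) V.Frac]
    exact add_mem (IntermediateField.algebraMap_mem _ _)
      (mul_mem (IntermediateField.algebraMap_mem _ _)
        (IntermediateField.mem_adjoin_simple_self _ _))
  have := div_mem (h1 r) (h1 s)
  rwa [div_div_div_cancel_right₀ h.coord_j_ne_zero] at this

/-- The function field of a line consists of the rational functions in `xᵢ / xⱼ`. -/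
theorem isGenerator : IsGenerator (AlgebraicClosure K) (V.ratio i j) := by
  constructor
  · intro h0
    exact h.ratio_transcendental (h0.algebraMap (A := V.Frac))
  · refine eq_top_iff.2 fun f _ => ?_
    have hf : (f : V.Frac) ∈
        IntermediateField.adjoin (AlgebraicClosure K) {V.coord i / V.coord j} := by
      have : V.FunField ≤
          IntermediateField.adjoin (AlgebraicClosure K) {V.coord i / V.coord j} := by
        refine IntermediateField.adjoin_le_iff.2 ?_
        rintro _ ⟨r, s, rfl⟩
        exact h.coord_div_coord_mem r s
      exact this f.2
    rw [IntermediateField.mem_adjoin_simple_iff] at hf ⊢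
    obtain ⟨p, q, hpq⟩ := hf
    refine ⟨p, q, Subtype.ext ?_⟩
    have h2 : ∀ p : Polynomial (AlgebraicClosure K),
        ((Polynomial.aeval (V.ratio i j) p : V.FunField) : V.Frac) =
          Polynomial.aeval (V.coord i / V.coord j) p := fun p =>
      (Polynomial.aeval_algebraMap_apply V.Frac (V.ratio i j) p).symm
    rw [hpq, IntermediateField.coe_div, h2, h2]

omit h in
theorem coe_aeval (p : Polynomial (AlgebraicClosure K)) :
    ((Polynomial.aeval (V.ratio i j) p : V.FunField) : V.Frac) =
      Polynomial.aeval (V.coord i / V.coord j) p :=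
  (Polynomial.aeval_algebraMap_apply V.Frac (V.ratio i j) p).symm

omit hV in
-- The bound is examined near the point at infinity, on t = 1 with s → 0. After division by |s|^m
-- the left side tends to the absolute value of the leading coefficient of P, while the right side
-- carries |s|^(deg P - m) and tends to 0 if deg P > m. Only s ≠ 0 is used, so the point at infinity
-- need not belong to V.
theorem natDegree_le_of_bound (σ : AlgebraicClosure K →+* ℂ) {m : ℕ}
    {P : Polynomial (AlgebraicClosure K)} {q : AlgebraicClosure K} {B : ℝ}
    (key : ∀ s t : ℂ, s ≠ 0 →
      ‖s ^ m * (homog i j P.natDegree P).eval₂ σ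
          (lineVec c d (σ.comp (algebraMap K (AlgebraicClosure K))) s t)‖ ≤
        B * ‖lineVec c d (σ.comp (algebraMap K (AlgebraicClosure K))) s t‖ ^ m *
          ‖(homog i j P.natDegree (Polynomial.C q)).eval₂ σ
            (lineVec c d (σ.comp (algebraMap K (AlgebraicClosure K))) s t)‖) :
    P.natDegree ≤ m := by
  by_contra! hlt
  set D := P.natDegree
  let vec : ℂ → Fin (n + 1) → ℂ :=
    fun s => lineVec c d (σ.comp (algebraMap K (AlgebraicClosure K))) s 1
  have hvec : Continuous vec := by
    refine continuous_pi fun r => ?_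
    simp only [vec, lineVec]
    fun_prop
  have hvj : ∀ s, vec s j = s := fun s => h.lineVec_j _ _ _
  have hvi : ∀ s, vec s i = 1 := fun s => h.lineVec_i _ _ _
  have hF : ∀ (p : Polynomial (AlgebraicClosure K)) (s : ℂ), (homog i j D p).eval₂ σ (vec s) =
      ∑ r ∈ Finset.range (D + 1), σ (p.coeff r) * s ^ (D - r) := by
    intro p s
    simp only [homog, eval₂_sum, eval₂_mul, eval₂_pow, eval₂_X, eval₂_C, hvj, hvi, one_pow,
      mul_one]
  have hle : ∀ s : ℂ, s ≠ 0 → ‖∑ r ∈ Finset.range (D + 1), σ (P.coeff r) * s ^ (D - r)‖ ≤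
      B * ‖vec s‖ ^ m * (‖σ q‖ * ‖s‖ ^ (D - m)) := by
    intro s hs
    have h1 := key s 1 hs
    change ‖s ^ m * (homog i j D P).eval₂ σ (vec s)‖ ≤ B * ‖vec s‖ ^ m *
      ‖(homog i j D (Polynomial.C q)).eval₂ σ (vec s)‖ at h1
    have h2 : ∑ r ∈ Finset.range (D + 1), σ ((Polynomial.C q).coeff r) * s ^ (D - r) =
        σ q * s ^ D := by
      rw [Finset.sum_eq_single 0]
      · simp
      · intro r _ hr
        simp [Polynomial.coeff_C, hr]
      · simp
    rw [hF, hF, h2, norm_mul, norm_mul, norm_pow, norm_pow] at h1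
    have h3 : 0 < ‖s‖ ^ m := pow_pos (norm_pos_iff.2 hs) m
    refine le_of_mul_le_mul_left (h1.trans_eq ?_) h3
    obtain ⟨l, hl⟩ := Nat.exists_eq_add_of_lt hlt
    rw [hl, show m + l + 1 - m = l + 1 by omega]
    ring
  have hlim := le_of_tendsto_of_tendsto (b := 𝓝[≠] (0 : ℂ))
    (f := fun s => ‖∑ r ∈ Finset.range (D + 1), σ (P.coeff r) * s ^ (D - r)‖)
    (g := fun s => B * ‖vec s‖ ^ m * (‖σ q‖ * ‖s‖ ^ (D - m)))
    ((by fun_prop : Continuous _).continuousWithinAt)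
    ((by fun_prop : Continuous _).continuousWithinAt)
    (eventually_nhdsWithin_of_forall hle)
  rw [Finset.sum_eq_single D] at hlim
  · have hD : D - m ≠ 0 := by omega
    simp only [Nat.sub_self, pow_zero, mul_one, norm_zero, zero_pow hD, mul_zero,
      norm_le_zero_iff, map_eq_zero] at hlim
    have : P = 0 := Polynomial.leadingCoeff_eq_zero.1 hlim
    have h0 : D = 0 := by simp [D, this]
    omega
  · intro r hr hrD
    have : r < D := lt_of_le_of_ne (Nat.lt_succ_iff.1 (Finset.mem_range.1 hr)) hrD
    rw [zero_pow (by omega), mul_zero]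
  · simp

/-- Sections of `𝒪(m)` of bounded norm are given by polynomials of degree at most `m`. -/
theorem exists_polynomial_of_mem_boundedSec (σ : AlgebraicClosure K →+* ℂ) {m : ℕ} {u : V.Frac}
    (hu : u ∈ V.boundedSec m) : ∃ p : Polynomial (AlgebraicClosure K), p.natDegree ≤ m ∧
      u = V.coord j ^ m * Polynomial.aeval (V.coord i / V.coord j) p := by
  obtain ⟨hu1, -, hu2⟩ := hu
  obtain ⟨B, hB⟩ := hu2 σ
  have hj := h.coord_j_ne_zero
  obtain ⟨P, Q, hPQ, hQ0, hf⟩ : ∃ P Q : Polynomial (AlgebraicClosure K), IsCoprime P Q ∧ Q ≠ 0 ∧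
      u / V.coord j ^ m = Polynomial.aeval (V.coord i / V.coord j) P /
        Polynomial.aeval (V.coord i / V.coord j) Q := by
    obtain ⟨P, Q, hQ, hf⟩ := h.isGenerator.exists_div ⟨_, hu1 j⟩
    have hf' := congrArg Subtype.val hf
    rw [IntermediateField.coe_div, coe_aeval, coe_aeval] at hf'
    obtain ⟨g, P', Q', hc, rfl, rfl⟩ := exists_isCoprime_mul P hQ
    refine ⟨P', Q', hc, left_ne_zero_of_mul hQ, hf'.trans ?_⟩
    rw [map_mul, map_mul, mul_div_mul_right]
    rw [← coe_aeval]
    have := h.isGenerator.aeval_ne_zero (right_ne_zero_of_mul hQ)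
    simpa using this
  have hQt : Polynomial.aeval (V.coord i / V.coord j) Q ≠ 0 := by
    rw [← coe_aeval]
    simpa using h.isGenerator.aeval_ne_zero hQ0
  set N := max P.natDegree Q.natDegree
  -- The section has the local expression xⱼ^m P / Q, with P and Q homogenized to the same degree N;
  -- this is the norm bound for it.
  have key : ∀ s t : ℂ, s ≠ 0 →
      ‖s ^ m * (homog i j N P).eval₂ σ (lineVec c d (σ.comp (algebraMap _ _)) s t)‖ ≤
        B * ‖lineVec c d (σ.comp (algebraMap K (AlgebraicClosure K))) s t‖ ^ m *
          ‖(homog i j N Q).eval₂ σ (lineVec c d (σ.comp (algebraMap _ _)) s t)‖ := by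
    intro s t hs
    have := hB _ ((h.isLineOver_complex _).mem_cone s t hs) (X j ^ m * homog i j N P)
      (homog i j N Q) (by
        rw [map_mul, map_pow, h.form_homog (le_max_left _ _), h.form_homog (le_max_right _ _)]
        change _ = V.coord j ^ m * _
        rw [div_eq_div_iff (pow_ne_zero _ hj) hQt] at hf
        linear_combination V.coord j ^ N * hf)
    rwa [eval₂_mul, eval₂_pow, eval₂_X, h.lineVec_j] at this
  -- At a zero of Q the bound forces P to vanish as well, against coprimality. So Q is constant over
  -- the algebraically closed field.
  have hQ : ∀ a, Q.eval a ≠ 0 := by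
    intro a ha
    have := key 1 (σ a) one_ne_zero
    rw [h.eval_homog (le_max_left _ _), h.eval_homog (le_max_right _ _), Polynomial.eval₂_at_apply,
      Polynomial.eval₂_at_apply, ha] at this
    simp only [map_zero, norm_zero, mul_zero, one_pow, one_mul, norm_le_zero_iff,
      map_eq_zero] at this
    obtain ⟨x, y, hxy⟩ := hPQ
    have h1 := congrArg (Polynomial.eval a) hxy
    simp [this, ha] at h1
  have hQd : Q.natDegree = 0 := by
    by_contra hd
    obtain ⟨a, ha⟩ := IsAlgClosed.exists_root Q
      (fun h0 => hd (Polynomial.natDegree_eq_zero_iff_degree_le_zero.2 h0.le))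
    exact hQ a ha
  obtain ⟨q, rfl⟩ := Polynomial.natDegree_eq_zero.1 hQd
  have hq : q ≠ 0 := by rintro rfl; simp at hQ0
  refine ⟨Polynomial.C q⁻¹ * P, (Polynomial.natDegree_C_mul_le _ _).trans ?_, ?_⟩
  · exact h.natDegree_le_of_bound σ (B := B) (q := q) fun s t hs => by
      have hN : N = P.natDegree := by simp [N]
      rw [← hN]
      exact key s t hs
  · rw [div_eq_iff (pow_ne_zero _ hj)] at hf
    rw [hf, map_mul, Polynomial.aeval_C, Polynomial.aeval_C, map_inv₀]
    field_simp

/-- The bound is |xᵣ| ≤ max |xₖ|, with constant 1; every local expression p / q satisfies xᵣ q = p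
at the complex points. -/
theorem coord_mem_boundedSec (r : Fin (n + 1)) : V.coord r ∈ V.boundedSec 1 := by
  refine ⟨fun s => ?_, fun x _ => ⟨X r, 1, by simp, by simp [coord]⟩, fun σ => ⟨1, ?_⟩⟩
  · rw [pow_one]
    exact (V.ratio r s).2
  · intro x hx p q hpq
    have h1 : V.form (X r * q) = V.form p := by rw [map_mul]; exact hpq
    have h2 := (h.isLineOver_complex _).eq_lineVec x hx
    have h3 := h.eval₂_eq_of_form_eq h1 σ (x j) (x i)
    rw [← h2, eval₂_mul, eval₂_X] at h3
    rw [← h3, norm_mul, pow_one, one_mul]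
    gcongr
    exact norm_le_pi_norm x r

end IsLine

end Line

end QuasiProj

namespace QuasiProj

/-! ## Orders at the places of a line -/

section LineOrder

universe u

variable {K : Type u} [Field K] {n : ℕ} {V : QuasiProj K n} {i j : Fin (n + 1)}
  {c d : Fin (n + 1) → K} [hV : V.IsIrred]

/-- Elements of the algebraic closure are integral over K, and a valuation ring is integrally
closed. -/
theorem Place.algebraMap_mem (P : V.Place) (a : AlgebraicClosure K) :
    algebraMap (AlgebraicClosure K) V.FunField a ∈ P.1 := by
  have ha : IsIntegral K a := Algebra.IsIntegral.isIntegral a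
  have h1 : IsIntegral P.1 (algebraMap (AlgebraicClosure K) V.FunField a) := by
    obtain ⟨p, hp, hpa⟩ := ha
    let φ : K →+* P.1 := (algebraMap K V.FunField).codRestrict P.1.toSubring P.2.1
    refine ⟨p.map φ, hp.map φ, ?_⟩
    rw [Polynomial.eval₂_map]
    have : (algebraMap P.1 V.FunField).comp φ =
        (algebraMap (AlgebraicClosure K) V.FunField).comp (algebraMap K (AlgebraicClosure K)) := by
      exact RingHom.ext (IsScalarTower.algebraMap_apply K (AlgebraicClosure K) V.FunField)
    rw [this, ← Polynomial.hom_eval₂, hpa, map_zero]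
  obtain ⟨y, hy⟩ := (IsIntegrallyClosed.isIntegral_iff (R := P.1) (K := V.FunField)).1 h1
  rw [← hy]
  exact y.2

/-- The order of the pole of `xᵢ / xⱼ`: it is `1` at the point at infinity and `0` elsewhere. -/
def poleOrd (i j : Fin (n + 1)) (P : V.Place) : ℤ :=
  open Classical in if V.ratio i j ∈ P.1 then 0 else 1

namespace IsLine

variable (h : V.IsLine i j c d)

include h

/-- The places of the function field of a line. -/
theorem isCentre_or (P : V.Place) :
    (poleOrd i j P = 1 ∧ IsCentre (AlgebraicClosure K) P.1 (V.ratio i j)⁻¹) ∨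
    (poleOrd i j P = 0 ∧ ∃ α, IsCentre (AlgebraicClosure K) P.1
      (V.ratio i j - algebraMap (AlgebraicClosure K) V.FunField α)) := by
  rcases h.isGenerator.isCentre_or P.algebraMap_mem P.2.2 with h1 | ⟨α, h1⟩
  · left
    refine ⟨if_neg ?_, h1⟩
    simpa using h1.inv_notMem
  · right
    refine ⟨if_pos ?_, α, h1⟩
    simpa using add_mem h1.mem (P.algebraMap_mem α)

theorem exists_isParam (P : V.Place) : ∃ π, IsParam P.1 π := by
  rcases h.isCentre_or P with ⟨-, h1⟩ | ⟨-, α, h1⟩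
  · exact ⟨_, h1.isParam h.isGenerator.inv⟩
  · exact ⟨_, h1.isParam (h.isGenerator.sub_algebraMap α)⟩

theorem ordFun_mul (P : V.Place) {f g : V.FunField} (hf : f ≠ 0) (hg : g ≠ 0) :
    V.ordFun P (f * g) = V.ordFun P f + V.ordFun P g :=
  (h.exists_isParam P).choose_spec.ord_mul hf hg

theorem ordFun_inv (P : V.Place) {f : V.FunField} (hf : f ≠ 0) :
    V.ordFun P f⁻¹ = -V.ordFun P f :=
  (h.exists_isParam P).choose_spec.ord_inv hf

theorem ordFun_div (P : V.Place) {f g : V.FunField} (hf : f ≠ 0) (hg : g ≠ 0) :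
    V.ordFun P (f / g) = V.ordFun P f - V.ordFun P g :=
  (h.exists_isParam P).choose_spec.ord_div hf hg

theorem ordFun_pow (P : V.Place) {f : V.FunField} (hf : f ≠ 0) (m : ℕ) :
    V.ordFun P (f ^ m) = m * V.ordFun P f :=
  (h.exists_isParam P).choose_spec.ord_pow hf m

theorem ordFun_nonneg_iff (P : V.Place) {f : V.FunField} (hf : f ≠ 0) :
    0 ≤ V.ordFun P f ↔ f ∈ P.1 :=
  (h.exists_isParam P).choose_spec.ord_nonneg_iff hf

theorem ordFun_const (P : V.Place) {a : AlgebraicClosure K} (ha : a ≠ 0) :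
    V.ordFun P (algebraMap (AlgebraicClosure K) V.FunField a) = 0 := by
  refine (h.exists_isParam P).choose_spec.ord_eq_zero_of_mem (by simpa using ha)
    (P.algebraMap_mem a) ?_
  rw [← map_inv₀]
  exact P.algebraMap_mem _

/-- The order of `xᵢ / xⱼ` at infinity. -/
theorem ordFun_ratio_of_poleOrd (P : V.Place) (hP : poleOrd i j P = 1) :
    V.ordFun P (V.ratio i j) = -1 := by
  rcases h.isCentre_or P with ⟨-, h1⟩ | ⟨h0, -⟩
  · have h2 := (h1.isParam h.isGenerator.inv).ord_param
    have h3 := h.ordFun_inv P h.isGenerator.ne_zero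
    rw [ordFun] at h3
    rw [h2] at h3
    omega
  · omega

omit hV h in
theorem poleOrd_eq (i j : Fin (n + 1)) [V.IsIrred] (P : V.Place) :
    poleOrd i j P = 0 ∨ poleOrd i j P = 1 := by
  rw [poleOrd]
  split_ifs <;> simp

omit h in
theorem ratio_mem_iff (P : V.Place) : V.ratio i j ∈ P.1 ↔ poleOrd i j P = 0 := by
  rw [poleOrd]
  split_ifs with h1 <;> simp [h1]

/-- A polynomial in xᵢ / xⱼ can have a pole only at infinity. There p(t) / t^m is a polynomial in
1/t, hence integral, so the pole has order at most m. -/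
theorem neg_mul_poleOrd_le_ordFun (P : V.Place) {m : ℕ} {p : Polynomial (AlgebraicClosure K)}
    (hp : p ≠ 0) (hm : p.natDegree ≤ m) :
    -(m * poleOrd i j P) ≤ V.ordFun P (Polynomial.aeval (V.ratio i j) p) := by
  have ht := h.isGenerator
  have hp0 := ht.aeval_ne_zero hp
  rcases poleOrd_eq i j P with hP | hP
  · rw [hP, mul_zero, neg_zero, h.ordFun_nonneg_iff P hp0]
    rw [Polynomial.aeval_eq_sum_range]
    refine sum_mem fun r _ => ?_
    rw [Algebra.smul_def]
    exact mul_mem (P.algebraMap_mem _) (pow_mem ((ratio_mem_iff P).2 hP) r)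
  · have h1 : Polynomial.aeval (V.ratio i j) p / V.ratio i j ^ m ∈ P.1 := by
      have hinv : (V.ratio i j)⁻¹ ∈ P.1 := by
        refine (P.1.mem_or_inv_mem _).resolve_left fun hmem => ?_
        rw [(ratio_mem_iff P).1 hmem] at hP
        omega
      rw [Polynomial.aeval_eq_sum_range, Finset.sum_div]
      refine sum_mem fun r hr => ?_
      have hr' : r ≤ m := (Nat.lt_succ_iff.1 (Finset.mem_range.1 hr)).trans hm
      obtain ⟨l, rfl⟩ := Nat.exists_eq_add_of_le hr'
      have : p.coeff r • V.ratio i j ^ r / V.ratio i j ^ (r + l) =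
          algebraMap (AlgebraicClosure K) V.FunField (p.coeff r) * (V.ratio i j)⁻¹ ^ l := by
        have := ht.ne_zero
        rw [Algebra.smul_def, pow_add, inv_pow]
        field_simp
      rw [this]
      exact mul_mem (P.algebraMap_mem _) (pow_mem hinv l)
    rw [← h.ordFun_nonneg_iff P (div_ne_zero hp0 (pow_ne_zero m ht.ne_zero)),
      h.ordFun_div P hp0 (pow_ne_zero m ht.ne_zero), h.ordFun_pow P ht.ne_zero,
      h.ordFun_ratio_of_poleOrd P hP] at h1
    rw [hP]
    linarith

/-- The order of a section of `𝒪(w)`. -/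
theorem ordSec_eq (σ : AlgebraicClosure K →+* ℂ) (P : V.Place) (w : ℕ) {f : V.FunField}
    (hf : f ≠ 0) :
    V.ordSec P w (V.coord j ^ w * f) = V.ordFun P f + w * poleOrd i j P := by
  have hj := h.coord_j_ne_zero
  have ht := h.isGenerator
  -- The supremum is attained at m = 1, by u = xⱼ at the finite places and by u = xᵢ at infinity. It
  -- is an upper bound because every u is xⱼ^m times a polynomial of degree at most m.
  refine IsGreatest.csSup_eq ⟨?_, ?_⟩
  · rcases poleOrd_eq i j P with hP | hP
    · refine ⟨1, le_rfl, V.coord j, h.coord_mem_boundedSec j, hj, f, ?_, ?_⟩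
      · field_simp
      · simp [hP]
    · refine ⟨1, le_rfl, V.coord i, h.coord_mem_boundedSec i, h.coord_i_ne_zero,
        f / V.ratio i j ^ w, ?_, ?_⟩
      · have := h.coord_i_ne_zero
        push_cast
        rw [ratio, div_pow]
        field_simp
      · rw [h.ordFun_div P hf (pow_ne_zero w ht.ne_zero), h.ordFun_pow P ht.ne_zero,
          h.ordFun_ratio_of_poleOrd P hP, hP]
        push_cast
        ring
  · rintro r ⟨m, hm, u, hu, hu0, g, hg, rfl⟩
    obtain ⟨p, hp, rfl⟩ := h.exists_polynomial_of_mem_boundedSec σ hu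
    have hp0 : p ≠ 0 := by rintro rfl; simp at hu0
    have hpt := ht.aeval_ne_zero hp0
    have hg' : g = f ^ m / Polynomial.aeval (V.ratio i j) p ^ w := by
      apply Subtype.ext
      rw [hg]
      push_cast
      rw [coe_aeval, mul_pow, mul_pow, ← pow_mul, ← pow_mul, mul_comm m w,
        mul_div_mul_left _ _ (pow_ne_zero _ hj)]
    have h1 := h.neg_mul_poleOrd_le_ordFun P hp0 hp
    rw [hg', h.ordFun_div P (pow_ne_zero m hf) (pow_ne_zero w hpt), h.ordFun_pow P hf,
      h.ordFun_pow P hpt]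
    have hm0 : (0 : ℝ) < m := by exact_mod_cast hm
    rw [div_le_iff₀ hm0]
    have h2 : (m : ℤ) * V.ordFun P f - w * V.ordFun P (Polynomial.aeval (V.ratio i j) p) ≤
        (V.ordFun P f + w * poleOrd i j P) * m := by
      have h3 : (w : ℤ) * (-(m * poleOrd i j P)) ≤
          w * V.ordFun P (Polynomial.aeval (V.ratio i j) p) :=
        mul_le_mul_of_nonneg_left h1 (Int.natCast_nonneg w)
      nlinarith
    exact_mod_cast h2

omit h in
theorem D_ratio_sub_const (α : AlgebraicClosure K) :
    KaehlerDifferential.D (AlgebraicClosure K) V.FunField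
      (V.ratio i j - algebraMap (AlgebraicClosure K) V.FunField α) =
    KaehlerDifferential.D (AlgebraicClosure K) V.FunField (V.ratio i j) := by
  rw [map_sub, Derivation.map_algebraMap, sub_zero]

/-- The order of a differential. -/
theorem ordDiff_eq (P : V.Place) {f : V.FunField} (hf : f ≠ 0) :
    V.ordDiff P (f • KaehlerDifferential.D (AlgebraicClosure K) V.FunField (V.ratio i j)) =
      V.ordFun P f - 2 * poleOrd i j P := by
  -- The order in `ordDiff` does not depend on the uniformizer chosen, so it can be read off from a
  -- generator centred at the place.
  have key : ∀ (t g : V.FunField) (ω : Ω[V.FunField⁄AlgebraicClosure K]),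
      IsGenerator (AlgebraicClosure K) t → IsCentre (AlgebraicClosure K) P.1 t → g ≠ 0 →
      ω = g • KaehlerDifferential.D (AlgebraicClosure K) V.FunField t →
      V.ordDiff P ω = V.ordFun P g := by
    intro t g ω ht hP hg hω
    have hex : ∃ m : ℤ, ∃ π f : V.FunField, IsUnif P.1 π ∧
        ω = f • KaehlerDifferential.D (AlgebraicClosure K) V.FunField π ∧ V.ordFun P f = m :=
      ⟨_, t, g, (hP.isParam ht).unif, hω, rfl⟩
    obtain ⟨π, f', hπ, h1, h2⟩ := Classical.epsilon_spec hex
    rw [ordDiff, ← h2]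
    exact hP.ord_eq_of_smul_D_eq ht hπ hg (hω.symm.trans h1)
  have ht := h.isGenerator
  rcases h.isCentre_or P with ⟨hP, h1⟩ | ⟨hP, α, h1⟩
  · have h0 : V.ratio i j ≠ 0 := ht.ne_zero
    -- At infinity dt = -t² d(1/t), which accounts for the double pole of dt.
    have h2 : f • KaehlerDifferential.D (AlgebraicClosure K) V.FunField (V.ratio i j) =
        (-(f * V.ratio i j ^ 2)) •
          KaehlerDifferential.D (AlgebraicClosure K) V.FunField (V.ratio i j)⁻¹ := by
      rw [Derivation.leibniz_inv, smul_smul]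
      congr 1
      field_simp
    have h3 : V.ordFun P (-(f * V.ratio i j ^ 2)) = V.ordFun P f - 2 := by
      have h4 : -(f * V.ratio i j ^ 2) =
          algebraMap (AlgebraicClosure K) V.FunField (-1) * (f * V.ratio i j ^ 2) := by simp
      rw [h4, h.ordFun_mul P (by simp) (mul_ne_zero hf (pow_ne_zero 2 h0)),
        h.ordFun_const P (by simp), h.ordFun_mul P hf (pow_ne_zero 2 h0), h.ordFun_pow P h0,
        h.ordFun_ratio_of_poleOrd P hP]
      push_cast
      ring
    rw [key _ _ _ ht.inv h1 (neg_ne_zero.2 (mul_ne_zero hf (pow_ne_zero 2 h0))) h2, h3, hP, mul_one]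
  · rw [key _ f _ (ht.sub_algebraMap α) h1 hf (by rw [D_ratio_sub_const]), hP, mul_zero, sub_zero]

end IsLine

end LineOrder

end QuasiProj

namespace QuasiProj

/-! ## Degrees -/

section Degree

universe u

theorem exists_complex_embedding (K : Type u) [Field K] [NumberField K] :
    Nonempty (AlgebraicClosure K →+* ℂ) := by
  have : Algebra.IsAlgebraic ℚ (AlgebraicClosure K) := Algebra.IsAlgebraic.trans ℚ K _
  exact ⟨(IsAlgClosed.lift (R := ℚ) (M := ℂ) (S := AlgebraicClosure K)).toRingHom⟩

/-- Divisors with integral coefficients as divisors with real coefficients. -/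
def realDiv (α : Type*) : (α →₀ ℤ) →+ (α →₀ ℝ) :=
  Finsupp.mapRange.addMonoidHom (Int.castAddHom ℝ)

theorem realDiv_apply {α : Type*} (D : α →₀ ℤ) (P : α) : realDiv α D P = D P := rfl

theorem degree_realDiv {α : Type*} (D : α →₀ ℤ) : (realDiv α D).degree = D.degree := by
  have : (Finsupp.degree).comp (realDiv α) = (Int.castAddHom ℝ).comp Finsupp.degree := by
    ext P
    simp [realDiv]
  exact DFunLike.congr_fun this D

theorem degree_smul {α : Type*} (a : ℝ) (D : α →₀ ℝ) : (a • D).degree = a * D.degree := by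
  induction D using Finsupp.induction_linear with
  | zero => simp
  | add f g hf hg => rw [smul_add, map_add, hf, hg, map_add, mul_add]
  | single P r =>
    rw [Finsupp.smul_single, Finsupp.degree_single, Finsupp.degree_single, smul_eq_mul]

theorem degree_nonneg {α R : Type*} [AddCommMonoid R] [PartialOrder R] [IsOrderedAddMonoid R]
    {D : α →₀ R} (hD : ∀ P, 0 ≤ D P) : 0 ≤ D.degree :=
  Finset.sum_nonneg fun P _ => hD P

theorem eq_zero_of_degree_eq_zero {α R : Type*} [AddCommMonoid R] [PartialOrder R]
    [IsOrderedAddMonoid R] {D : α →₀ R} (hD : ∀ P, 0 ≤ D P) (h0 : D.degree = 0) : D = 0 := by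
  ext P
  by_cases hP : P ∈ D.support
  · exact (Finset.sum_eq_zero_iff_of_nonneg fun P _ => hD P).1 h0 P hP
  · simpa using hP

variable {K : Type u} [Field K] {n : ℕ} {V : QuasiProj K n} {i j : Fin (n + 1)}
  {c d : Fin (n + 1) → K} [hV : V.IsIrred]

theorem exists_place {t : V.FunField} (ht : IsGenerator (AlgebraicClosure K) t) :
    ∃ P : V.Place, IsCentre (AlgebraicClosure K) P.1 t := by
  obtain ⟨O, hO⟩ := ht.exists_isCentre
  refine ⟨⟨O, fun c => ?_, ?_⟩, hO⟩
  · rw [IsScalarTower.algebraMap_apply K (AlgebraicClosure K) V.FunField]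
    exact hO.const_mem _
  · rintro rfl
    exact hO.inv_notMem trivial

namespace IsLine

variable (h : V.IsLine i j c d)

/-- The place at infinity. -/
def infPlace : V.Place := (exists_place h.isGenerator.inv).choose

include h

theorem isCentre_infPlace : IsCentre (AlgebraicClosure K) h.infPlace.1 (V.ratio i j)⁻¹ :=
  (exists_place h.isGenerator.inv).choose_spec

theorem poleOrd_eq_single (P : V.Place) :
    poleOrd i j P = (Finsupp.single h.infPlace 1 : V.Divisor) P := by
  classical
  rw [Finsupp.single_apply]
  split_ifs with hP
  · rw [poleOrd, if_neg]
    rw [← hP]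
    simpa using h.isCentre_infPlace.inv_notMem
  · rcases h.isCentre_or P with ⟨-, h1⟩ | ⟨h0, -⟩
    · exact absurd (Subtype.ext
        (h.isCentre_infPlace.eq_of_isCentre h1 h.isGenerator.inv)) hP
    · exact h0

/-- The function t - α is a uniformizer at its unique centre Q, a unit at the other finite places,
and has a simple pole at infinity. -/
theorem exists_divisor_linear (α : AlgebraicClosure K) : ∃ Q : V.Place, ∀ P,
    (Finsupp.single Q 1 - Finsupp.single h.infPlace 1 : V.Divisor) P = V.ordFun P
      (V.ratio i j - algebraMap (AlgebraicClosure K) V.FunField α) := by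
  classical
  have ht := h.isGenerator.sub_algebraMap α
  obtain ⟨Q, hQ⟩ := exists_place ht
  refine ⟨Q, fun P => ?_⟩
  rw [Finsupp.sub_apply, ← h.poleOrd_eq_single]
  have hQ0 : poleOrd i j Q = 0 := (ratio_mem_iff Q).1 (by
    simpa using add_mem hQ.mem (Q.algebraMap_mem α))
  rcases poleOrd_eq i j P with hP | hP
  · have hmem := sub_mem ((ratio_mem_iff P).2 hP) (P.algebraMap_mem α)
    by_cases hinv : (V.ratio i j - algebraMap (AlgebraicClosure K) V.FunField α)⁻¹ ∈ P.1
    · have hne : Q ≠ P := by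
        rintro rfl
        exact hQ.inv_notMem hinv
      rw [Finsupp.single_eq_of_ne' hne, hP, sub_zero]
      exact ((h.exists_isParam P).choose_spec.ord_eq_zero_of_mem ht.ne_zero hmem hinv).symm
    · have hc : IsCentre (AlgebraicClosure K) P.1
          (V.ratio i j - algebraMap (AlgebraicClosure K) V.FunField α) :=
        ⟨P.algebraMap_mem, hmem, hinv⟩
      have he : Q = P := Subtype.ext (hQ.eq_of_isCentre hc ht)
      rw [he, Finsupp.single_eq_same, hP, sub_zero]
      exact (hc.isParam ht).ord_param.symm
  -- At infinity t - α is not integral, so its order is negative; by the degree bound it is at least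
  -- -1.
  · have hne : Q ≠ P := by rintro rfl; omega
    have h1 := h.neg_mul_poleOrd_le_ordFun P (m := 1) (p := Polynomial.X - Polynomial.C α)
      (Polynomial.X_sub_C_ne_zero α) (by simp)
    have h2 : ¬ 0 ≤ V.ordFun P (V.ratio i j - algebraMap (AlgebraicClosure K) V.FunField α) := by
      rw [h.ordFun_nonneg_iff P ht.ne_zero]
      intro hmem
      have := add_mem hmem (P.algebraMap_mem α)
      rw [sub_add_cancel, ratio_mem_iff] at this
      omega
    rw [map_sub, Polynomial.aeval_X, Polynomial.aeval_C, hP] at h1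
    rw [Finsupp.single_eq_of_ne' hne, hP]
    push_cast at h1
    omega

/-- The divisor of a rational function has degree zero. -/
theorem exists_divisor_fun {f : V.FunField} (hf : f ≠ 0) :
    ∃ D : V.Divisor, (∀ P, D P = V.ordFun P f) ∧ D.degree = 0 := by
  refine h.isGenerator.induction (P := fun f => ∃ D : V.Divisor, (∀ P, D P = V.ordFun P f) ∧
    D.degree = 0) ?_ ?_ ?_ ?_ hf
  · intro a ha
    exact ⟨0, fun P => (h.ordFun_const P ha).symm, map_zero _⟩
  · intro α
    obtain ⟨Q, hQ⟩ := h.exists_divisor_linear α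
    exact ⟨_, hQ, by simp⟩
  · rintro f g hf hg ⟨D, hD, hD0⟩ ⟨E, hE, hE0⟩
    exact ⟨D + E, fun P => by rw [Finsupp.add_apply, hD, hE, h.ordFun_mul P hf hg],
      by rw [map_add, hD0, hE0, add_zero]⟩
  · rintro f hf ⟨D, hD, hD0⟩
    exact ⟨-D, fun P => by rw [Finsupp.neg_apply, hD, h.ordFun_inv P hf],
      by rw [map_neg, hD0, neg_zero]⟩

theorem degree_eq_zero_of_fun {f : V.FunField} (hf : f ≠ 0) {D : V.Divisor}
    (hD : ∀ P, D P = V.ordFun P f) : D.degree = 0 := by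
  obtain ⟨E, hE, hE0⟩ := h.exists_divisor_fun hf
  have : D = E := Finsupp.ext fun P => by rw [hD, hE]
  rw [this, hE0]

theorem exists_ratSec_eq {w : ℕ} {z : V.Frac} (hz : z ∈ V.ratSec w) (hz0 : z ≠ 0) :
    ∃ f : V.FunField, f ≠ 0 ∧ z = V.coord j ^ w * f := by
  have hj := pow_ne_zero w h.coord_j_ne_zero
  refine ⟨⟨_, hz j⟩, fun h0 => ?_, ?_⟩
  · have := congrArg Subtype.val h0
    exact div_ne_zero hz0 hj this
  · rw [mul_div_cancel₀ _ hj]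

omit h in
theorem coord_pow_mul_mem_ratSec (w : ℕ) (f : V.FunField) : V.coord j ^ w * f ∈ V.ratSec w := by
  intro r
  rw [mul_comm, mul_div_assoc, ← div_pow]
  exact mul_mem f.2 (pow_mem (V.ratio j r).2 w)

/-- Division by xⱼ^w leaves a rational function, of degree zero, and xⱼ as a section of M vanishes
exactly once, at infinity. So M has degree 1. -/
theorem exists_divisor_sec (σ : AlgebraicClosure K →+* ℂ) {w : ℕ} {z : V.Frac}
    (hz : z ∈ V.ratSec w) (hz0 : z ≠ 0) :
    ∃ D : V.Divisor, (∀ P, (D P : ℝ) = V.ordSec P w z) ∧ D.degree = w := by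
  obtain ⟨f, hf, rfl⟩ := h.exists_ratSec_eq hz hz0
  obtain ⟨D, hD, hD0⟩ := h.exists_divisor_fun hf
  refine ⟨D + (w : ℤ) • Finsupp.single h.infPlace 1, fun P => ?_, ?_⟩
  · rw [h.ordSec_eq σ P w hf, h.poleOrd_eq_single, Finsupp.add_apply, hD, Finsupp.smul_apply]
    push_cast
    simp
  · rw [map_add, hD0, map_zsmul, Finsupp.degree_single]
    simp

theorem exists_diff_eq {ω : Ω[V.FunField⁄AlgebraicClosure K]} (hω : ω ≠ 0) :
    ∃ f : V.FunField, f ≠ 0 ∧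
      ω = f • KaehlerDifferential.D (AlgebraicClosure K) V.FunField (V.ratio i j) := by
  obtain ⟨f, rfl⟩ := h.isGenerator.exists_smul_D ω
  refine ⟨f, ?_, rfl⟩
  rintro rfl
  simp at hω

theorem exists_divisor_diff {ω : Ω[V.FunField⁄AlgebraicClosure K]} (hω : ω ≠ 0) :
    ∃ D : V.Divisor, (∀ P, D P = V.ordDiff P ω) ∧ D.degree = -2 := by
  obtain ⟨f, hf, rfl⟩ := h.exists_diff_eq hω
  obtain ⟨D, hD, hD0⟩ := h.exists_divisor_fun hf
  refine ⟨D - (2 : ℤ) • Finsupp.single h.infPlace 1, fun P => ?_, ?_⟩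
  · rw [h.ordDiff_eq P hf, h.poleOrd_eq_single, Finsupp.sub_apply, hD, Finsupp.smul_apply,
      smul_eq_mul]
  · rw [map_sub, hD0, map_zsmul, Finsupp.degree_single]
    simp

theorem degree_principalReal {D : V.Place →₀ ℝ} (hD : D ∈ V.principalReal) : D.degree = 0 := by
  induction hD using Submodule.span_induction with
  | mem D hD =>
    obtain ⟨f, hf, hfD⟩ := hD
    obtain ⟨E, hE, hE0⟩ := h.exists_divisor_fun hf
    have : D = realDiv _ E := Finsupp.ext fun P => by rw [hfD, realDiv_apply, hE]
    rw [this, degree_realDiv, hE0, Int.cast_zero]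
  | zero => exact map_zero _
  | add D E _ _ hD hE => rw [map_add, hD, hE, add_zero]
  | smul a D _ hD =>
    rw [degree_smul, hD, mul_zero]

/-! ## The invariant `a` -/

/-- The class t[M] + [K_X] has degree t - 2, and an effective real divisor has non-negative degree.
At t = 2 the divisor attached to xⱼ and dt is zero. -/
theorem a_eq [NumberField K] : V.a = 2 := by
  obtain ⟨σ⟩ := exists_complex_embedding K
  have hj := h.coord_j_ne_zero
  refine IsLeast.csInf_eq ⟨⟨2, by norm_num, V.coord j, ?_, hj, KaehlerDifferential.D _ _
    (V.ratio i j), h.isGenerator.D_ne_zero, 0, zero_mem _, fun P => ?_⟩, ?_⟩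
  · simpa using coord_pow_mul_mem_ratSec (j := j) 1 (1 : V.FunField)
  · have h1 := h.ordSec_eq σ P 1 (one_ne_zero (α := V.FunField))
    have h2 := h.ordDiff_eq P (one_ne_zero (α := V.FunField))
    have h3 := h.ordFun_const P (one_ne_zero (α := AlgebraicClosure K))
    rw [map_one] at h3
    rw [one_smul] at h2
    simp only [pow_one, OneMemClass.coe_one, mul_one] at h1
    rw [h1, h2, h3]
    simp
  · rintro t ⟨q, rfl, l, hl, hl0, ω, hω, D, hD, hle⟩
    obtain ⟨E, hE, hE0⟩ := h.exists_divisor_sec σ hl hl0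
    obtain ⟨E', hE', hE0'⟩ := h.exists_divisor_diff hω
    have h1 : 0 ≤ ((q : ℝ) • realDiv _ E + realDiv _ E' + D).degree := by
      refine degree_nonneg fun P => ?_
      have := hle P
      rw [← hE, ← hE'] at this
      exact this
    rw [map_add, map_add, degree_smul, degree_realDiv, degree_realDiv, hE0, hE0',
      h.degree_principalReal hD] at h1
    push_cast at h1
    linarith

/-! ## Adjoint sections -/

/-- The divisor of an adjoint section on a line is zero. -/
theorem adjointSection_order [NumberField K] (g : V.AdjointSection) (P : V.Place) :
    g.order P = 0 := by
  obtain ⟨σ⟩ := exists_complex_embedding K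
  obtain ⟨E, hE, hE0⟩ := h.exists_divisor_sec σ g.sec_mem g.sec_ne
  obtain ⟨E', hE', hE0'⟩ := h.exists_divisor_diff g.diff_ne
  have hP : ∀ P, g.order P = ((E + (g.N : ℤ) • E') P : ℤ) := by
    intro P
    rw [AdjointSection.order, ← hE, ← hE']
    simp
  have hw : (g.w : ℤ) = g.N * 2 := by
    have := g.weight
    rw [h.a_eq] at this
    exact_mod_cast this
  -- The divisor of g is effective of degree w - 2N, and w = 2N since a = 2.
  have h0 : E + (g.N : ℤ) • E' = 0 := by
    refine eq_zero_of_degree_eq_zero (fun P => ?_) ?_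
    · have h1 := g.effective P
      change 0 ≤ g.order P at h1
      rw [hP] at h1
      exact_mod_cast h1
    · rw [map_add, map_zsmul, hE0, hE0', hw]
      simp
  rw [hP, h0]
  simp

end IsLine

end Degree

end QuasiProj

/-- The quotient by the kernel of a surjective map to the integers. -/
def quotientEquivInt {A : Type*} [AddCommGroup A] (N : AddSubgroup A) (f : A →+ ℤ)
    (hf : Function.Surjective f) (hN : N = f.ker) : A ⧸ N ≃+ ℤ :=
  (QuotientAddGroup.quotientAddEquivOfEq hN).trans
    (QuotientAddGroup.quotientKerEquivOfSurjective f hf)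

theorem quotientEquivInt_mk {A : Type*} [AddCommGroup A] (N : AddSubgroup A) (f : A →+ ℤ)
    (hf : Function.Surjective f) (hN : N = f.ker) (x : A) :
    quotientEquivInt N f hf hN (QuotientAddGroup.mk x) = f x := rfl

/-- Every automorphism of an algebraic extension has a positive power that fixes a given finite
subextension. -/
theorem exists_pow_mem_fixingSubgroup {M L : Type*} [Field M] [Field L] [CharZero M] [Algebra M L]
    (s : L ≃ₐ[M] L) (E : IntermediateField M L) [FiniteDimensional M E] :
    ∃ l : ℕ, s ^ (l + 1) ∈ E.fixingSubgroup := by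
  obtain ⟨x, hx⟩ := Field.exists_primitive_element M E
  have hint : IsIntegral M (x : L) := (Algebra.IsIntegral.isIntegral x).map E.val
  have hmaps : ∀ m : ℕ, (s ^ m) (x : L) ∈ (minpoly M (x : L)).rootSet L := by
    intro m
    rw [Polynomial.mem_rootSet]
    refine ⟨minpoly.ne_zero hint, ?_⟩
    have := Polynomial.aeval_algHom_apply (s ^ m : L ≃ₐ[M] L).toAlgHom (x : L) (minpoly M (x : L))
    rw [minpoly.aeval, map_zero] at this
    exact this
  -- The orbit of a primitive element lies in the finite root set of its minimal polynomial, so two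
  -- powers of s agree on it.
  obtain ⟨a, b, hab, hEq⟩ : ∃ a b : ℕ, a < b ∧ (s ^ a) (x : L) = (s ^ b) x := by
    have hfin := ((minpoly M (x : L)).rootSet_finite L).to_subtype
    obtain ⟨a, b, hne, hEq⟩ := Finite.exists_ne_map_eq_of_infinite
      (fun m : ℕ => (⟨_, hmaps m⟩ : (minpoly M (x : L)).rootSet L))
    have hEq' := congrArg Subtype.val hEq
    rcases lt_or_gt_of_ne hne with hlt | hlt
    · exact ⟨a, b, hlt, hEq'⟩
    · exact ⟨b, a, hlt, hEq'.symm⟩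
  obtain ⟨l, rfl⟩ := Nat.exists_eq_add_of_lt hab
  have hfix : (s ^ (l + 1)) (x : L) = x := by
    rw [add_assoc, pow_add, AlgEquiv.mul_apply] at hEq
    exact ((s ^ a).injective hEq).symm
  refine ⟨l, (IntermediateField.mem_fixingSubgroup_iff _ _).2 fun y hy => ?_⟩
  have hy' : (⟨y, hy⟩ : E) ∈ IntermediateField.adjoin M {x} := by
    rw [hx]; trivial
  have : ∀ z : E, z ∈ IntermediateField.adjoin M {x} → (s ^ (l + 1)) (z : L) = z := by
    intro z hz
    induction hz using IntermediateField.adjoin_induction with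
    | mem z hz =>
      rw [Set.mem_singleton_iff] at hz
      rw [hz, hfix]
    | algebraMap z => exact (s ^ (l + 1)).commutes z
    | add y z _ _ hy hz => rw [IntermediateField.coe_add, map_add, hy, hz]
    | inv z _ hz => rw [IntermediateField.coe_inv, map_inv₀, hz]
    | mul y z _ _ hy hz => rw [IntermediateField.coe_mul, map_mul, hy, hz]
  exact this _ hy'

/-- The generator of the dual lattice is determined only up to the sign ε, and the integral over the
corresponding half-line is 1 for both signs. The dimension stays a variable because V.b equals 1
only propositionally. -/
theorem setIntegral_exp_neg_of_eq_one {b : ℕ} (hb : b = 1) (S : Set (Fin b → ℝ))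
    (f : (Fin b → ℝ) → ℝ) (i : Fin b) (ε : ℤ) (hε : ε = 1 ∨ ε = -1)
    (hS : ∀ y, y ∈ S ↔ 0 ≤ y i * ε) (hf : ∀ y, f y = Real.exp (-(y i * ε))) :
    ∫ y in S, f y = 1 := by
  subst hb
  obtain rfl : i = 0 := Subsingleton.elim _ _
  have hcone : S = MeasurableEquiv.funUnique (Fin 1) ℝ ⁻¹' {x | 0 ≤ x * ε} := by
    ext y
    rw [hS]
    rfl
  have hint : f = fun y => (fun x : ℝ => Real.exp (-(x * ε)))
      (MeasurableEquiv.funUnique (Fin 1) ℝ y) := by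
    funext y
    rw [hf]
    rfl
  rw [hcone, hint]
  refine ((volume_preserving_funUnique (Fin 1) ℝ).setIntegral_preimage_emb
    (MeasurableEquiv.measurableEmbedding _) (fun x : ℝ => Real.exp (-(x * ε)))
    {x | 0 ≤ x * ε}).trans ?_
  rcases hε with hε | hε
  · have : {x : ℝ | 0 ≤ x * (ε : ℝ)} = Set.Ici 0 := by ext x; simp [hε]
    rw [this, integral_Ici_eq_integral_Ioi, hε]
    simpa using integral_exp_neg_Ioi_zero
  · have : {x : ℝ | 0 ≤ x * (ε : ℝ)} = Set.Iic 0 := by ext x; simp [hε]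
    rw [this, hε]
    simpa using integral_exp_Iic_zero

theorem det_id_sub_smul_id {W : Type*} [AddCommGroup W] [Module ℝ W]
    (hW : Module.finrank ℝ W = 1) (x : ℝ) :
    LinearMap.det (LinearMap.id - x • LinearMap.id : W →ₗ[ℝ] W) = 1 - x := by
  have : (LinearMap.id - x • LinearMap.id : W →ₗ[ℝ] W) = (1 - x) • LinearMap.id := by
    rw [sub_smul, one_smul]
  rw [this, LinearMap.det_smul, hW, LinearMap.det_id, pow_one, mul_one]

namespace QuasiProj

/-! ## The Picard group of a line -/

section Picard

universe u

variable {K : Type u} [Field K] [NumberField K] {n : ℕ} {V : QuasiProj K n} {i j : Fin (n + 1)}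
  {c d : Fin (n + 1) → K} [hV : V.IsIrred]

omit [NumberField K] in
theorem degree_galDiv (s : V.Gal) (D : V.Divisor) : (V.galDiv s D).degree = D.degree :=
  Finsupp.degree_mapDomain _ _

namespace IsLine

variable (h : V.IsLine i j c d)

include h

/-- Adjoint sections have zero divisor, so the relations are only the principal divisors, of degree
zero and preserved by Galois. Conversely each P - ∞ is the divisor of some t - α, and these span the
divisors of degree zero. -/
theorem picRel_eq_ker : V.picRel = (Finsupp.degree : V.Divisor →+ ℤ).ker := by
  apply le_antisymm
  · refine (AddSubgroup.closure_le _).2 ?_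
    rintro _ ⟨s, D, hD, rfl⟩
    change (V.galDiv s D).degree = 0
    rw [degree_galDiv]
    rcases hD with ⟨f, hf, hD⟩ | ⟨g, P, hP, -⟩
    · exact h.degree_eq_zero_of_fun hf hD
    · rw [h.adjointSection_order] at hP
      exact absurd hP (lt_irrefl _)
  · have hgen : ∀ D ∈ V.picGen, D ∈ V.picRel := by
      intro D hD
      refine AddSubgroup.subset_closure ⟨1, D, hD, ?_⟩
      have : (fun P : V.Place => (1 : V.Gal) • P) = id := funext fun P => one_smul _ P
      rw [galDiv, Finsupp.mapDomain.addMonoidHom_apply, this, Finsupp.mapDomain_id]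
    have hlin : ∀ P : V.Place,
        (Finsupp.single P 1 - Finsupp.single h.infPlace 1 : V.Divisor) ∈ V.picRel := by
      intro P
      rcases h.isCentre_or P with ⟨hP, -⟩ | ⟨-, α, hα⟩
      · have : P = h.infPlace := by
          by_contra hne
          rw [h.poleOrd_eq_single, Finsupp.single_eq_of_ne hne] at hP
          exact zero_ne_one hP
        rw [this, sub_self]
        exact zero_mem _
      · obtain ⟨Q, hQ⟩ := h.exists_divisor_linear α
        have hPQ : P = Q := by
          by_contra hne
          have h1 := hQ P
          have h2 : V.ordFun P (V.ratio i j - algebraMap (AlgebraicClosure K) V.FunField α) = 1 :=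
            (hα.isParam (h.isGenerator.sub_algebraMap α)).ord_param
          rw [h2, Finsupp.sub_apply, Finsupp.single_eq_of_ne hne, ← h.poleOrd_eq_single] at h1
          rcases poleOrd_eq i j P with h3 | h3 <;> omega
        rw [hPQ]
        exact hgen _ (Or.inl ⟨_, (h.isGenerator.sub_algebraMap α).ne_zero, hQ⟩)
    have key : ∀ D : V.Divisor, D - D.degree • Finsupp.single h.infPlace 1 ∈ V.picRel := by
      intro D
      induction D using Finsupp.induction_linear with
      | zero => simp
      | add D E hD hE =>
        have := add_mem hD hE
        rw [map_add, add_smul]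
        convert this using 1
        abel
      | single P a =>
        have := zsmul_mem (hlin P) a
        rw [Finsupp.degree_single]
        convert this using 1
        rw [smul_sub]
        simp
    intro D hD
    have := key D
    rw [show D.degree = 0 from hD, zero_smul, sub_zero] at this
    exact this

/-- The Picard group of a line is identified with the integers by the degree. -/
def picEquiv : V.Pic ≃+ ℤ :=
  quotientEquivInt V.picRel Finsupp.degree
    (fun a => ⟨Finsupp.single h.infPlace a, Finsupp.degree_single _ _⟩) h.picRel_eq_ker

theorem picEquiv_mk (D : V.Divisor) : h.picEquiv (QuotientAddGroup.mk D) = D.degree :=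
  quotientEquivInt_mk _ _ _ h.picRel_eq_ker D

/-- The degree identifies Pic with ℤ, and permuting places does not change it. -/
theorem galPic_eq_id (s : V.Gal) : V.galPic s = AddMonoidHom.id V.Pic := by
  refine DFunLike.ext _ _ fun p => ?_
  obtain ⟨D, rfl⟩ := QuotientAddGroup.mk_surjective p
  apply h.picEquiv.injective
  change h.picEquiv (QuotientAddGroup.mk (V.galDiv s D)) = h.picEquiv (QuotientAddGroup.mk D)
  rw [picEquiv_mk, picEquiv_mk, degree_galDiv]

theorem picInv_eq_top : V.picInv = ⊤ := by
  refine eq_top_iff.2 fun p _ s => ?_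
  rw [h.galPic_eq_id]
  rfl

/-- The degree on the Galois invariant classes. -/
def picInvEquiv : V.picInv ≃+ ℤ :=
  ((AddEquiv.addSubgroupCongr h.picInv_eq_top).trans AddSubgroup.topEquiv).trans h.picEquiv

theorem picInvEquiv_apply (p : V.picInv) : h.picInvEquiv p = h.picEquiv p := rfl

theorem b_eq : V.b = 1 := by
  rw [b, h.picInvEquiv.toIntLinearEquiv.finrank_eq, Module.finrank_self]

/-- The chosen representative is irrelevant: the divisor of any non-zero rational section of M has
degree 1. -/
theorem picInvEquiv_polClass : h.picInvEquiv V.polClass = 1 := by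
  obtain ⟨σ⟩ := exists_complex_embedding K
  have hl : V.coord j ∈ V.ratSec 1 := by
    simpa using coord_pow_mul_mem_ratSec (j := j) 1 (1 : V.FunField)
  obtain ⟨D, hD, -⟩ := h.exists_divisor_sec σ hl h.coord_j_ne_zero
  have hex : ∃ p : V.picInv, ∃ D : V.Divisor, (p : V.Pic) = QuotientAddGroup.mk D ∧
      ∃ l ∈ V.ratSec 1, l ≠ 0 ∧ ∀ P, (D P : ℝ) = V.ordSec P 1 l :=
    ⟨⟨QuotientAddGroup.mk D, by rw [h.picInv_eq_top]; trivial⟩, D, rfl, _, hl,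
      h.coord_j_ne_zero, hD⟩
  obtain ⟨E, hE, l, hl, hl0, hEl⟩ := Classical.epsilon_spec hex
  obtain ⟨E', hE', hE1⟩ := h.exists_divisor_sec σ hl hl0
  have hEE : E = E' := Finsupp.ext fun P => by
    have := (hEl P).trans (hE' P).symm
    exact_mod_cast this
  have : h.picEquiv (V.polClass : V.Pic) = E.degree := by
    rw [polClass, hE, picEquiv_mk]
  rw [picInvEquiv_apply, this, hEE, hE1, Nat.cast_one]

/-! ## The invariants `γ` and `δ` -/

/-- Evaluation at the class of degree one. -/
def dualPicEquiv : (V.picInv →+ ℤ) ≃ₗ[ℤ] ℤ :=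
  AddEquiv.toIntLinearEquiv
    { toFun := fun f => f (h.picInvEquiv.symm 1)
      invFun := fun a => (zmultiplesHom ℤ a).comp h.picInvEquiv.toAddMonoidHom
      left_inv := fun f => by
        ext p
        obtain ⟨m, rfl⟩ := h.picInvEquiv.symm.surjective p
        simp only [AddMonoidHom.comp_apply, AddEquiv.toAddMonoidHom_eq_coe, AddMonoidHom.coe_coe,
          AddEquiv.apply_symm_apply, zmultiplesHom_apply]
        rw [← map_zsmul, ← map_zsmul, smul_eq_mul, mul_one]
      right_inv := fun a => by simp
      map_add' := fun f g => rfl }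

theorem dualPicEquiv_apply (f : V.picInv →+ ℤ) (p : V.picInv) :
    f p = h.picInvEquiv p * h.dualPicEquiv f := by
  obtain ⟨m, rfl⟩ := h.picInvEquiv.symm.surjective p
  rw [AddEquiv.apply_symm_apply]
  change _ = m * f (h.picInvEquiv.symm 1)
  rw [← smul_eq_mul, ← map_zsmul, ← map_zsmul, smul_eq_mul, mul_one]

/-- In the degree coordinate the effective classes are the non-negative integers and [M] is 1, so γ
is the integral of exp(-y) over a half-line. -/
theorem gamma_eq : V.gamma = 1 := by
  have hb := h.b_eq
  let _ : Unique (Fin V.b) := (finCongr hb).unique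
  have hne : Nonempty (Module.Basis (Fin V.b) ℤ (V.picInv →+ ℤ)) :=
    ⟨((Module.Basis.singleton (Fin V.b) ℤ).map h.dualPicEquiv.symm)⟩
  rw [gamma, dif_pos hne]
  set e := hne.some
  set ε : ℤ := h.dualPicEquiv (e default)
  -- A basis vector of a lattice of rank one generates it, so its coordinate is a unit of ℤ.
  have hε : ε = 1 ∨ ε = -1 := by
    rw [← Int.isUnit_iff]
    have h1 := (e.map h.dualPicEquiv).sum_repr 1
    rw [Fintype.sum_unique, Module.Basis.map_apply, smul_eq_mul] at h1
    exact IsUnit.of_mul_eq_one_right _ h1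
  refine setIntegral_exp_neg_of_eq_one hb _ _ default ε hε (fun y => ?_) fun y => ?_
  · simp only [dualCone, Set.mem_ofPred_eq, Fintype.sum_unique]
    constructor
    · intro hy
      have := hy (h.picInvEquiv.symm 1) ⟨Finsupp.single h.infPlace 1, by simp, ?_⟩
      · rwa [h.dualPicEquiv_apply, AddEquiv.apply_symm_apply, one_mul] at this
      · apply h.picEquiv.injective
        rw [picEquiv_mk, Finsupp.degree_single, ← picInvEquiv_apply, AddEquiv.apply_symm_apply]
    · rintro hy p ⟨D, hD, hp⟩
      have h0 : 0 ≤ h.picInvEquiv p := by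
        rw [picInvEquiv_apply, hp, picEquiv_mk]
        exact degree_nonneg hD
      rw [h.dualPicEquiv_apply]
      have h1 : (0 : ℝ) ≤ h.picInvEquiv p := by exact_mod_cast h0
      push_cast
      have := mul_nonneg h1 hy
      linarith
  · rw [Fintype.sum_unique, h.dualPicEquiv_apply, h.picInvEquiv_polClass, one_mul]

omit [NumberField K] in
-- The constants are algebraic over K and xᵢ / xⱼ lies in K(V); together they generate the geometric
-- function field.
theorem isAlgebraic_ratField : Algebra.IsAlgebraic V.RatField V.FunField := by
  refine ⟨fun f => ?_⟩
  rw [← mem_algebraicClosure_iff]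
  have hconst : ∀ a, algebraMap (AlgebraicClosure K) V.FunField a ∈
      algebraicClosure V.RatField V.FunField := by
    intro a
    rw [mem_algebraicClosure_iff]
    have h1 : IsAlgebraic K a := Algebra.IsAlgebraic.isAlgebraic a
    exact (h1.algebraMap (A := V.FunField)).tower_top V.RatField
  have ht : V.ratio i j ∈ algebraicClosure V.RatField V.FunField := by
    have hm : V.ratio i j ∈ V.RatField := IntermediateField.subset_adjoin _ _ ⟨i, j, rfl⟩
    exact IntermediateField.algebraMap_mem _ (⟨_, hm⟩ : V.RatField)
  have hpoly : ∀ p : Polynomial (AlgebraicClosure K),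
      Polynomial.aeval (V.ratio i j) p ∈ algebraicClosure V.RatField V.FunField := by
    intro p
    rw [Polynomial.aeval_eq_sum_range]
    refine sum_mem fun r _ => ?_
    rw [Algebra.smul_def]
    exact mul_mem (hconst _) (pow_mem ht r)
  obtain ⟨p, q, -, rfl⟩ := h.isGenerator.exists_div f
  exact div_mem (hpoly p) (hpoly q)

/-- For the trivial action a cocycle is a homomorphism to ℤ. By continuity it vanishes on the
automorphisms fixing a finite subextension; every element has a positive power there, and ℤ is
torsion-free. -/
theorem cocycle_eq_zero {c : V.Gal → V.Pic} (hc : c ∈ V.cocycles) : c = 0 := by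
  obtain ⟨hloc, hmul⟩ := hc
  have hmul' : ∀ s t, c (s * t) = c s + c t := fun s t => by
    rw [hmul, h.galPic_eq_id]; rfl
  have hone : c 1 = 0 := by simpa using hmul' 1 1
  have hpow : ∀ s m, c (s ^ m) = m • c s := by
    intro s m
    induction m with
    | zero => simpa using hone
    | succ m ih => rw [pow_succ, hmul', ih, succ_nsmul]
  have := h.isAlgebraic_ratField
  have hnhds : {s | c s = 0} ∈ 𝓝 (1 : V.Gal) :=
    (hloc.isOpen_fiber 0).mem_nhds hone
  obtain ⟨E, hE, hEs⟩ := (krullTopology_mem_nhds_one_iff V.RatField V.FunField _).1 hnhds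
  funext s
  obtain ⟨l, hmem⟩ := exists_pow_mem_fixingSubgroup s E
  have h0 : c (s ^ (l + 1)) = 0 := hEs hmem
  rw [hpow] at h0
  have h1 : (l + 1) • h.picEquiv (c s) = 0 := by rw [← map_nsmul, h0, map_zero]
  apply h.picEquiv.injective
  rw [Pi.zero_apply, map_zero]
  exact (smul_eq_zero.1 h1).resolve_left (Nat.succ_ne_zero l)

theorem delta_eq : V.delta = 1 := by
  have : Subsingleton V.cocycles := ⟨fun x y => Subtype.ext (by
    rw [h.cocycle_eq_zero x.2, h.cocycle_eq_zero y.2])⟩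
  have : Subsingleton (V.cocycles ⧸ V.coboundaries.addSubgroupOf V.cocycles) :=
    (QuotientAddGroup.mk_surjective).subsingleton
  exact Nat.card_unique

/-! ## The local factors -/

/-- Galois acts trivially on a module of rank one, so no place is ramified and the factor is that of
the Dedekind zeta function, whichever Frobenius is chosen. -/
theorem localL_eq (v : IsDedekindDomain.HeightOneSpectrum (𝓞 K)) (s : ℝ) :
    V.localL v s = (1 - (Ideal.absNorm v.asIdeal : ℝ) ^ (-s))⁻¹ := by
  have hr : ¬ V.IsRamified v := by
    rintro ⟨-, -, s, -, hs⟩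
    exact hs (h.galPic_eq_id s)
  have hfree : Module.Free ℤ V.Pic := Module.Free.of_equiv h.picEquiv.toIntLinearEquiv.symm
  have hfin : Module.finrank ℝ (ℝ ⊗[ℤ] V.Pic) = 1 := by
    rw [Module.finrank_baseChange, h.picEquiv.toIntLinearEquiv.finrank_eq, Module.finrank_self]
  have hid : (AddMonoidHom.id V.Pic).toIntLinearMap = LinearMap.id := rfl
  rw [localL, if_neg hr, h.galPic_eq_id, hid, LinearMap.baseChange_id]
  congr 1
  exact det_id_sub_smul_id hfin _

end IsLine

end Picard

end QuasiProj

/-! ### Effect of a change of affine coordinate on the normal form of an adjoint section -/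

theorem IsGenerator.eq_mul_of_smul_D_eq {k F : Type*} [Field k] [Field F] [Algebra k F]
    {t u f f' g : F} (ht : IsGenerator k t)
    (hD : KaehlerDifferential.D k F u = g • KaehlerDifferential.D k F t)
    (h : f • KaehlerDifferential.D k F t = f' • KaehlerDifferential.D k F u) : f = f' * g := by
  rw [hD, smul_smul] at h
  exact ht.smul_D_injective h

/-- Each of x', y' is a multiple of x or of y. If both are multiples of the same one, the quotient
is constant; otherwise it is a constant times x/y or y/x. -/
theorem ratio_cases {k L : Type*} [Field k] [Field L] (A : k →+* L) {x y x' y' : L} {c d c' d' : k}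
    (hx : x ≠ 0) (hy : y ≠ 0) (hcd : c = 0 ∨ d = 0) (hcd' : c' = 0 ∨ d' = 0)
    (hx' : x' = A c * y + A d * x) (hy' : y' = A c' * y + A d' * x)
    (hrat : ∀ b : k, x' / y' ≠ A b) :
    (d ≠ 0 ∧ c = 0 ∧ c' ≠ 0 ∧ d' = 0 ∧ x' / y' = A (d / c') * (x / y)) ∨
    (c ≠ 0 ∧ d = 0 ∧ d' ≠ 0 ∧ c' = 0 ∧ x' / y' = A (c / d') * (x / y)⁻¹) := by
  rcases hcd with rfl | rfl
  · have hd : d ≠ 0 := by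
      rintro rfl
      exact hrat 0 (by simp [hx'])
    have hd' : d' = 0 := by
      by_contra hd'
      obtain rfl := hcd'.resolve_right hd'
      refine hrat (d / d') ?_
      rw [hx', hy', map_zero, zero_mul, zero_add, zero_add, map_div₀]
      exact mul_div_mul_right _ _ hx
    subst hd'
    have hc' : c' ≠ 0 := by
      rintro rfl
      exact hrat 0 (by simp [hy'])
    refine Or.inl ⟨hd, rfl, hc', rfl, ?_⟩
    rw [hx', hy', map_zero, zero_mul, zero_mul, zero_add, add_zero, map_div₀, div_mul_div_comm]
  · have hc : c ≠ 0 := by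
      rintro rfl
      exact hrat 0 (by simp [hx'])
    have hc' : c' = 0 := by
      by_contra hc'
      obtain rfl := hcd'.resolve_left hc'
      refine hrat (c / c') ?_
      rw [hx', hy', map_zero, zero_mul, add_zero, add_zero, map_div₀]
      exact mul_div_mul_right _ _ hy
    subst hc'
    have hd' : d' ≠ 0 := by
      rintro rfl
      exact hrat 0 (by simp [hy'])
    refine Or.inr ⟨hc, rfl, hd', rfl, ?_⟩
    rw [hx', hy', map_zero, zero_mul, zero_mul, zero_add, add_zero, map_div₀, inv_div,
      div_mul_div_comm]

theorem normalForm_mul {k F : Type*} [Field k] [Field F] (A : k →+* F) {S f f' y : F} {a p q : k}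
    {N : ℕ} (hp : p ≠ 0) (hq : q ≠ 0) (hS : S * f ^ N = A a * y ^ (2 * N))
    (hf : f = f' * A (p / q)) :
    S * f' ^ N = A (a * (q / p) ^ N) * y ^ (2 * N) := by
  have hp' : A p ≠ 0 := by simpa using hp
  have hq' : A q ≠ 0 := by simpa using hq
  have hf' : f' = f * (A q / A p) := by
    rw [hf, map_div₀]
    field_simp
  rw [hf', mul_pow, ← mul_assoc, hS, map_mul, map_pow, map_div₀]
  ring

/-- For u = (p/q)(x/y)⁻¹ the derivative of u contains (x/y)^(-2). Its N-th power exactly converts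
y^(2N) into x^(2N), so the section remains a constant times a power of one coordinate. -/
theorem normalForm_inv {k F : Type*} [Field k] [Field F] (A : k →+* F) {S f f' x y : F} {a p q : k}
    {N : ℕ} (hx : x ≠ 0) (hy : y ≠ 0) (hp : p ≠ 0) (hq : q ≠ 0)
    (hS : S * f ^ N = A a * y ^ (2 * N)) (hf : f = f' * (A (p / q) * -((x / y) ^ 2)⁻¹)) :
    S * f' ^ N = A (a * (-(q / p)) ^ N) * x ^ (2 * N) := by
  have hp' : A p ≠ 0 := by simpa using hp
  have hq' : A q ≠ 0 := by simpa using hq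
  have hf' : f' = f * (-(A q / A p) * (x / y) ^ 2) := by
    rw [hf, map_div₀]
    field_simp
  rw [hf', mul_pow, ← mul_assoc, hS, mul_pow, div_pow x, div_pow, ← pow_mul, ← pow_mul, map_mul,
    map_pow, map_neg, map_div₀]
  field_simp

theorem derivation_const_mul {k F M : Type*} [Field k] [Field F] [Algebra k F] [AddCommGroup M]
    [Module k M] [Module F M] [IsScalarTower k F M] (D : Derivation k F M) (b : k) (t : F) :
    D (algebraMap k F b * t) = algebraMap k F b • D t := by
  rw [D.leibniz, D.map_algebraMap, smul_zero, add_zero]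

theorem derivation_const_mul_inv {k F M : Type*} [Field k] [Field F] [Algebra k F] [AddCommGroup M]
    [Module k M] [Module F M] [IsScalarTower k F M] (D : Derivation k F M) (b : k) (t : F) :
    D (algebraMap k F b * t⁻¹) = (algebraMap k F b * -(t ^ 2)⁻¹) • D t := by
  rw [D.leibniz, D.map_algebraMap, smul_zero, add_zero, D.leibniz_inv, smul_smul, inv_pow]

namespace QuasiProj

/-! ## Rational adjoint sections on a line -/

section Rational

universe u

variable {K : Type u} [Field K] [NumberField K] {n : ℕ} {V : QuasiProj K n} {i j : Fin (n + 1)}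
  {c d : Fin (n + 1) → K}

/-- The restriction to a line of forms over the base field. -/
theorem eval₂_lineVec_eq {A B : MvPolynomial (Fin (n + 1)) K}
    (hAB : ∀ s t : K, A.eval (lineVec c d (RingHom.id K) s t) =
      B.eval (lineVec c d (RingHom.id K) s t))
    {E : Type*} [Field E] (φ : K →+* E) (s t : E) :
    A.eval₂ φ (lineVec c d φ s t) = B.eval₂ φ (lineVec c d φ s t) := by
  set L : Fin (n + 1) → MvPolynomial (Fin 2) K := fun r => C (c r) * X 0 + C (d r) * X 1
  have key' : ∀ (x : Fin 2 → K) (f : MvPolynomial (Fin (n + 1)) K),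
      (aeval L f).eval x = f.eval (lineVec c d (RingHom.id K) (x 0) (x 1)) := by
    intro x f
    induction f using MvPolynomial.induction_on with
    | C a => simp
    | add f g hf hg => rw [map_add, map_add, hf, hg, map_add]
    | mul_X f r hf => rw [map_mul, map_mul, hf, map_mul, aeval_X]; simp [lineVec, L]
  -- Since K is infinite, equality at all K-points of the line is an identity of polynomials, valid
  -- over every extension.
  have hL : aeval L A = aeval L B := by
    have : Infinite K := inferInstance
    refine MvPolynomial.funext fun x => ?_
    rw [key', key', hAB]
  have h1 : ∀ f : MvPolynomial (Fin (n + 1)) K,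
      (aeval L f).eval₂ φ ![s, t] = f.eval₂ φ (lineVec c d φ s t) := by
    intro f
    induction f using MvPolynomial.induction_on with
    | C a => simp
    | add f g hf hg => rw [map_add, eval₂_add, hf, hg, eval₂_add]
    | mul_X f r hf => rw [map_mul, eval₂_mul, hf, eval₂_mul, aeval_X]; simp [lineVec, L]
  rw [← h1, ← h1, hL]

namespace IsLine

variable (h : V.IsLine i j c d)

include h

variable [hV : V.IsIrred]

/-- A completion comes with an embedding of K but not of its algebraic closure. The identity is
therefore first descended to the K-points of the line and then extended along φ. -/
theorem eval₂_eq_of_form_map_eq {A B : MvPolynomial (Fin (n + 1)) K}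
    (hAB : V.form (A.map (algebraMap K (AlgebraicClosure K))) =
      V.form (B.map (algebraMap K (AlgebraicClosure K))))
    {E : Type*} [Field E] (φ : K →+* E) (s t : E) :
    A.eval₂ φ (lineVec c d φ s t) = B.eval₂ φ (lineVec c d φ s t) := by
  refine eval₂_lineVec_eq (fun s t => ?_) φ s t
  have h1 := h.eval₂_eq_of_form_eq hAB (RingHom.id _) (algebraMap K _ s) (algebraMap K _ t)
  have h2 : lineVec c d ((RingHom.id (AlgebraicClosure K)).comp (algebraMap K (AlgebraicClosure K)))
      (algebraMap K _ s) (algebraMap K _ t) =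
      fun r => algebraMap K (AlgebraicClosure K) (lineVec c d (RingHom.id K) s t r) := by
    funext r
    simp [lineVec]
  apply (algebraMap K (AlgebraicClosure K)).injective
  have h3 : ∀ f : MvPolynomial (Fin (n + 1)) K,
      (f.map (algebraMap K (AlgebraicClosure K))).eval₂ (RingHom.id _)
        (fun r => algebraMap K (AlgebraicClosure K) (lineVec c d (RingHom.id K) s t r)) =
      algebraMap K (AlgebraicClosure K) (f.eval (lineVec c d (RingHom.id K) s t)) := by
    intro f
    rw [eval₂_map, RingHom.id_comp]
    exact (eval₂_comp_left _ (RingHom.id K) _ f).symm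
  rw [h2, h3, h3] at h1
  exact h1

theorem exists_eval_ne_zero {B : MvPolynomial (Fin (n + 1)) K}
    (hB : V.form (B.map (algebraMap K (AlgebraicClosure K))) ≠ 0) :
    ∃ s t : K, B.eval (lineVec c d (RingHom.id K) s t) ≠ 0 := by
  by_contra! h0
  apply hB
  rw [← map_zero V.form, form_eq_iff, sub_zero, QuasiProj.ideal, mem_vanishingIdeal_iff]
  intro x hx
  rw [(h.isLineOver _).eq_lineVec x hx]
  have := eval₂_lineVec_eq (A := B) (B := 0) (c := c) (d := d) (fun s t => by rw [h0, map_zero])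
    (algebraMap K (AlgebraicClosure K)) (x j) (x i)
  rw [eval₂_zero] at this
  rw [aeval_map_algebraMap]
  exact this

/-- The ratio of two sections over the base field is a constant only if that constant lies in the
base field. -/
theorem exists_eq_algebraMap {A B : MvPolynomial (Fin (n + 1)) K} {a : AlgebraicClosure K}
    (hAB : V.form (A.map (algebraMap K (AlgebraicClosure K))) =
      algebraMap (AlgebraicClosure K) V.Frac a *
        V.form (B.map (algebraMap K (AlgebraicClosure K))))
    (hB : V.form (B.map (algebraMap K (AlgebraicClosure K))) ≠ 0) :
    ∃ b : K, a = algebraMap K (AlgebraicClosure K) b := by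
  obtain ⟨s, t, hst⟩ := h.exists_eval_ne_zero hB
  rw [← form_C, ← map_mul] at hAB
  have h1 := h.eval₂_eq_of_form_eq hAB (RingHom.id _) (algebraMap K _ s) (algebraMap K _ t)
  have h2 : lineVec c d ((RingHom.id (AlgebraicClosure K)).comp (algebraMap K (AlgebraicClosure K)))
      (algebraMap K _ s) (algebraMap K _ t) =
      fun r => algebraMap K (AlgebraicClosure K) (lineVec c d (RingHom.id K) s t r) := by
    funext r
    simp [lineVec]
  have h3 : ∀ f : MvPolynomial (Fin (n + 1)) K,
      (f.map (algebraMap K (AlgebraicClosure K))).eval₂ (RingHom.id _)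
        (fun r => algebraMap K (AlgebraicClosure K) (lineVec c d (RingHom.id K) s t r)) =
      algebraMap K (AlgebraicClosure K) (f.eval (lineVec c d (RingHom.id K) s t)) := by
    intro f
    rw [eval₂_map, RingHom.id_comp]
    exact (eval₂_comp_left _ (RingHom.id K) _ f).symm
  rw [h2, eval₂_mul, h3, h3, eval₂_C, RingHom.id_apply] at h1
  refine ⟨A.eval (lineVec c d (RingHom.id K) s t) / B.eval (lineVec c d (RingHom.id K) s t), ?_⟩
  rw [map_div₀, h1, mul_div_cancel_right₀]
  simpa using hst

omit [NumberField K] in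
/-- A rational function without poles is constant. -/
theorem mem_range_of_ordFun_nonneg {u : V.FunField} (hu : u ≠ 0) (h0 : ∀ P, 0 ≤ V.ordFun P u) :
    u ∈ Set.range (algebraMap (AlgebraicClosure K) V.FunField) := by
  have hc := h.isCentre_infPlace
  have ht := h.isGenerator.inv
  obtain ⟨p, q, hq, hpq⟩ := (hc.mem_iff ht u).1 ((h.ordFun_nonneg_iff _ hu).1 (h0 _))
  by_contra hne
  -- This is the value of u at infinity, where u = p(1/t) / q(1/t). If u were not constant, u - a
  -- would be free of poles but vanish at infinity, although its divisor has degree zero.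
  set a := p.coeff 0 / q.coeff 0
  have hua : u - algebraMap (AlgebraicClosure K) V.FunField a ≠ 0 := fun h1 =>
    hne ⟨a, (sub_eq_zero.1 h1).symm⟩
  have hnn : ∀ P, 0 ≤ V.ordFun P (u - algebraMap (AlgebraicClosure K) V.FunField a) := fun P =>
    (h.ordFun_nonneg_iff P hua).2 (sub_mem ((h.ordFun_nonneg_iff P hu).1 (h0 P))
      (P.algebraMap_mem a))
  obtain ⟨D, hD, hD0⟩ := h.exists_divisor_fun hua
  have hD1 := eq_zero_of_degree_eq_zero (fun P => by rw [hD]; exact hnn P) hD0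
  have hord : V.ordFun h.infPlace (u - algebraMap (AlgebraicClosure K) V.FunField a) = 0 := by
    rw [← hD, hD1]; rfl
  have hq0 : Polynomial.aeval (V.ratio i j)⁻¹ q ≠ 0 :=
    ht.aeval_ne_zero (by rintro rfl; simp at hq)
  obtain ⟨r, hr⟩ : Polynomial.X ∣ p - Polynomial.C a * q := by
    rw [Polynomial.X_dvd_iff]
    simp [a, hq]
  have hfac : (u - algebraMap (AlgebraicClosure K) V.FunField a) / (V.ratio i j)⁻¹ =
      Polynomial.aeval (V.ratio i j)⁻¹ r / Polynomial.aeval (V.ratio i j)⁻¹ q := by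
    have h1 := congrArg (Polynomial.aeval (V.ratio i j)⁻¹) hr
    rw [map_sub, map_mul, map_mul, Polynomial.aeval_C, Polynomial.aeval_X] at h1
    rw [div_eq_div_iff ht.ne_zero hq0, hpq, sub_mul, div_mul_cancel₀ _ hq0, h1, mul_comm]
  have h2 : 0 ≤ V.ordFun h.infPlace
      ((u - algebraMap (AlgebraicClosure K) V.FunField a) / (V.ratio i j)⁻¹) := by
    rw [h.ordFun_nonneg_iff _ (div_ne_zero hua ht.ne_zero)]
    exact (hc.mem_iff ht _).2 ⟨r, q, hq, hfac⟩
  rw [h.ordFun_div _ hua ht.ne_zero, hord, show V.ordFun h.infPlace (V.ratio i j)⁻¹ = 1 from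
    (hc.isParam ht).ord_param] at h2
  norm_num at h2

/-- A line has an adjoint section which is defined over the base field. -/
theorem exists_adjointSection : ∃ g : V.AdjointSection, g.IsRational := by
  obtain ⟨σ⟩ := exists_complex_embedding K
  -- The section is xⱼ² ⊗ dt with N = 1 and w = 2: the double zero of xⱼ² at infinity cancels the
  -- double pole of dt. Rigidity then says that functions without poles are constant.
  have hord : ∀ P, V.ordSec P 2 (V.coord j ^ 2) + ((1 : ℕ) : ℝ) *
      V.ordDiff P (KaehlerDifferential.D (AlgebraicClosure K) V.FunField (V.ratio i j)) = 0 := by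
    intro P
    have h1 := h.ordSec_eq σ P 2 (one_ne_zero (α := V.FunField))
    have h2 := h.ordDiff_eq P (one_ne_zero (α := V.FunField))
    have h3 : ((1 : V.FunField) : V.Frac) = 1 := rfl
    rw [one_smul] at h2
    rw [h3, mul_one] at h1
    have h4 : V.ordFun P 1 = 0 := by simpa using h.ordFun_const P (one_ne_zero)
    rw [h1, h2, h4]
    push_cast
    ring
  refine ⟨⟨1, 2, le_rfl, by rw [h.a_eq]; norm_num, V.coord j ^ 2, ?_, pow_ne_zero 2
    h.coord_j_ne_zero, KaehlerDifferential.D _ _ (V.ratio i j), h.isGenerator.D_ne_zero,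
    fun P => (hord P).ge, fun k f hf hP => ?_⟩, ?_, ?_⟩
  · simpa using coord_pow_mul_mem_ratSec (j := j) 2 (1 : V.FunField)
  · refine h.mem_range_of_ordFun_nonneg hf fun P => ?_
    have := hP P
    rw [hord, mul_zero, add_zero] at this
    exact_mod_cast this
  · refine ⟨X j ^ 2, 1, by simp, ?_⟩
    simp [coord]
  · exact ⟨1, one_mem _, V.ratio i j, IntermediateField.subset_adjoin _ _ ⟨i, j, rfl⟩,
      (one_smul _ _).symm⟩

/-! ### The normal form -/

omit [NumberField K] in
theorem exists_div_of_mem_ratField {f : V.FunField} (hf : f ∈ V.RatField) :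
    ∃ P Q : Polynomial K, Q ≠ 0 ∧
      f = Polynomial.aeval (V.ratio i j) P / Polynomial.aeval (V.ratio i j) Q := by
  have hle : V.RatField ≤ IntermediateField.adjoin K {V.ratio i j} := by
    refine IntermediateField.adjoin_le_iff.2 ?_
    rintro _ ⟨r, s, rfl⟩
    have h1 : ∀ r, V.ratio r j ∈ IntermediateField.adjoin K {V.ratio i j} := by
      intro r
      have : V.ratio r j = algebraMap K V.FunField (c r) +
          algebraMap K V.FunField (d r) * V.ratio i j := by
        apply Subtype.ext
        have h2 := h.coord_j_ne_zero
        change V.coord r / V.coord j = algebraMap K V.Frac (c r) +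
          algebraMap K V.Frac (d r) * (V.coord i / V.coord j)
        rw [h.coord_eq r]
        field_simp
      rw [this]
      exact add_mem (IntermediateField.algebraMap_mem _ _)
        (mul_mem (IntermediateField.algebraMap_mem _ _)
          (IntermediateField.mem_adjoin_simple_self _ _))
    have h2 : V.ratio r s = V.ratio r j / V.ratio s j :=
      Subtype.ext (div_div_div_cancel_right₀ h.coord_j_ne_zero _ _).symm
    rw [h2]
    exact div_mem (h1 r) (h1 s)
  have hf' := hle hf
  rw [IntermediateField.mem_adjoin_simple_iff] at hf'
  obtain ⟨P, Q, rfl⟩ := hf'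
  by_cases hQ : Q = 0
  · exact ⟨0, 1, one_ne_zero, by simp [hQ]⟩
  · exact ⟨P, Q, hQ, rfl⟩

omit h [NumberField K] in
theorem aeval_mem_ratField (P : Polynomial K) :
    Polynomial.aeval (V.ratio i j) P ∈ V.RatField := by
  have ht : V.ratio i j ∈ V.RatField := IntermediateField.subset_adjoin _ _ ⟨i, j, rfl⟩
  rw [Polynomial.aeval_eq_sum_range]
  exact sum_mem fun m _ => IntermediateField.smul_mem _ (pow_mem ht m)

omit [NumberField K] in
theorem deriv_mem_ratField {f : V.FunField} (hf : f ∈ V.RatField) :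
    h.isGenerator.deriv f ∈ V.RatField := by
  obtain ⟨P, Q, hQ, rfl⟩ := h.exists_div_of_mem_ratField hf
  have key : ∀ P : Polynomial K, h.isGenerator.deriv (Polynomial.aeval (V.ratio i j) P) ∈
      V.RatField := by
    intro P
    rw [← Polynomial.aeval_map_algebraMap (AlgebraicClosure K), h.isGenerator.deriv.map_aeval,
      IsGenerator.deriv_self, Polynomial.derivative_map, Polynomial.aeval_map_algebraMap,
      smul_eq_mul, mul_one]
    exact aeval_mem_ratField _
  rw [Derivation.leibniz_div, smul_eq_mul, smul_eq_mul, smul_eq_mul]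
  exact mul_mem (pow_mem (inv_mem (aeval_mem_ratField Q)) 2)
    (sub_mem (mul_mem (aeval_mem_ratField Q) (key P)) (mul_mem (aeval_mem_ratField P) (key Q)))

theorem adjointSection_weight (g : V.AdjointSection) : g.w = 2 * g.N := by
  have := g.weight
  rw [h.a_eq] at this
  have h2 : (g.w : ℝ) = ((2 * g.N : ℕ) : ℝ) := by rw [this]; push_cast; ring
  exact_mod_cast h2

/-- Write the section as xⱼ^w u and the differential as f dt. As the divisor of g is zero, u f^N has
order zero at every place and is a constant. -/
theorem exists_const (g : V.AdjointSection) : ∃ (f : V.FunField) (a : AlgebraicClosure K), f ≠ 0 ∧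
    a ≠ 0 ∧ g.diff = f • KaehlerDifferential.D (AlgebraicClosure K) V.FunField (V.ratio i j) ∧
      g.sec * (f : V.Frac) ^ g.N =
        algebraMap (AlgebraicClosure K) V.Frac a * V.coord j ^ (2 * g.N) := by
  obtain ⟨σ⟩ := exists_complex_embedding K
  obtain ⟨f, hf, hdiff⟩ := h.exists_diff_eq g.diff_ne
  obtain ⟨u, hu, hsec⟩ := h.exists_ratSec_eq g.sec_mem g.sec_ne
  have hw := h.adjointSection_weight g
  have hfN := pow_ne_zero g.N hf
  have hord : ∀ P, V.ordFun P (u * f ^ g.N) = 0 := by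
    intro P
    have h1 := h.adjointSection_order g P
    rw [AdjointSection.order, hsec, hdiff, h.ordSec_eq σ P g.w hu, h.ordDiff_eq P hf, hw] at h1
    rw [h.ordFun_mul P hu hfN, h.ordFun_pow P hf]
    have h2 : ((V.ordFun P u + g.N * V.ordFun P f : ℤ) : ℝ) = 0 := by
      push_cast at h1 ⊢
      linarith
    exact_mod_cast h2
  obtain ⟨a, ha⟩ := h.mem_range_of_ordFun_nonneg (mul_ne_zero hu hfN) fun P => (hord P).ge
  refine ⟨f, a, hf, ?_, hdiff, ?_⟩
  · rintro rfl
    rw [map_zero] at ha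
    exact mul_ne_zero hu hfN ha.symm
  · have h3 : algebraMap (AlgebraicClosure K) V.Frac a = (u : V.Frac) * (f : V.Frac) ^ g.N :=
      congrArg Subtype.val ha
    rw [h3, hsec, hw]
    ring

/-- The normal form of a rational adjoint section on a line. -/
theorem exists_rational_const (g : V.AdjointSection) (hg : g.IsRational) :
    ∃ (f : V.FunField) (a : K), f ≠ 0 ∧ a ≠ 0 ∧
      g.diff = f • KaehlerDifferential.D (AlgebraicClosure K) V.FunField (V.ratio i j) ∧
      g.sec * (f : V.Frac) ^ g.N = algebraMap K V.Frac a * V.coord j ^ (2 * g.N) := by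
  obtain ⟨f, a, hf, ha, hdiff, hsec⟩ := h.exists_const g
  obtain ⟨⟨p, q, hq, hpq⟩, f', hf', t', ht', hdiff'⟩ := hg
  have hj := h.coord_j_ne_zero
  have hfrat : f ∈ V.RatField := by
    rw [h.isGenerator.derivation_eq (KaehlerDifferential.D _ _) t', smul_smul, hdiff] at hdiff'
    rw [h.isGenerator.smul_D_injective hdiff']
    exact mul_mem hf' (h.deriv_mem_ratField ht')
  obtain ⟨P, Q, hQ, hfPQ⟩ := h.exists_div_of_mem_ratField hfrat
  set M := max P.natDegree Q.natDegree
  have hhom : ∀ R : Polynomial K, R.natDegree ≤ M →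
      V.form ((homog i j M R).map (algebraMap K (AlgebraicClosure K))) =
        V.coord j ^ M * ((Polynomial.aeval (V.ratio i j) R : V.FunField) : V.Frac) := by
    intro R hR
    have h1 : (homog i j M R).map (algebraMap K (AlgebraicClosure K)) =
        homog i j M (R.map (algebraMap K (AlgebraicClosure K))) := by
      simp [homog]
    rw [h1, h.form_homog ((Polynomial.natDegree_map_le).trans hR), ← coe_aeval,
      Polynomial.aeval_map_algebraMap]
  have hQ0 : (Polynomial.aeval (V.ratio i j) Q : V.FunField) ≠ 0 := by
    rw [← Polynomial.aeval_map_algebraMap (AlgebraicClosure K)]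
    exact h.isGenerator.aeval_ne_zero (by
      rwa [Ne, Polynomial.map_eq_zero])
  have hQ1 : ((Polynomial.aeval (V.ratio i j) Q : V.FunField) : V.Frac) ≠ 0 := by
    simpa using hQ0
  have hcoe : (f : V.Frac) = ((Polynomial.aeval (V.ratio i j) P : V.FunField) : V.Frac) /
      ((Polynomial.aeval (V.ratio i j) Q : V.FunField) : V.Frac) := by rw [hfPQ]; rfl
  -- Clearing denominators exhibits the constant as the quotient of two forms over K, the section
  -- being p/q and f being P/Q; so the constant lies in K.
  obtain ⟨b, rfl⟩ := h.exists_eq_algebraMap (A := p * homog i j M P ^ g.N)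
    (B := X j ^ (2 * g.N) * q * homog i j M Q ^ g.N) (a := a) (by
      simp only [map_mul, map_pow, map_X, hhom _ (le_max_left _ _), hhom _ (le_max_right _ _)]
      rw [← hpq]
      change _ = _ * (V.coord j ^ (2 * g.N) * _ * _)
      have h2 : ((Polynomial.aeval (V.ratio i j) P : V.FunField) : V.Frac) =
        (f : V.Frac) * ((Polynomial.aeval (V.ratio i j) Q : V.FunField) : V.Frac) := by
          rw [hcoe, div_mul_cancel₀ _ hQ1]
      rw [h2, mul_assoc, mul_assoc, ← mul_assoc (algebraMap (AlgebraicClosure K) V.Frac a), ← hsec]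
      ring) (by
      simp only [map_mul, map_pow, map_X, hhom _ (le_max_right _ _)]
      exact mul_ne_zero (mul_ne_zero (pow_ne_zero _ hj) hq)
        (pow_ne_zero _ (mul_ne_zero (pow_ne_zero _ hj) hQ1)))
  refine ⟨f, b, hf, ?_, hdiff, ?_⟩
  · rintro rfl
    exact ha (map_zero _)
  · rw [hsec, ← IsScalarTower.algebraMap_apply]

/-! ### Local expressions -/

/-- All local expressions over K of the section give the same value, so the choice in
`Chart.density` is immaterial. -/
theorem hasValue_iff {z : V.Frac} {a : K} {m : Fin (n + 1)} {k : ℕ}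
    (hz : z = algebraMap K V.Frac a * V.coord m ^ k) {E : Type*} [Field E] (φ : K →+* E) (s t r : E) :
    HasValue z φ (lineVec c d φ s t) r ↔ r = φ a * lineVec c d φ s t m ^ k := by
  have hz' : z = V.form ((C a * X m ^ k).map (algebraMap K (AlgebraicClosure K))) := by
    rw [hz, map_mul, map_C, map_pow, map_X, map_mul, form_C, map_pow,
      ← IsScalarTower.algebraMap_apply]
    rfl
  constructor
  · rintro ⟨p, q, hpq, hq, rfl⟩
    rw [hz', ← map_mul, ← map_mul] at hpq
    rw [div_eq_iff hq, ← h.eval₂_eq_of_form_map_eq hpq φ s t]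
    simp
  · rintro rfl
    exact ⟨C a * X m ^ k, 1, by simp [hz'], by simp, by simp⟩

omit [NumberField K] in
/-- The coordinate of a chart is a multiple of `xᵢ / xⱼ` or of its inverse. -/
theorem chart_cases (g : V.AdjointSection) {f : V.FunField} {a : K}
    (hdiff : g.diff = f • KaehlerDifferential.D (AlgebraicClosure K) V.FunField (V.ratio i j))
    (hsec : g.sec * (f : V.Frac) ^ g.N = algebraMap K V.Frac a * V.coord j ^ (2 * g.N))
    {i' j' : Fin (n + 1)} {f' : V.FunField}
    (hdiff' : g.diff = f' • KaehlerDifferential.D (AlgebraicClosure K) V.FunField (V.ratio i' j')) :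
    (d i' ≠ 0 ∧ c i' = 0 ∧ c j' ≠ 0 ∧ d j' = 0 ∧ g.sec * (f' : V.Frac) ^ g.N =
      algebraMap K V.Frac (a * (c j' / d i') ^ g.N) * V.coord j ^ (2 * g.N)) ∨
    (c i' ≠ 0 ∧ d i' = 0 ∧ d j' ≠ 0 ∧ c j' = 0 ∧ g.sec * (f' : V.Frac) ^ g.N =
      algebraMap K V.Frac (a * (-(d j' / c i')) ^ g.N) * V.coord i ^ (2 * g.N)) := by
  have hrat : ∀ b : K, V.coord i' / V.coord j' ≠ algebraMap K V.Frac b := by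
    intro b hb
    apply g.diff_ne
    have hb' : V.ratio i' j' = algebraMap (AlgebraicClosure K) V.FunField
        (algebraMap K (AlgebraicClosure K) b) := Subtype.ext hb
    rw [hdiff', hb', Derivation.map_algebraMap, smul_zero]
  rcases ratio_cases (algebraMap K V.Frac) h.coord_i_ne_zero h.coord_j_ne_zero (h.c_or_d i')
    (h.c_or_d j') (h.coord_eq i') (h.coord_eq j') hrat with ⟨h1, h2, h3, h4, h5⟩ | ⟨h1, h2, h3, h4, h5⟩
  · refine Or.inl ⟨h1, h2, h3, h4, ?_⟩
    have hr : V.ratio i' j' = algebraMap (AlgebraicClosure K) V.FunField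
      (algebraMap K (AlgebraicClosure K) (d i' / c j')) * V.ratio i j := Subtype.ext h5
    have hD := derivation_const_mul (KaehlerDifferential.D (AlgebraicClosure K) V.FunField)
      (algebraMap K (AlgebraicClosure K) (d i' / c j')) (V.ratio i j)
    rw [← hr] at hD
    exact normalForm_mul (algebraMap K V.Frac) h1 h3 hsec (congrArg Subtype.val
      (h.isGenerator.eq_mul_of_smul_D_eq hD (hdiff.symm.trans hdiff')))
  · refine Or.inr ⟨h1, h2, h3, h4, ?_⟩
    have hr : V.ratio i' j' = algebraMap (AlgebraicClosure K) V.FunField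
      (algebraMap K (AlgebraicClosure K) (c i' / d j')) * (V.ratio i j)⁻¹ := Subtype.ext h5
    have hD := derivation_const_mul_inv (KaehlerDifferential.D (AlgebraicClosure K) V.FunField)
      (algebraMap K (AlgebraicClosure K) (c i' / d j')) (V.ratio i j)
    rw [← hr] at hD
    exact normalForm_inv (algebraMap K V.Frac) h.coord_i_ne_zero h.coord_j_ne_zero h1 h3 hsec
      (congrArg Subtype.val (h.isGenerator.eq_mul_of_smul_D_eq hD (hdiff.symm.trans hdiff')))

end IsLine

end Rational

end QuasiProj

/-! ## Haar measures on normed fields -/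

section Haar

/-- The measure of a ball is proportional to the `e`-th power of its radius, for the radii in the
value group. -/
structure IsModulus {E : Type*} [NormedField E] [MeasurableSpace E] (e : ℕ) (Λ : Measure E) :
    Prop where
  one_le : 1 ≤ e
  exists_lt_one : ∃ x : E, x ≠ 0 ∧ ‖x‖ < 1
  closedBall : ∀ x : E, x ≠ 0 →
    Λ (Metric.closedBall 0 ‖x‖) = ENNReal.ofReal (‖x‖ ^ e) * Λ (Metric.closedBall 0 1)

namespace IsModulus

variable {E : Type*} [NormedField E] [ProperSpace E] [MeasurableSpace E] [BorelSpace E]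
  {e : ℕ} {Λ : Measure E} [Λ.IsAddHaarMeasure]

omit [BorelSpace E] in
theorem measure_closedBall_ne_top : Λ (Metric.closedBall 0 1) ≠ ⊤ :=
  (ProperSpace.isCompact_closedBall (0 : E) 1).measure_lt_top.ne

omit [ProperSpace E] [BorelSpace E] in
theorem measure_closedBall_ne_zero : Λ (Metric.closedBall 0 1) ≠ 0 :=
  (Metric.measure_closedBall_pos Λ 0 one_pos).ne'

/-- Multiplication by x carries Λ to another Haar measure, a multiple of Λ; comparing the masses of
the balls of radius ‖x‖ and 1 determines the factor. -/
theorem lintegral_comp_mul (h : IsModulus e Λ) {x : E} (hx : x ≠ 0) {G : E → ENNReal}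
    (hG : Measurable G) :
    ENNReal.ofReal (‖x‖ ^ e) * ∫⁻ t, G (x * t) ∂Λ = ∫⁻ t, G t ∂Λ := by
  have hpos : 0 < ‖x‖ ^ e := pow_pos (norm_pos_iff.2 hx) e
  let φ : E ≃+ E :=
    { toFun := fun t => x * t
      invFun := fun t => x⁻¹ * t
      left_inv := fun t => inv_mul_cancel_left₀ hx t
      right_inv := fun t => mul_inv_cancel_left₀ hx t
      map_add' := mul_add x }
  have hφ : ∀ t, φ t = x * t := fun t => rfl
  have hc : Continuous φ := continuous_const_mul x
  have hcs : Continuous φ.symm := continuous_const_mul x⁻¹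
  have hHaar : (Λ.map φ).IsAddHaarMeasure := φ.isAddHaarMeasure_map Λ hc hcs
  have heq := Measure.isAddLeftInvariant_eq_smul (Λ.map φ) Λ
  set κ := Measure.addHaarScalarFactor (Λ.map φ) Λ
  have hpre : φ ⁻¹' (Metric.closedBall 0 ‖x‖) = Metric.closedBall 0 1 := by
    ext t
    rw [Set.mem_preimage, mem_closedBall_zero_iff, mem_closedBall_zero_iff, hφ, norm_mul]
    exact mul_le_iff_le_one_right (norm_pos_iff.2 hx)
  have h1 : Λ.map φ (Metric.closedBall 0 ‖x‖) =
      ((κ : ENNReal) • Λ) (Metric.closedBall 0 ‖x‖) := by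
    rw [heq]
    rfl
  rw [Measure.map_apply hc.measurable measurableSet_closedBall, hpre, Measure.smul_apply,
    h.closedBall x hx] at h1
  have hκ : (κ : ENNReal) * ENNReal.ofReal (‖x‖ ^ e) = 1 := by
    have h2 : ((κ : ENNReal) * ENNReal.ofReal (‖x‖ ^ e)) * Λ (Metric.closedBall 0 1) =
        1 * Λ (Metric.closedBall 0 1) := by
      rw [one_mul, mul_assoc]
      exact h1.symm
    exact (ENNReal.mul_left_inj measure_closedBall_ne_zero measure_closedBall_ne_top).1 h2
  have h3 : ∫⁻ t, G (x * t) ∂Λ = κ * ∫⁻ t, G t ∂Λ := by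
    have := lintegral_map hG hc.measurable (μ := Λ)
    rw [heq, lintegral_smul_measure] at this
    exact this.symm
  rw [h3, ← mul_assoc, mul_comm _ (κ : ENNReal), hκ, one_mul]

/-- Multiplication by an element of norm less than 1 fixes the origin but scales its finite mass by
a factor less than 1. -/
theorem measure_singleton_zero (h : IsModulus e Λ) : Λ {0} = 0 := by
  obtain ⟨x, hx, hx1⟩ := h.exists_lt_one
  have h1 := h.lintegral_comp_mul hx (G := Set.indicator {0} 1)
    (measurable_one.indicator (measurableSet_singleton 0))
  have h2 : (fun t => Set.indicator {(0 : E)} (1 : E → ENNReal) (x * t)) =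
      Set.indicator {(0 : E)} 1 := by
    classical
    funext t
    simp [Set.indicator_apply, hx]
  rw [h2, lintegral_indicator_one (measurableSet_singleton 0)] at h1
  by_contra h0
  have hfin : Λ {0} ≠ ⊤ := isCompact_singleton.measure_lt_top.ne
  have h3 : ENNReal.ofReal (‖x‖ ^ e) = 1 := by
    rw [← one_mul (Λ {0})] at h1
    nth_rewrite 1 [one_mul] at h1
    exact (ENNReal.mul_left_inj h0 hfin).1 h1
  have h4 : ENNReal.ofReal (‖x‖ ^ e) < 1 := by
    rw [ENNReal.ofReal_lt_one]
    exact pow_lt_one₀ (norm_nonneg x) hx1 (Nat.one_le_iff_ne_zero.1 h.one_le)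
  exact h4.ne h3

theorem ae_ne_zero (h : IsModulus e Λ) : ∀ᵐ t ∂Λ, t ≠ 0 := by
  rw [ae_iff]
  simpa using h.measure_singleton_zero

/-- The density of the multiplicative Haar measure. -/
def invNorm (E : Type*) [NormedField E] (e : ℕ) (t : E) : ENNReal := ENNReal.ofReal ((‖t‖ ^ e)⁻¹)

omit [ProperSpace E] in
theorem measurable_invNorm : Measurable (invNorm E e) :=
  ENNReal.measurable_ofReal.comp ((measurable_norm.pow_const e).inv)

omit [ProperSpace E] [MeasurableSpace E] [BorelSpace E] in
theorem invNorm_mul (x t : E) : invNorm E e (x * t) = invNorm E e x * invNorm E e t := by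
  rw [invNorm, norm_mul, mul_pow, mul_inv, ENNReal.ofReal_mul (by positivity)]
  rfl

omit [ProperSpace E] [MeasurableSpace E] [BorelSpace E] in
theorem ofReal_mul_invNorm {x : E} (hx : x ≠ 0) : ENNReal.ofReal (‖x‖ ^ e) * invNorm E e x = 1 := by
  have : 0 < ‖x‖ ^ e := pow_pos (norm_pos_iff.2 hx) e
  rw [invNorm, ← ENNReal.ofReal_mul this.le, mul_inv_cancel₀ this.ne', ENNReal.ofReal_one]

omit [ProperSpace E] [MeasurableSpace E] [BorelSpace E] in
theorem invNorm_zero (he : 1 ≤ e) : invNorm E e 0 = 0 := by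
  rw [invNorm, norm_zero, zero_pow (Nat.one_le_iff_ne_zero.1 he), inv_zero, ENNReal.ofReal_zero]

theorem lintegral_comp_mul_invNorm (h : IsModulus e Λ) {x : E} (hx : x ≠ 0) {G : E → ENNReal}
    (hG : Measurable G) :
    ∫⁻ t, G (x * t) * invNorm E e t ∂Λ = ∫⁻ t, G t * invNorm E e t ∂Λ := by
  rw [← h.lintegral_comp_mul hx (hG.fun_mul measurable_invNorm), ← lintegral_const_mul]
  · refine lintegral_congr fun t => ?_
    rw [invNorm_mul]
    calc _ = (ENNReal.ofReal (‖x‖ ^ e) * invNorm E e x) * (G (x * t) * invNorm E e t) := by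
          rw [ofReal_mul_invNorm hx, one_mul]
      _ = _ := by ring
  · exact (hG.fun_mul measurable_invNorm).comp (measurable_const_mul x)

/-- The multiplicative Haar measure is invariant under inversion. -/
theorem lintegral_comp_inv_invNorm (h : IsModulus e Λ) {g : E → ENNReal} (hg : Measurable g) :
    ∫⁻ t, g t⁻¹ * invNorm E e t ∂Λ = ∫⁻ t, g t * invNorm E e t ∂Λ := by
  set M := invNorm E e with hMdef
  have hM : Measurable M := measurable_invNorm
  -- An auxiliary function whose multiplicative integral is the mass of the unit ball, which is
  -- neither zero nor infinite and so can be cancelled.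
  set f : E → ENNReal := Set.indicator (Metric.closedBall 0 1) fun t => ENNReal.ofReal (‖t‖ ^ e)
    with hfdef
  have hf : Measurable f := Measurable.indicator
    (ENNReal.measurable_ofReal.comp (measurable_norm.pow_const e)) measurableSet_closedBall
  have hfM : ∫⁻ t, f t * M t ∂Λ = Λ (Metric.closedBall 0 1) := by
    rw [← lintegral_indicator_one measurableSet_closedBall]
    refine lintegral_congr_ae ?_
    classical
    filter_upwards [h.ae_ne_zero] with t ht
    rw [hfdef, Set.indicator_apply, Set.indicator_apply]
    split_ifs
    · exact ofReal_mul_invNorm ht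
    · exact zero_mul _
  -- The usual uniqueness argument: the double integral of f(x) g(x/y) for the multiplicative
  -- measure is evaluated in two ways, by rescaling y for fixed x and by rescaling x for fixed y.
  have key : (∫⁻ x, f x * M x ∂Λ) * ∫⁻ y, g y⁻¹ * M y ∂Λ =
      (∫⁻ y, f y * M y ∂Λ) * ∫⁻ x, g x * M x ∂Λ := by
    have hm1 : Measurable fun y : E => g y⁻¹ * M y := (hg.comp measurable_inv).mul hM
    calc _ = ∫⁻ x, ∫⁻ y, (f x * M x) * (g (x * y⁻¹) * M y) ∂Λ ∂Λ := by
          rw [← lintegral_mul_const _ (hf.fun_mul hM)]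
          refine lintegral_congr fun x => ?_
          have hm : Measurable fun y : E => g (x * y⁻¹) * M y :=
            (hg.comp (measurable_inv.const_mul x)).mul hM
          rw [lintegral_const_mul _ hm]
          by_cases hx : x = 0
          · rw [hx, hMdef, invNorm_zero h.one_le, mul_zero, zero_mul, zero_mul]
          · have h1 := h.lintegral_comp_mul_invNorm (inv_ne_zero hx) (G := fun y => g y⁻¹)
              (hg.comp measurable_inv)
            simp only [mul_inv, inv_inv] at h1
            rw [hMdef, h1]
      _ = ∫⁻ y, ∫⁻ x, (f x * M x) * (g (x * y⁻¹) * M y) ∂Λ ∂Λ := by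
          refine lintegral_lintegral_swap (Measurable.aemeasurable ?_)
          exact ((hf.fun_mul hM).comp measurable_fst).mul
            ((hg.comp (measurable_fst.mul measurable_snd.inv)).mul (hM.comp measurable_snd))
      _ = ∫⁻ y, ∫⁻ x, (f (y * x) * M y) * (g x * M x) ∂Λ ∂Λ := by
          refine lintegral_congr fun y => ?_
          by_cases hy : y = 0
          · simp [hy, hMdef, invNorm_zero h.one_le]
          · have h1 := h.lintegral_comp_mul_invNorm hy
              (G := fun x => f x * g (x * y⁻¹) * M y)
              ((hf.mul (hg.comp (measurable_id.mul_const y⁻¹))).mul_const _)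
            calc _ = ∫⁻ x, (f x * g (x * y⁻¹) * M y) * M x ∂Λ :=
                  lintegral_congr fun x => by ring
              _ = _ := h1.symm
              _ = _ := lintegral_congr fun x => by
                  rw [mul_comm y x, mul_assoc x y, mul_inv_cancel₀ hy, mul_one]
                  ring
      _ = ∫⁻ x, ∫⁻ y, (f (y * x) * M y) * (g x * M x) ∂Λ ∂Λ := by
          refine lintegral_lintegral_swap (Measurable.aemeasurable ?_)
          exact ((hf.comp (measurable_fst.mul measurable_snd)).mul (hM.comp measurable_fst)).mul
            ((hg.fun_mul hM).comp measurable_snd)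
      _ = _ := by
          rw [← lintegral_const_mul _ (hg.fun_mul hM)]
          refine lintegral_congr fun x => ?_
          have hm : Measurable fun y : E => f (y * x) * M y :=
            (hf.comp (measurable_id.mul_const x)).mul hM
          rw [lintegral_mul_const _ hm]
          by_cases hx : x = 0
          · rw [hx, hMdef, invNorm_zero h.one_le, mul_zero, mul_zero, mul_zero]
          · rw [← h.lintegral_comp_mul_invNorm hx hf]
            simp only [mul_comm x, hMdef]
  rw [hfM] at key
  exact (ENNReal.mul_right_inj measure_closedBall_ne_zero measure_closedBall_ne_top).1 key

/-- The change of variables `t ↦ t⁻¹`. -/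
theorem lintegral_comp_inv (h : IsModulus e Λ) {G : E → ENNReal} (hG : Measurable G) :
    ∫⁻ t, G t⁻¹ * invNorm E e t ^ 2 ∂Λ = ∫⁻ t, G t ∂Λ := by
  have h1 := h.lintegral_comp_inv_invNorm (g := fun t => G t * ENNReal.ofReal (‖t‖ ^ e))
    (hG.mul (ENNReal.measurable_ofReal.comp (measurable_norm.pow_const e)))
  calc _ = ∫⁻ t, G t⁻¹ * ENNReal.ofReal (‖t⁻¹‖ ^ e) * invNorm E e t ∂Λ := by
        refine lintegral_congr fun t => ?_
        rw [norm_inv, inv_pow, sq, mul_assoc]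
        rfl
    _ = _ := h1
    _ = _ := by
        refine lintegral_congr_ae ?_
        filter_upwards [h.ae_ne_zero] with t ht
        rw [mul_assoc, ofReal_mul_invNorm ht, mul_one]

/-- The projective line is the union of the ball ‖t‖ ≤ 1 and the ball ‖1/t‖ < 1; in the coordinates
t and 1/t respectively the density is 1. -/
theorem lintegral_inv_max_one (h : IsModulus e Λ) :
    ∫⁻ t : E, ENNReal.ofReal ((max 1 ‖t‖ ^ (2 * e))⁻¹) ∂Λ =
      Λ (Metric.closedBall 0 1) + Λ (Metric.ball 0 1) := by
  rw [← lintegral_indicator_one measurableSet_closedBall,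
    ← lintegral_indicator_one (μ := Λ) measurableSet_ball,
    ← h.lintegral_comp_inv (measurable_one.indicator measurableSet_ball),
    ← lintegral_add_left (measurable_one.indicator measurableSet_closedBall)]
  refine lintegral_congr_ae ?_
  filter_upwards [h.ae_ne_zero] with t ht
  classical
  have hpos := norm_pos_iff.2 ht
  simp only [Set.indicator_apply, mem_closedBall_zero_iff, mem_ball_zero_iff, norm_inv,
    Pi.one_apply]
  rcases le_or_gt ‖t‖ 1 with h1 | h1
  · rw [if_pos h1, if_neg, max_eq_left h1]
    · simp
    · rw [not_lt, one_le_inv₀ hpos]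
      exact h1
  · rw [if_neg h1.not_ge, if_pos (inv_lt_one_of_one_lt₀ h1), max_eq_right h1.le, zero_add, one_mul,
      invNorm, ← ENNReal.ofReal_pow (by positivity), inv_pow, ← pow_mul, mul_comm e]

/-- The total mass of the projective line for the measure defined by the maximum norm. -/
theorem lintegral_inv_max (h : IsModulus e Λ) {x y : E} (hx : x ≠ 0) (hy : y ≠ 0) :
    ∫⁻ t : E, ENNReal.ofReal ((max ‖x‖ (‖y‖ * ‖t‖) ^ (2 * e))⁻¹) ∂Λ =
      ENNReal.ofReal (((‖x‖ * ‖y‖) ^ e)⁻¹) *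
        (Λ (Metric.closedBall 0 1) + Λ (Metric.ball 0 1)) := by
  have hx' := norm_pos_iff.2 hx
  have hy' := norm_pos_iff.2 hy
  rw [← h.lintegral_comp_mul (div_ne_zero hx hy), ← h.lintegral_inv_max_one, ← lintegral_const_mul,
    ← lintegral_const_mul]
  · refine lintegral_congr fun t => ?_
    -- The substitution t ↦ (x / y) t reduces to the case of norms 1.
    have h1 : max ‖x‖ (‖y‖ * ‖x / y * t‖) = ‖x‖ * max 1 ‖t‖ := by
      rw [norm_mul, norm_div, mul_max_of_nonneg _ _ hx'.le, mul_one]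
      congr 1
      field_simp
    rw [h1, ← ENNReal.ofReal_mul (by positivity), ← ENNReal.ofReal_mul (by positivity), norm_div]
    congr 1
    rw [div_pow, mul_pow, mul_pow, mul_comm 2 e, pow_mul, pow_mul]
    field_simp
  · fun_prop
  · fun_prop
  · fun_prop

end IsModulus

end Haar

/-- The Borel sets of a normed field. -/
abbrev fieldBorel (E : Type*) [NormedField E] : MeasurableSpace E := borel E

attribute [local instance] fieldBorel

instance borelSpace_fieldBorel (E : Type*) [NormedField E] : @BorelSpace E _ (fieldBorel E) := ⟨rfl⟩

/-! ### Haar measures of unit balls and integrals in charts -/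

namespace QuasiProj

theorem haarBall_eq (E : Type*) [NormedField E] [ProperSpace E] (vol : ENNReal) :
    ∃ K₀ : TopologicalSpace.PositiveCompacts E, (K₀ : Set E) = Metric.closedBall 0 1 ∧
      haarBall E vol = vol • Measure.addHaarMeasure K₀ := by
  refine ⟨⟨⟨Metric.closedBall 0 1, ProperSpace.isCompact_closedBall 0 1⟩, ⟨0,
    Metric.ball_subset_interior_closedBall (Metric.mem_ball_self one_pos)⟩⟩, rfl, ?_⟩
  rw [haarBall, dif_pos (ProperSpace.isCompact_closedBall 0 1)]

theorem isAddHaarMeasure_haarBall (E : Type*) [NormedField E] [ProperSpace E] {vol : ENNReal}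
    (h0 : vol ≠ 0) (h1 : vol ≠ ⊤) : (haarBall E vol).IsAddHaarMeasure := by
  obtain ⟨K₀, -, h⟩ := haarBall_eq E vol
  rw [h]
  exact Measure.IsAddHaarMeasure.smul _ h0 h1

theorem haarBall_closedBall (E : Type*) [NormedField E] [ProperSpace E] (vol : ENNReal) :
    haarBall E vol (Metric.closedBall 0 1) = vol := by
  obtain ⟨K₀, hK, h⟩ := haarBall_eq E vol
  rw [h, ← hK, Measure.smul_apply, Measure.addHaarMeasure_self, smul_eq_mul, mul_one]

/-- A chart may cover only a part of E, hence the inequality. Points with coordinate 0 form a null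
set and are ignored, which matters when the chart coordinate is inverse to xᵢ / xⱼ and 0 is the
point at infinity. -/
theorem setLIntegral_comap_le {X E : Type*} [MeasurableSpace X] [NormedField E] {Λ : Measure E}
    (hΛ : Λ {0} = 0) {α : X → E} (hα : MeasurableEmbedding α) {S : Set X} (hS : MeasurableSet S)
    {δ : X → ENNReal} {h : E → ENNReal}
    (hδ : ∀ P ∈ S, α P ≠ 0 → δ P ≤ h (α P)) :
    ∫⁻ P in S, δ P ∂Measure.comap α Λ ≤ ∫⁻ t, h t ∂Λ := by
  have h1 : ∫⁻ P, h (α P) ∂Measure.comap α Λ ≤ ∫⁻ t, h t ∂Λ := by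
    rw [← hα.lintegral_map, hα.map_comap]
    exact setLIntegral_le_lintegral _ _
  refine le_trans ?_ h1
  refine le_trans (lintegral_mono_ae ?_) (setLIntegral_le_lintegral S _)
  rw [ae_restrict_iff' hS]
  have h2 : ∀ᵐ P ∂Measure.comap α Λ, α P ≠ 0 := by
    rw [ae_iff]
    have : {P | ¬α P ≠ 0} = α ⁻¹' {0} := by ext P; simp
    rw [this, ← hα.map_apply, hα.map_comap]
    exact measure_mono_null (Set.Subset.refl _) (Measure.absolutelyContinuous_of_le
      Measure.restrict_le_self hΛ)
  filter_upwards [h2] with P hP hPS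
  exact hδ P hPS hP

theorem setLIntegral_comap_eq {X E : Type*} [MeasurableSpace X] [NormedField E] {Λ : Measure E}
    {α : X → E} (hα : MeasurableEmbedding α) (hsurj : Function.Surjective α) {S : Set X}
    (hS : MeasurableSet S) {δ : X → ENNReal} {h : E → ENNReal}
    (hδ : ∀ P, S.indicator δ P = h (α P)) :
    ∫⁻ P in S, δ P ∂Measure.comap α Λ = ∫⁻ t, h t ∂Λ := by
  rw [← lintegral_indicator hS]
  simp only [hδ]
  rw [← hα.lintegral_map, hα.map_comap, hsurj.range_eq, Measure.restrict_univ]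

theorem inversion_identity (b : ℝ) {k y : ℝ} (hk : k ≠ 0) (hy : y ≠ 0) (x z : ℝ) (e : ℕ) :
    b * k⁻¹ ^ e * (x / z) ^ (2 * e) =
      k ^ e * (b * (y / z) ^ (2 * e) * ((k⁻¹ * (x / y)) ^ e) ^ 2) := by
  rw [pow_mul', pow_mul', mul_pow _ _ e, div_pow x z, div_pow y z, div_pow x y, inv_pow]
  have h1 := pow_ne_zero e hk
  have h2 := pow_ne_zero e hy
  generalize x ^ e = X at *
  generalize y ^ e = Y at *
  generalize k ^ e = L at *
  generalize z ^ e = Z at *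
  field_simp

theorem norm_rpow_mul {E : Type*} [NormedField E] {N e : ℕ} (hN : 1 ≤ N) (a κ : E) :
    ‖a * κ ^ N‖ ^ ((e : ℝ) / N) = ‖a‖ ^ ((e : ℝ) / N) * ‖κ‖ ^ e := by
  rw [norm_mul, Real.mul_rpow (norm_nonneg _) (norm_nonneg _), norm_pow, ← Real.rpow_natCast,
    ← Real.rpow_mul (norm_nonneg _)]
  congr 1
  rw [mul_div_cancel₀, Real.rpow_natCast]
  positivity

section Local

variable {K : Type*} [Field K] {n : ℕ} {V : QuasiProj K n} {i j : Fin (n + 1)}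
  {c d : Fin (n + 1) → K} {E : Type*} [NormedField E] {φ : K →+* E}

/-- Every coordinate of the vector is a multiple of s alone or of t alone, so its norm involves no
sum, even over an archimedean field. -/
theorem norm_lineVec (hcd : ∀ r, c r = 0 ∨ d r = 0) (s t : E) :
    ‖lineVec c d φ s t‖ = max (‖fun r => φ (c r)‖ * ‖s‖) (‖fun r => φ (d r)‖ * ‖t‖) := by
  apply le_antisymm
  · rw [pi_norm_le_iff_of_nonneg (by positivity)]
    intro r
    rcases hcd r with h | h
    · rw [lineVec, h, map_zero, zero_mul, zero_add, norm_mul]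
      exact le_max_of_le_right (mul_le_mul_of_nonneg_right
        (norm_le_pi_norm (fun r => φ (d r)) r) (norm_nonneg _))
    · rw [lineVec, h, map_zero, zero_mul, add_zero, norm_mul]
      exact le_max_of_le_left (mul_le_mul_of_nonneg_right
        (norm_le_pi_norm (fun r => φ (c r)) r) (norm_nonneg _))
  · refine max_le ?_ ?_
    · rw [mul_comm, ← norm_smul, pi_norm_le_iff_of_nonneg (norm_nonneg _)]
      intro r
      rcases hcd r with h | h
      · simp [h]
      · have := norm_le_pi_norm (lineVec c d φ s t) r
        rw [lineVec, h, map_zero, zero_mul, add_zero] at this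
        rwa [Pi.smul_apply, smul_eq_mul, mul_comm]
    · rw [mul_comm, ← norm_smul, pi_norm_le_iff_of_nonneg (norm_nonneg _)]
      intro r
      rcases hcd r with h | h
      · have := norm_le_pi_norm (lineVec c d φ s t) r
        rw [lineVec, h, map_zero, zero_mul, zero_add] at this
        rwa [Pi.smul_apply, smul_eq_mul, mul_comm]
      · simp [h]

instance (φ : K →+* E) : BorelSpace (V.Points φ) := ⟨rfl⟩

variable (h : V.IsLineOver i j c d φ)

include h

namespace IsLineOver

theorem lineVec_ne_zero (t : E) : lineVec c d φ 1 t ≠ 0 := (h.mem_cone 1 t one_ne_zero).1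

/-- The affine parametrization of a line. -/
def affPt (t : E) : V.Points φ := by
  refine ⟨Projectivization.mk E (lineVec c d φ 1 t) (h.lineVec_ne_zero t), ?_⟩
  obtain ⟨a, ha⟩ := Projectivization.exists_smul_eq_mk_rep E (lineVec c d φ 1 t)
    (h.lineVec_ne_zero t)
  rw [← ha]
  have : a • lineVec c d φ 1 t = lineVec c d φ (a : E) (a * t) := by
    funext r
    simp only [lineVec, Pi.smul_apply, Units.smul_def, smul_eq_mul]
    ring
  rw [this]
  exact h.mem_cone _ _ a.ne_zero

theorem continuous_affPt : Continuous h.affPt := by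
  refine continuous_induced_rng.2 ?_
  have h1 : Continuous fun t : E =>
      (⟨lineVec c d φ 1 t, h.lineVec_ne_zero t⟩ : {x : Fin (n + 1) → E // x ≠ 0}) := by
    refine Continuous.subtype_mk (continuous_pi fun r => ?_) _
    simp only [lineVec]
    fun_prop
  have h2 : @Continuous _ _ _ (TopologicalSpace.coinduced
      (Projectivization.mk' E : {x : Fin (n + 1) → E // x ≠ 0} → ℙ E (Fin (n + 1) → E))
      inferInstance) (Projectivization.mk' E : {x : Fin (n + 1) → E // x ≠ 0} →
        ℙ E (Fin (n + 1) → E)) := continuous_coinduced_rng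
  have h3 := @Continuous.comp _ _ _ _ _ (_) _ _ h2 h1
  exact h3

theorem rep_eq (P : V.Points φ) : P.1.rep = lineVec c d φ (P.1.rep j) (P.1.rep i) :=
  h.eq_lineVec _ P.2

theorem affPt_affineCoord {P : V.Points φ} (hP : P.1.rep j ≠ 0) :
    h.affPt (affineCoord φ i j P) = P := by
  apply Subtype.ext
  conv_rhs => rw [← P.1.mk_rep]
  change Projectivization.mk E _ _ = _
  rw [Projectivization.mk_eq_mk_iff']
  refine ⟨(P.1.rep j)⁻¹, ?_⟩
  funext r
  have hr := congrFun (h.rep_eq P) r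
  rw [Pi.smul_apply, hr]
  simp only [lineVec, smul_eq_mul, affineCoord]
  field_simp

omit h in
-- An open condition that is invariant under scaling descends to the quotient topology of projective
-- space, whatever representatives are chosen.
theorem isOpen_setOf_rep {p : (Fin (n + 1) → E) → Prop} (hp : IsOpen {x | p x})
    (hsmul : ∀ (a : Eˣ) x, p (a • x) ↔ p x) : IsOpen {P : V.Points φ | p P.1.rep} := by
  refine (@isOpen_induced_iff _ _ (_) _ _).2 ⟨{Q | p Q.rep}, ?_, rfl⟩
  rw [isOpen_coinduced]
  have : (Projectivization.mk' E : {x : Fin (n + 1) → E // x ≠ 0} → ℙ E (Fin (n + 1) → E)) ⁻¹'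
      {Q | p Q.rep} = Subtype.val ⁻¹' {x | p x} := by
    ext x
    obtain ⟨a, ha⟩ := Projectivization.exists_smul_eq_mk_rep E x.1 x.2
    change p (Projectivization.mk E x.1 x.2).rep ↔ p x.1
    rw [← ha, hsmul]
  rw [this]
  exact hp.preimage continuous_subtype_val

end IsLineOver

namespace IsLine

variable (hV : V.IsLine i j c d)

include hV

omit hV in
theorem affPt_rep (t : E) : ∃ a : Eˣ, (h.affPt t).1.rep = a • lineVec c d φ 1 t := by
  obtain ⟨a, ha⟩ := Projectivization.exists_smul_eq_mk_rep E (lineVec c d φ 1 t)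
    (h.lineVec_ne_zero t)
  exact ⟨a, ha.symm⟩

theorem rep_affPt_ne (t : E) : (h.affPt t).1.rep j ≠ 0 := by
  obtain ⟨a, ha⟩ := affPt_rep h t
  rw [ha, Pi.smul_apply, hV.lineVec_j]
  simp [Units.smul_def]

theorem affineCoord_affPt (t : E) : affineCoord φ i j (h.affPt t) = t := by
  obtain ⟨a, ha⟩ := affPt_rep h t
  rw [affineCoord, ha, Pi.smul_apply, Pi.smul_apply, hV.lineVec_j, hV.lineVec_i]
  simp [Units.smul_def]

omit h hV in
theorem isOpen_rep_ne (φ : K →+* E) (j : Fin (n + 1)) :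
    IsOpen {P : V.Points φ | P.1.rep j ≠ 0} :=
  IsLineOver.isOpen_setOf_rep (isOpen_ne_fun (continuous_apply j) continuous_const)
    fun a x => by simp [Units.smul_def]

/-- The parametrization `affPt` is a continuous inverse, so the coordinate is a homeomorphism onto
all of E. -/
theorem isOpenEmbedding_affineCoord :
    IsOpenEmbedding fun P : {P : V.Points φ | P.1.rep j ≠ 0} => affineCoord φ i j P.1 := by
  have hcont : Continuous fun P : {P : V.Points φ | P.1.rep j ≠ 0} => affineCoord φ i j P.1 := by
    refine continuous_def.2 fun S hS => ?_
    have h1 : IsOpen {P : V.Points φ | P.1.rep j ≠ 0 ∧ P.1.rep i / P.1.rep j ∈ S} := by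
      refine IsLineOver.isOpen_setOf_rep (p := fun x => x j ≠ 0 ∧ x i / x j ∈ S) ?_ fun a x => ?_
      · have h2 : ContinuousOn (fun x : Fin (n + 1) → E => x i / x j) {x | x j ≠ 0} :=
          (continuous_apply i).continuousOn.div (continuous_apply j).continuousOn fun x hx => hx
        exact h2.isOpen_inter_preimage (isOpen_ne_fun (continuous_apply j) continuous_const) hS
      · simp only [Pi.smul_apply, Units.smul_def, smul_eq_mul, ne_eq, mul_eq_zero,
          a.ne_zero, false_or, mul_div_mul_left _ _ a.ne_zero]
    convert h1.preimage continuous_subtype_val using 1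
    ext P
    constructor
    · intro hP
      exact ⟨P.2, hP⟩
    · exact fun hP => hP.2
  let e : {P : V.Points φ | P.1.rep j ≠ 0} ≃ₜ E :=
    { toFun := fun P => affineCoord φ i j P.1
      invFun := fun t => ⟨h.affPt t, hV.rep_affPt_ne h t⟩
      left_inv := fun P => Subtype.ext (h.affPt_affineCoord P.2)
      right_inv := fun t => hV.affineCoord_affPt h t
      continuous_toFun := hcont
      continuous_invFun := h.continuous_affPt.subtype_mk _ }
  exact e.isOpenEmbedding

end IsLine

end Local

/-! ### The local Tamagawa measure of a line and its total mass -/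

section Tamagawa

universe u

variable {K : Type u} [Field K] [NumberField K] {n : ℕ} {V : QuasiProj K n} {i j : Fin (n + 1)}
  {c d : Fin (n + 1) → K} {E : Type*} [NormedField E] {φ : K →+* E} [hI : V.IsIrred]

namespace IsLine

variable (hV : V.IsLine i j c d) (h : V.IsLineOver i j c d φ)

include hV h

/-- The section b x_m^(2N) has norm |b| (|x_m| / max |xᵣ|)^(2N); the exponent e / N removes N from
the second factor. -/
theorem density_eq {g : V.AdjointSection} (C : Chart g φ) {b : K} {m : Fin (n + 1)}
    (hb : g.sec * (C.f : V.Frac) ^ g.N = algebraMap K V.Frac b * V.coord m ^ (2 * g.N)) (e : ℕ)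
    (P : V.Points φ) :
    C.density e P = ‖φ b‖ ^ ((e : ℝ) / g.N) * (‖P.1.rep m‖ / ‖P.1.rep‖) ^ (2 * e) := by
  have hval : ∀ r, HasValue (g.sec * (C.f : V.Frac) ^ g.N) φ P.1.rep r ↔
      r = φ b * P.1.rep m ^ (2 * g.N) := by
    intro r
    have := hV.hasValue_iff hb φ (P.1.rep j) (P.1.rep i) r
    rwa [← h.rep_eq P] at this
  have hex : ∃ r, HasValue (g.sec * (C.f : V.Frac) ^ g.N) φ P.1.rep r := ⟨_, (hval _).2 rfl⟩
  rw [Chart.density, dif_pos hex, (hval _).1 hex.choose_spec, hV.adjointSection_weight, norm_mul,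
    norm_pow, mul_div_assoc, ← div_pow, Real.mul_rpow (norm_nonneg _) (by positivity)]
  congr 1
  have hN : (g.N : ℝ) ≠ 0 := by
    have := g.one_le
    positivity
  rw [← Real.rpow_natCast, ← Real.rpow_mul (by positivity), ← Real.rpow_natCast]
  congr 1
  push_cast
  field_simp

omit [NumberField K] hI in
theorem norm_rep_div {P : V.Points φ} (hP : P.1.rep j ≠ 0) :
    ‖P.1.rep j‖ / ‖P.1.rep‖ =
      (max ‖fun r => φ (c r)‖ (‖fun r => φ (d r)‖ * ‖affineCoord φ i j P‖))⁻¹ := by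
  have h1 : ‖P.1.rep‖ = ‖P.1.rep j‖ *
      max ‖fun r => φ (c r)‖ (‖fun r => φ (d r)‖ * ‖affineCoord φ i j P‖) := by
    conv_lhs => rw [h.rep_eq P, norm_lineVec hV.c_or_d]
    rw [mul_max_of_nonneg _ _ (norm_nonneg _), affineCoord, norm_div, mul_comm]
    congr 1
    have := norm_ne_zero_iff.2 hP
    field_simp
  rw [h1, div_mul_eq_div_div, div_self (norm_ne_zero_iff.2 hP), one_div]

/-- The density of the Tamagawa measure in the standard coordinate. -/
def lineDensity (_ : V.IsLine i j c d) (φ : K →+* E) (b : ℝ) (e : ℕ) (t : E) : ENNReal :=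
  ENNReal.ofReal (b * (max ‖fun r => φ (c r)‖ (‖fun r => φ (d r)‖ * ‖t‖) ^ (2 * e))⁻¹)

omit h [NumberField K] hI in
theorem measurable_lineDensity (b : ℝ) (e : ℕ) : Measurable (hV.lineDensity φ b e) := by
  unfold lineDensity
  fun_prop

omit [NumberField K] hV hI in
theorem measurable_affPt : Measurable h.affPt := h.continuous_affPt.measurable

variable [ProperSpace E]

/-- The coordinate of any chart is a constant times t = xᵢ / xⱼ or its inverse, and the density
changes by the modulus of the corresponding substitution. So every chart gives the restriction of
one and the same measure, which bounds their supremum. -/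
theorem chart_measure_le {g : V.AdjointSection} {f : V.FunField} {a : K}
    (hdiff : g.diff = f • KaehlerDifferential.D (AlgebraicClosure K) V.FunField (V.ratio i j))
    (hsec : g.sec * (f : V.Frac) ^ g.N = algebraMap K V.Frac a * V.coord j ^ (2 * g.N))
    {e : ℕ} {vol : ENNReal} (h0 : vol ≠ 0) (h1 : vol ≠ ⊤) (hm : IsModulus e (haarBall E vol))
    (C : Chart g φ) :
    C.measure e vol ≤ Measure.map h.affPt ((haarBall E vol).withDensity
      (hV.lineDensity φ (‖φ a‖ ^ ((e : ℝ) / g.N)) e)) := by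
  have hHaar := isAddHaarMeasure_haarBall E h0 h1
  set b := ‖φ a‖ ^ ((e : ℝ) / g.N) with hb
  have hb0 : 0 ≤ b := by positivity
  have hρ := hV.measurable_lineDensity (φ := φ) b e
  have hψ := measurable_affPt h
  rw [Measure.le_iff]
  intro S hS
  have hG : Measurable (Set.indicator (h.affPt ⁻¹' S) (hV.lineDensity φ b e)) :=
    hρ.indicator (hψ hS)
  set G := Set.indicator (h.affPt ⁻¹' S) (hV.lineDensity φ b e) with hGdef
  rw [Measure.map_apply hψ hS, withDensity_apply _ (hψ hS), ← lintegral_indicator (hψ hS), ← hGdef]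
  rw [Chart.measure, Measure.map_apply measurable_subtype_coe hS,
    withDensity_apply _ (measurable_subtype_coe hS)]
  have hemb : MeasurableEmbedding fun P : C.dom => affineCoord φ C.i C.j P.1 :=
    C.isOpenEmbedding.measurableEmbedding
  have hz := hm.measure_singleton_zero
  have hGval : ∀ P : V.Points φ, P ∈ S → P.1.rep j ≠ 0 →
      G (affineCoord φ i j P) = ENNReal.ofReal (b * (‖P.1.rep j‖ / ‖P.1.rep‖) ^ (2 * e)) := by
    intro P hPS hP
    rw [hGdef, Set.indicator_of_mem, lineDensity, hV.norm_rep_div h hP, inv_pow]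
    rw [Set.mem_preimage, h.affPt_affineCoord hP]
    exact hPS
  rcases hV.chart_cases g hdiff hsec C.diff_eq with ⟨hd, hc, hc', hd', hs⟩ | ⟨hc, hd, hd', hc', hs⟩
  -- Here t is κ times the chart coordinate, and dt scales by ‖κ‖^e.
  · set κ := φ (c C.j / d C.i) with hκdef
    have hκ : κ ≠ 0 := by simp [hκdef, hd, hc']
    have hG1 : Measurable fun t => G (κ * t) := hG.comp (measurable_const_mul κ)
    rw [← hm.lintegral_comp_mul hκ hG, ← lintegral_const_mul _ hG1]
    refine setLIntegral_comap_le hz hemb (measurable_subtype_coe hS)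
      fun P hPS _ => ?_
    have hrj : P.1.1.rep C.j = φ (c C.j) * P.1.1.rep j := by
      conv_lhs => rw [h.rep_eq P.1]
      simp [lineVec, hd']
    have hri : P.1.1.rep C.i = φ (d C.i) * P.1.1.rep i := by
      conv_lhs => rw [h.rep_eq P.1]
      simp [lineVec, hc]
    have hPj : P.1.1.rep j ≠ 0 := by
      intro h2
      apply C.rep_ne P.1 P.2
      rw [hrj, h2, mul_zero]
    have hcoord : κ * affineCoord φ C.i C.j P.1 = affineCoord φ i j P.1 := by
      have h2 : φ (c C.j) ≠ 0 := by simpa using hc'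
      have h3 : φ (d C.i) ≠ 0 := by simpa using hd
      rw [affineCoord, affineCoord, hri, hrj, hκdef, map_div₀]
      field_simp
    rw [hcoord, hGval P.1 hPS hPj, hV.density_eq h C hs, map_mul, map_pow,
      norm_rpow_mul g.one_le, ← ENNReal.ofReal_mul (by positivity)]
    apply le_of_eq
    congr 1
    ring
  -- Here t is κ times the inverse of the chart coordinate u, and the substitution contributes ‖κ‖^e
  -- ‖u‖^(-2e).
  · set κ := φ (c C.i / d C.j) with hκdef
    have hκ : κ ≠ 0 := by simp [hκdef, hc, hd']
    have hG2 : Measurable fun t => G (κ * t) := hG.comp (measurable_const_mul κ)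
    have hG3 : Measurable fun t => G (κ * t⁻¹) * IsModulus.invNorm E e t ^ 2 :=
      (hG2.comp measurable_inv).mul (IsModulus.measurable_invNorm.pow_const 2)
    rw [← hm.lintegral_comp_mul hκ hG, ← hm.lintegral_comp_inv hG2, ← lintegral_const_mul _ hG3]
    refine setLIntegral_comap_le hz hemb (measurable_subtype_coe hS)
      fun P hPS hP0 => ?_
    have hrj : P.1.1.rep C.j = φ (d C.j) * P.1.1.rep i := by
      conv_lhs => rw [h.rep_eq P.1]
      simp [lineVec, hc']
    have hri : P.1.1.rep C.i = φ (c C.i) * P.1.1.rep j := by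
      conv_lhs => rw [h.rep_eq P.1]
      simp [lineVec, hd]
    have hPi : P.1.1.rep i ≠ 0 := by
      intro h2
      apply C.rep_ne P.1 P.2
      rw [hrj, h2, mul_zero]
    have hPj : P.1.1.rep j ≠ 0 := by
      intro h2
      apply hP0
      rw [affineCoord, hri, h2, mul_zero, zero_div]
    have h2 : φ (c C.i) ≠ 0 := by simpa using hc
    have h3 : φ (d C.j) ≠ 0 := by simpa using hd'
    have hcoord : κ * (affineCoord φ C.i C.j P.1)⁻¹ = affineCoord φ i j P.1 := by
      rw [affineCoord, affineCoord, hri, hrj, hκdef, map_div₀]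
      field_simp
    have hnorm : ‖affineCoord φ C.i C.j P.1‖⁻¹ = ‖κ‖⁻¹ * (‖P.1.1.rep i‖ / ‖P.1.1.rep j‖) := by
      rw [← norm_inv, ← norm_inv, ← norm_div, ← norm_mul]
      congr 1
      change _ = _ * affineCoord φ i j P.1
      rw [← hcoord, inv_mul_cancel_left₀ hκ]
    have hκ' : ‖φ (-(d C.j / c C.i))‖ = ‖κ‖⁻¹ := by
      rw [map_neg, norm_neg, ← norm_inv, hκdef, ← map_inv₀, inv_div]
    rw [hcoord, hGval P.1 hPS hPj, hV.density_eq h C hs, map_mul, map_pow,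
      norm_rpow_mul g.one_le, IsModulus.invNorm, ← inv_pow, hnorm, hκ',
      ← ENNReal.ofReal_pow (by positivity), ← ENNReal.ofReal_mul (by positivity),
      ← ENNReal.ofReal_mul (by positivity)]
    apply le_of_eq
    congr 1
    have h4 := norm_ne_zero_iff.2 hPj
    have h5 := norm_ne_zero_iff.2 hκ
    exact inversion_identity _ h5 h4 _ _ e

/-- The Tamagawa measure on a line. -/
theorem measure_eq {g : V.AdjointSection} {f : V.FunField} {a : K}
    (hdiff : g.diff = f • KaehlerDifferential.D (AlgebraicClosure K) V.FunField (V.ratio i j))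
    (hsec : g.sec * (f : V.Frac) ^ g.N = algebraMap K V.Frac a * V.coord j ^ (2 * g.N))
    {e : ℕ} {vol : ENNReal} (h0 : vol ≠ 0) (h1 : vol ≠ ⊤) (hm : IsModulus e (haarBall E vol)) :
    g.measure φ e vol = Measure.map h.affPt ((haarBall E vol).withDensity
      (hV.lineDensity φ (‖φ a‖ ^ ((e : ℝ) / g.N)) e)) := by
  refine le_antisymm (iSup_le fun C => hV.chart_measure_le h hdiff hsec h0 h1 hm C) ?_
  -- The standard chart, the complement of infinity with coordinate xᵢ / xⱼ, attains the bound.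
  let C : Chart g φ :=
    { i := i
      j := j
      f := f
      diff_eq := hdiff
      dom := {P | P.1.rep j ≠ 0}
      isOpen_dom := isOpen_rep_ne φ j
      rep_ne := fun P hP => hP
      isOpenEmbedding := hV.isOpenEmbedding_affineCoord h }
  refine le_iSup_of_le C (le_of_eq ?_)
  have hψ := measurable_affPt h
  ext S hS
  rw [Measure.map_apply hψ hS, withDensity_apply _ (hψ hS), ← lintegral_indicator (hψ hS)]
  rw [Chart.measure, Measure.map_apply measurable_subtype_coe hS,
    withDensity_apply _ (measurable_subtype_coe hS)]
  have hemb : MeasurableEmbedding fun P : C.dom => affineCoord φ C.i C.j P.1 :=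
    C.isOpenEmbedding.measurableEmbedding
  symm
  refine setLIntegral_comap_eq hemb (fun t => ⟨⟨h.affPt t, hV.rep_affPt_ne h t⟩,
    hV.affineCoord_affPt h t⟩) (measurable_subtype_coe hS) fun P => ?_
  have hP : P.1.1.rep j ≠ 0 := P.2
  have hback : h.affPt (affineCoord φ C.i C.j P.1) = P.1 := h.affPt_affineCoord hP
  by_cases hPS : P.1 ∈ S
  · rw [Set.indicator_of_mem (s := (fun P : C.dom => P.1) ⁻¹' S) hPS, Set.indicator_of_mem,
      hV.density_eq h C hsec, hV.norm_rep_div h hP, lineDensity, inv_pow]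
    rwa [Set.mem_preimage, hback]
  · rw [Set.indicator_of_notMem (s := (fun P : C.dom => P.1) ⁻¹' S) hPS, Set.indicator_of_notMem]
    rwa [Set.mem_preimage, hback]

/-- The total mass of the Tamagawa measure on a line. -/
theorem measure_univ {g : V.AdjointSection} {f : V.FunField} {a : K}
    (hdiff : g.diff = f • KaehlerDifferential.D (AlgebraicClosure K) V.FunField (V.ratio i j))
    (hsec : g.sec * (f : V.Frac) ^ g.N = algebraMap K V.Frac a * V.coord j ^ (2 * g.N))
    {e : ℕ} {vol : ENNReal} (h0 : vol ≠ 0) (h1 : vol ≠ ⊤) (hm : IsModulus e (haarBall E vol)) :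
    g.measure φ e vol Set.univ = ENNReal.ofReal (‖φ a‖ ^ ((e : ℝ) / g.N) *
      ((‖fun r => φ (c r)‖ * ‖fun r => φ (d r)‖) ^ e)⁻¹) *
        (vol + haarBall E vol (Metric.ball 0 1)) := by
  have hHaar := isAddHaarMeasure_haarBall E h0 h1
  -- The rescaling needs elements of E with norms ‖c‖ and ‖d‖; a largest coordinate serves, and it
  -- is non-zero because some coordinate is 1.
  have hnorm : ∀ (x : Fin (n + 1) → K) (r : Fin (n + 1)), x r = 1 →
      ∃ y : E, y ≠ 0 ∧ ‖y‖ = ‖fun r => φ (x r)‖ := by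
    intro x r hr
    obtain ⟨m, hm⟩ := Finite.exists_max fun r => ‖φ (x r)‖
    refine ⟨φ (x m), fun h2 => ?_, le_antisymm (norm_le_pi_norm (fun r => φ (x r)) m)
      ((pi_norm_le_iff_of_nonneg (norm_nonneg _)).2 hm)⟩
    have := hm r
    rw [hr, h2, map_one, norm_one, norm_zero] at this
    exact absurd this one_pos.not_ge
  obtain ⟨x, hx, hxn⟩ := hnorm c j hV.c_j
  obtain ⟨y, hy, hyn⟩ := hnorm d i hV.d_i
  rw [hV.measure_eq h hdiff hsec h0 h1 hm, Measure.map_apply (measurable_affPt h) MeasurableSet.univ,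
    Set.preimage_univ, withDensity_apply _ MeasurableSet.univ, Measure.restrict_univ]
  have h2 := hm.lintegral_inv_max hx hy
  rw [haarBall_closedBall] at h2
  rw [ENNReal.ofReal_mul (by positivity), mul_assoc, ← hxn, ← hyn, ← h2, ← lintegral_const_mul]
  · refine lintegral_congr fun t => ?_
    rw [lineDensity, ENNReal.ofReal_mul (by positivity), hxn, hyn]
  · fun_prop

end IsLine

end Tamagawa

end QuasiProj

theorem norm_sub_le_max {E : Type*} [NormedField E] [IsUltrametricDist E] (x y : E) :
    ‖x - y‖ ≤ max ‖x‖ ‖y‖ := by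
  rw [sub_eq_add_neg, ← norm_neg y]
  exact IsUltrametricDist.norm_add_le_max _ _

/-! ## Non-archimedean local fields -/

/-- `π` is a uniformizer of the discretely valued field `E`, and `T` is a set of representatives of
its residue field. -/
structure IsLocal {E : Type*} [NormedField E] (π : E) (T : Finset E) : Prop where
  ne_zero : π ≠ 0
  norm_lt_one : ‖π‖ < 1
  norm_eq : ∀ x : E, x ≠ 0 → ∃ m : ℤ, ‖x‖ = ‖π‖ ^ m
  norm_le_one : ∀ τ ∈ T, ‖τ‖ ≤ 1
  exists_lt_one : ∀ x : E, ‖x‖ ≤ 1 → ∃ τ ∈ T, ‖x - τ‖ < 1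
  one_le_norm_sub : ∀ τ ∈ T, ∀ τ' ∈ T, τ ≠ τ' → 1 ≤ ‖τ - τ'‖

namespace IsLocal

variable {E : Type*} [NormedField E] {π : E} {T : Finset E} (h : IsLocal π T)

include h

theorem norm_pos : 0 < ‖π‖ := norm_pos_iff.2 h.ne_zero

theorem lt_zpow_iff (x : E) (m : ℤ) : ‖x‖ < ‖π‖ ^ m ↔ ‖x‖ ≤ ‖π‖ ^ (m + 1) := by
  have hlt := zpow_right_strictAnti₀ h.norm_pos h.norm_lt_one
  constructor
  · intro hx
    by_cases h0 : x = 0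
    · rw [h0, norm_zero]
      exact (zpow_pos h.norm_pos _).le
    · obtain ⟨l, hl⟩ := h.norm_eq x h0
      rw [hl] at hx ⊢
      have h1 : m < l := hlt.lt_iff_gt.1 hx
      exact hlt.antitone (by omega)
  · exact fun hx => hx.trans_lt (hlt (by omega))

variable [IsUltrametricDist E]

/-- Division by π^m reduces to the unit ball, which is the union of its residue classes; the values
being discrete, distance < 1 means distance ≤ ‖π‖. -/
theorem closedBall_eq (m : ℤ) : Metric.closedBall (0 : E) (‖π‖ ^ m) =
    ⋃ τ ∈ T, Metric.closedBall (π ^ m * τ) (‖π‖ ^ (m + 1)) := by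
  have hm := zpow_ne_zero m h.ne_zero
  have hpos := zpow_pos h.norm_pos m
  ext x
  simp only [Set.mem_iUnion, exists_prop, mem_closedBall_iff_norm, sub_zero]
  constructor
  · intro hx
    obtain ⟨τ, hτ, hxτ⟩ := h.exists_lt_one (x / π ^ m) (by
      rw [norm_div, norm_zpow]
      exact div_le_one_of_le₀ hx hpos.le)
    refine ⟨τ, hτ, (h.lt_zpow_iff _ _).1 ?_⟩
    have : x - π ^ m * τ = π ^ m * (x / π ^ m - τ) := by field_simp
    rw [this, norm_mul, norm_zpow]
    exact mul_lt_of_lt_one_right hpos hxτ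
  · rintro ⟨τ, hτ, hx⟩
    have h1 : ‖π ^ m * τ‖ ≤ ‖π‖ ^ m := by
      rw [norm_mul, norm_zpow]
      exact mul_le_of_le_one_right hpos.le (h.norm_le_one τ hτ)
    have h2 := ((h.lt_zpow_iff _ _).2 hx).le
    calc ‖x‖ = ‖(x - π ^ m * τ) + π ^ m * τ‖ := by rw [sub_add_cancel]
      _ ≤ max _ _ := IsUltrametricDist.norm_add_le_max _ _
      _ ≤ _ := max_le h2 h1

theorem pairwiseDisjoint (m : ℤ) : (T : Set E).PairwiseDisjoint
    fun τ => Metric.closedBall (π ^ m * τ) (‖π‖ ^ (m + 1)) := by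
  intro τ hτ τ' hτ' hne
  rw [Function.onFun, Set.disjoint_left]
  intro x hx hx'
  rw [mem_closedBall_iff_norm, ← h.lt_zpow_iff] at hx hx'
  have h1 : ‖π ^ m * (τ - τ')‖ < ‖π‖ ^ m := by
    calc ‖π ^ m * (τ - τ')‖ = ‖(x - π ^ m * τ') - (x - π ^ m * τ)‖ := by congr 1; ring
      _ ≤ max _ _ := norm_sub_le_max _ _
      _ < _ := max_lt hx' hx
  rw [norm_mul, norm_zpow] at h1
  have h2 := h.one_le_norm_sub τ hτ τ' hτ' hne
  have h3 := le_mul_of_one_le_right (zpow_pos h.norm_pos m).le h2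
  exact absurd h1 h3.not_gt

theorem exists_finset_cover (m : ℕ) : ∃ S : Finset E,
    Metric.closedBall (0 : E) 1 ⊆ ⋃ y ∈ S, Metric.closedBall y (‖π‖ ^ m) := by
  classical
  induction m with
  | zero => exact ⟨{0}, by simp⟩
  | succ m ih =>
    obtain ⟨S, hS⟩ := ih
    refine ⟨(S ×ˢ T).image fun p => p.1 + π ^ m * p.2, fun x hx => ?_⟩
    obtain ⟨y, hy, hxy⟩ := Set.mem_iUnion₂.1 (hS hx)
    have h1 : x - y ∈ Metric.closedBall (0 : E) (‖π‖ ^ (m : ℤ)) := by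
      rwa [mem_closedBall_zero_iff, zpow_natCast, ← mem_closedBall_iff_norm]
    rw [h.closedBall_eq] at h1
    obtain ⟨τ, hτ, hxτ⟩ := Set.mem_iUnion₂.1 h1
    refine Set.mem_iUnion₂.2 ⟨y + π ^ m * τ, Finset.mem_image.2 ⟨(y, τ),
      Finset.mem_product.2 ⟨hy, hτ⟩, rfl⟩, ?_⟩
    rw [mem_closedBall_iff_norm] at hxτ ⊢
    rw [← sub_sub]
    exact_mod_cast hxτ

/-- Refining balls into residue classes makes the unit ball totally bounded, hence compact by
completeness; its multiples by powers of 1/π exhaust E. -/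
theorem properSpace [CompleteSpace E] : ProperSpace E := by
  have hc : IsCompact (Metric.closedBall (0 : E) 1) := by
    rw [isCompact_iff_totallyBounded_isComplete]
    refine ⟨Metric.totallyBounded_iff.2 fun ε hε => ?_, Metric.isClosed_closedBall.isComplete⟩
    obtain ⟨m, hm⟩ := exists_pow_lt_of_lt_one hε h.norm_lt_one
    obtain ⟨S, hS⟩ := h.exists_finset_cover m
    refine ⟨S, S.finite_toSet, hS.trans ?_⟩
    exact Set.iUnion₂_mono fun y _ => Metric.closedBall_subset_ball hm
  have hinv : 1 < ‖π‖⁻¹ := (one_lt_inv₀ h.norm_pos).2 h.norm_lt_one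
  refine ProperSpace.of_seq_closedBall (x := (0 : E)) (l := atTop) (r := fun m : ℕ => ‖π‖⁻¹ ^ m)
    (tendsto_pow_atTop_atTop_of_one_lt hinv) (Eventually.of_forall fun m => ?_)
  have : Metric.closedBall (0 : E) (‖π‖⁻¹ ^ m) =
      (fun x => (π⁻¹) ^ m * x) '' Metric.closedBall 0 1 := by
    ext x
    have hne := pow_ne_zero m (inv_ne_zero h.ne_zero)
    constructor
    · intro hx
      refine ⟨x / (π⁻¹) ^ m, ?_, mul_div_cancel₀ x hne⟩
      rw [mem_closedBall_zero_iff] at hx ⊢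
      rw [norm_div, norm_pow, norm_inv]
      exact div_le_one_of_le₀ hx (by positivity)
    · rintro ⟨y, hy, rfl⟩
      rw [mem_closedBall_zero_iff] at hy ⊢
      rw [norm_mul, norm_pow, norm_inv]
      exact mul_le_of_le_one_right (by positivity) hy
  rw [this]
  exact hc.image (continuous_const_mul _)

omit [IsUltrametricDist E] in
theorem ball_eq : Metric.ball (0 : E) 1 = Metric.closedBall 0 (‖π‖ ^ (1 : ℤ)) := by
  ext x
  rw [mem_ball_zero_iff, mem_closedBall_zero_iff]
  simpa using h.lt_zpow_iff x 0

section Measure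

variable [MeasurableSpace E] [BorelSpace E] {Λ : Measure E} [Λ.IsAddHaarMeasure]

theorem measure_step (m : ℤ) : Λ (Metric.closedBall 0 (‖π‖ ^ m)) =
    T.card * Λ (Metric.closedBall 0 (‖π‖ ^ (m + 1))) := by
  have htrans : ∀ (y : E) (r : ℝ), Λ (Metric.closedBall y r) = Λ (Metric.closedBall 0 r) := by
    intro y r
    rw [← measure_preimage_add Λ (-y) (Metric.closedBall 0 r)]
    congr 1
    ext x
    rw [Set.mem_preimage, mem_closedBall_iff_norm, mem_closedBall_zero_iff, neg_add_eq_sub]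
  rw [h.closedBall_eq, measure_biUnion_finset (h.pairwiseDisjoint m)
    fun τ _ => measurableSet_closedBall]
  simp only [htrans, Finset.sum_const, nsmul_eq_mul]

variable (hT : ‖π‖ = (T.card : ℝ)⁻¹)

include hT

theorem measure_succ (m : ℤ) : Λ (Metric.closedBall 0 (‖π‖ ^ (m + 1))) =
    ENNReal.ofReal ‖π‖ * Λ (Metric.closedBall 0 (‖π‖ ^ m)) := by
  have hpos := h.norm_pos
  have hq : (T.card : ℝ) ≠ 0 := by
    intro h0
    rw [hT, h0, inv_zero] at hpos
    exact lt_irrefl _ hpos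
  rw [h.measure_step m, ← mul_assoc, ← ENNReal.ofReal_natCast, ← ENNReal.ofReal_mul hpos.le, hT,
    inv_mul_cancel₀ hq, ENNReal.ofReal_one, one_mul]

theorem measure_zpow (m : ℤ) : Λ (Metric.closedBall 0 (‖π‖ ^ m)) =
    ENNReal.ofReal (‖π‖ ^ m) * Λ (Metric.closedBall 0 1) := by
  have hpos := h.norm_pos
  induction m using Int.induction_on with
  | zero => simp
  | succ m ih =>
    rw [h.measure_succ hT, ih, ← mul_assoc, ← ENNReal.ofReal_mul hpos.le,
      zpow_add_one₀ hpos.ne', mul_comm ‖π‖]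
  | pred m ih =>
    have h1 := h.measure_succ hT (Λ := Λ) (-m - 1)
    rw [sub_add_cancel, ih] at h1
    have h2 : (‖π‖ : ℝ) ^ (-m : ℤ) = ‖π‖ * ‖π‖ ^ (-m - 1 : ℤ) := by
      rw [zpow_sub_one₀ hpos.ne']
      field_simp
    rw [h2, ENNReal.ofReal_mul hpos.le, mul_assoc] at h1
    refine ((ENNReal.mul_right_inj ?_ ENNReal.ofReal_ne_top).1 h1).symm
    simpa using h.ne_zero

theorem isModulus : IsModulus 1 Λ where
  one_le := le_rfl
  exists_lt_one := ⟨π, h.ne_zero, h.norm_lt_one⟩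
  closedBall x hx := by
    obtain ⟨m, hm⟩ := h.norm_eq x hx
    rw [hm, pow_one]
    exact h.measure_zpow hT m

theorem measure_ball : Λ (Metric.ball 0 1) = ENNReal.ofReal ‖π‖ * Λ (Metric.closedBall 0 1) := by
  rw [h.ball_eq, h.measure_zpow hT, zpow_one]

end Measure

end IsLocal

/-! ## Completions at the finite places -/

section FinitePlace

open NumberField IsDedekindDomain

variable {K : Type*} [Field K] [NumberField K] (v : HeightOneSpectrum (𝓞 K))

instance : IsUltrametricDist (v.adicCompletion K) :=
  inferInstanceAs (@IsUltrametricDist _ (Valued.toNormedField (v.adicCompletion K)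
    (WithZero (Multiplicative ℤ))).toDist)

instance : CompleteSpace (v.adicCompletion K) := inferInstance

theorem denseRange_embedding : DenseRange (FinitePlace.embedding (K := K) v) :=
  HeightOneSpectrum.denseRange_algebraMap K v

theorem exists_isLocal : ∃ (π : v.adicCompletion K) (T : Finset (v.adicCompletion K)),
    IsLocal π T ∧ ‖π‖ = (Ideal.absNorm v.asIdeal : ℝ)⁻¹ ∧ T.card = Ideal.absNorm v.asIdeal := by
  classical
  set ι := FinitePlace.embedding (K := K) v with hι
  have hq := HeightOneSpectrum.one_lt_absNorm v
  have hq' : (1 : ℝ) < Ideal.absNorm v.asIdeal := by exact_mod_cast hq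
  have hq0 : (Ideal.absNorm v.asIdeal : ℝ) ≠ 0 := by positivity
  obtain ⟨p, hp⟩ := v.valuation_exists_uniformizer K
  have hfin : Finite (𝓞 K ⧸ v.asIdeal) := v.asIdeal.finiteQuotientOfFreeOfNeBot v.ne_bot
  let _ := Fintype.ofFinite (𝓞 K ⧸ v.asIdeal)
  let rep : 𝓞 K ⧸ v.asIdeal → v.adicCompletion K := fun x => ι (algebraMap (𝓞 K) K x.out)
  have hrep : ∀ x y, x ≠ y → ‖rep x - rep y‖ = 1 := by
    intro x y hxy
    have h1 : rep x - rep y = ι (algebraMap (𝓞 K) K (x.out - y.out)) := by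
      simp only [rep, map_sub]
    rw [h1, FinitePlace.norm_eq_one_iff_notMem]
    intro h2
    apply hxy
    have h3 := (Ideal.Quotient.eq (I := v.asIdeal)).2 h2
    rwa [← x.out_eq', ← y.out_eq']
  have hinj : Function.Injective rep := by
    intro x y hxy
    by_contra hne
    have := hrep x y hne
    rw [hxy, sub_self, norm_zero] at this
    exact zero_ne_one this
  have hnormp : ‖ι p‖ = (Ideal.absNorm v.asIdeal : ℝ)⁻¹ := by
    rw [FinitePlace.norm_embedding', hp, WithZeroMulInt.toNNReal_neg_apply _ (by simp)]
    have : (WithZero.unzero (WithZero.exp_ne_zero (a := (-1 : ℤ)))).toAdd = -1 := rfl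
    rw [this]
    simp
  refine ⟨ι p, Finset.univ.image rep, ⟨?_, ?_, ?_, ?_, ?_, ?_⟩, hnormp, ?_⟩
  · rw [← norm_ne_zero_iff, hnormp]
    exact inv_ne_zero hq0
  · rw [hnormp]
    exact inv_lt_one_of_one_lt₀ hq'
  · intro x hx
    have hx' : Valued.v x ≠ 0 := (Valuation.ne_zero_iff _).2 hx
    rw [FinitePlace.norm_def, WithZeroMulInt.toNNReal_neg_apply _ hx', hnormp]
    refine ⟨-(WithZero.unzero hx').toAdd, ?_⟩
    simp
  · intro τ hτ
    obtain ⟨x, -, rfl⟩ := Finset.mem_image.1 hτ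
    exact FinitePlace.norm_le_one K v _
  -- Three approximations: x by an element k of K, k by an algebraic integer a modulo v, and a by
  -- the representative of its residue class. The ultrametric inequality combines them.
  · intro x hx
    obtain ⟨k, hk⟩ := Metric.denseRange_iff.1 (denseRange_embedding v) x 1 one_pos
    rw [dist_eq_norm] at hk
    have hk1 : ‖ι k‖ ≤ 1 := by
      calc ‖ι k‖ = ‖x - (x - ι k)‖ := by rw [sub_sub_cancel]
        _ ≤ max _ _ := norm_sub_le_max _ _
        _ ≤ 1 := max_le hx hk.le
    have hval : ∀ y : K, ‖ι y‖ ≤ 1 ↔ v.valuation K y ≤ 1 := by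
      intro y
      rw [FinitePlace.norm_embedding']
      have := (WithZeroMulInt.toNNReal_strictMono
        (HeightOneSpectrum.one_lt_absNorm_nnreal v)).le_iff_le (a := v.valuation K y) (b := 1)
      rw [map_one] at this
      rw [← this]
      norm_cast
    have hval' : ∀ y : K, ‖ι y‖ < 1 ↔ v.valuation K y < 1 := by
      intro y
      rw [FinitePlace.norm_embedding']
      have := (WithZeroMulInt.toNNReal_strictMono
        (HeightOneSpectrum.one_lt_absNorm_nnreal v)).lt_iff_lt (a := v.valuation K y) (b := 1)
      rw [map_one] at this
      rw [← this]
      norm_cast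
    obtain ⟨a, ha⟩ := v.exists_valuation_sub_lt_of_integer ((hval k).1 hk1) 1
    rw [Units.val_one, ← hval'] at ha
    refine ⟨_, Finset.mem_image_of_mem rep (Finset.mem_univ (Ideal.Quotient.mk v.asIdeal a)), ?_⟩
    have h1 : ‖ι (algebraMap (𝓞 K) K a) - rep (Ideal.Quotient.mk v.asIdeal a)‖ < 1 := by
      have : ι (algebraMap (𝓞 K) K a) - rep (Ideal.Quotient.mk v.asIdeal a) =
          ι (algebraMap (𝓞 K) K (a - (Ideal.Quotient.mk v.asIdeal a).out)) := by
        simp only [rep, map_sub]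
      rw [this, FinitePlace.norm_lt_one_iff_mem, ← Ideal.Quotient.eq]
      exact (Quotient.out_eq' _).symm
    have h2 : ‖x - ι (algebraMap (𝓞 K) K a)‖ < 1 := by
      calc _ = ‖(x - ι k) - ι (algebraMap (𝓞 K) K a - k)‖ := by rw [map_sub]; congr 1; ring
        _ ≤ max _ _ := norm_sub_le_max _ _
        _ < 1 := max_lt hk ha
    calc _ = ‖(x - ι (algebraMap (𝓞 K) K a)) +
          (ι (algebraMap (𝓞 K) K a) - rep (Ideal.Quotient.mk v.asIdeal a))‖ := by
          rw [sub_add_sub_cancel]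
      _ ≤ max _ _ := IsUltrametricDist.norm_add_le_max _ _
      _ < 1 := max_lt h2 h1
  · intro τ hτ τ' hτ' hne
    obtain ⟨x, -, rfl⟩ := Finset.mem_image.1 hτ
    obtain ⟨y, -, rfl⟩ := Finset.mem_image.1 hτ'
    exact (hrep x y fun h => hne (by rw [h])).ge
  · rw [Finset.card_image_of_injective _ hinj, Finset.card_univ, Ideal.absNorm_apply,
      Submodule.cardQuot_apply, Nat.card_eq_fintype_card]

instance : ProperSpace (v.adicCompletion K) := by
  obtain ⟨π, T, h, -⟩ := exists_isLocal v
  exact h.properSpace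

theorem isModulus_finite : IsModulus 1 (QuasiProj.haarBall (v.adicCompletion K) 1) := by
  obtain ⟨π, T, h, hπ, hT⟩ := exists_isLocal v
  have := QuasiProj.isAddHaarMeasure_haarBall (v.adicCompletion K) one_ne_zero ENNReal.one_ne_top
  exact h.isModulus (by rw [hπ, hT])

theorem haarBall_ball_finite : QuasiProj.haarBall (v.adicCompletion K) 1 (Metric.ball 0 1) =
    ENNReal.ofReal (Ideal.absNorm v.asIdeal : ℝ)⁻¹ := by
  obtain ⟨π, T, h, hπ, hT⟩ := exists_isLocal v
  have := QuasiProj.isAddHaarMeasure_haarBall (v.adicCompletion K) one_ne_zero ENNReal.one_ne_top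
  rw [h.measure_ball (by rw [hπ, hT]), hπ, QuasiProj.haarBall_closedBall, mul_one]

end FinitePlace

/-! ## Completions at the infinite places -/

/-- Balls are transported to a real vector space, where Haar measure scales by the dimension-th
power of the radius. For ℝ and ℂ the dimension is the multiplicity of the place. -/
theorem isModulus_of_isometry {E F : Type*} [NormedField E] [MeasurableSpace E] [BorelSpace E]
    [NormedField F] [NormedSpace ℝ F] [FiniteDimensional ℝ F] (ψ : E ≃+* F) (hψ : Isometry ψ)
    (Λ : Measure E) [Λ.IsAddHaarMeasure] : IsModulus (Module.finrank ℝ F) Λ := by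
  let _ : MeasurableSpace F := borel F
  have : BorelSpace F := ⟨rfl⟩
  have hc : Continuous ψ.toAddEquiv := hψ.continuous
  have hcs : Continuous ψ.toAddEquiv.symm := (IsometryEquiv.mk ψ.toEquiv hψ).symm.continuous
  have : (Λ.map ψ.toAddEquiv).IsAddHaarMeasure := ψ.toAddEquiv.isAddHaarMeasure_map Λ hc hcs
  have hnorm : ∀ x, ‖ψ x‖ = ‖x‖ := fun x => by
    rw [← dist_zero_right, ← map_zero ψ, hψ.dist_eq, dist_zero_right]
  have hball : ∀ r, Λ (Metric.closedBall 0 r) = Λ.map ψ.toAddEquiv (Metric.closedBall 0 r) := by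
    intro r
    rw [Measure.map_apply hc.measurable measurableSet_closedBall]
    congr 1
    ext x
    rw [Set.mem_preimage, mem_closedBall_zero_iff, mem_closedBall_zero_iff]
    exact (hnorm x).symm ▸ Iff.rfl
  have hsmul : ‖((2 : ℝ)⁻¹ • (1 : F))‖ = 2⁻¹ := by
    rw [norm_smul, norm_one, mul_one]
    norm_num
  refine ⟨Module.finrank_pos, ⟨ψ.symm ((2 : ℝ)⁻¹ • 1), ?_, ?_⟩, fun x _ => ?_⟩
  · rw [← norm_ne_zero_iff, ← hnorm, ψ.apply_symm_apply, hsmul]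
    norm_num
  · rw [← hnorm, ψ.apply_symm_apply, hsmul]
    norm_num
  · rw [hball, hball, Measure.addHaar_closedBall' _ _ (norm_nonneg x)]

section InfinitePlace

open NumberField

variable {K : Type*} [Field K] (v : InfinitePlace K)

instance : ProperSpace v.Completion := by
  have hp : ∀ {F : Type} [NormedField F] [ProperSpace F], (v.Completion ≃ᵢ F) →
      ProperSpace v.Completion := by
    intro F _ _ ψ
    refine ⟨fun x r => ?_⟩
    have h := ψ.preimage_closedBall (ψ x) r
    rw [ψ.symm_apply_apply] at h
    rw [← h]
    exact ψ.toHomeomorph.isClosedEmbedding.isCompact_preimage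
      (ProperSpace.isCompact_closedBall _ _)
  rcases v.isReal_or_isComplex with hv | hv
  · exact hp (InfinitePlace.Completion.isometryEquivRealOfIsReal hv)
  · exact hp (InfinitePlace.Completion.isometryEquivComplexOfIsComplex hv)

theorem isModulus_infinite {vol : ENNReal} (h0 : vol ≠ 0) (h1 : vol ≠ ⊤) :
    IsModulus v.mult (QuasiProj.haarBall v.Completion vol) := by
  have := QuasiProj.isAddHaarMeasure_haarBall v.Completion h0 h1
  rcases v.isReal_or_isComplex with hv | hv
  · have h := isModulus_of_isometry (InfinitePlace.Completion.ringEquivRealOfIsReal hv)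
      (InfinitePlace.Completion.isometry_extensionEmbeddingOfIsReal hv)
      (QuasiProj.haarBall v.Completion vol)
    rwa [Module.finrank_self, ← InfinitePlace.mult_isReal ⟨v, hv⟩] at h
  · have h := isModulus_of_isometry (InfinitePlace.Completion.ringEquivComplexOfIsComplex hv)
      (InfinitePlace.Completion.isometry_extensionEmbedding v)
      (QuasiProj.haarBall v.Completion vol)
    rwa [Complex.finrank_real_complex, ← InfinitePlace.mult_isComplex ⟨v, hv⟩] at h

theorem denseRange_algebraMap_infinite : DenseRange (algebraMap K v.Completion) :=
  (InfinitePlace.Completion.denseRange_coe v).comp (WithAbs.equiv v.1).symm.surjective.denseRange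
    (InfinitePlace.Completion.continuous_coe v)

theorem norm_algebraMap_infinite (x : K) : ‖algebraMap K v.Completion x‖ = v x :=
  InfinitePlace.Completion.norm_coe v _

end InfinitePlace

/-! ## The Euler product of the Dedekind zeta function -/

section EulerProduct

open IsDedekindDomain

variable {R : Type*} [CommRing R] [IsDedekindDomain R] (F : Ideal R →*₀ ℝ)

open Classical in
/-- The sum of a function over the ideals that are not divisible by any prime in `S`. -/
def siftedSum (S : Finset (HeightOneSpectrum R)) : ℝ :=
  ∑' I : Ideal R, if ∀ p ∈ S, ¬p.asIdeal ∣ I then F I else 0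

variable {F}

/-- One step of the sieve: the ideals to be removed are the products pJ, and pJ avoids the primes of
S exactly when J does, since p is not in S. Their sum is F(p) times the old sum. -/
theorem siftedSum_insert [DecidableEq (HeightOneSpectrum R)] (hF : Summable F)
    {S : Finset (HeightOneSpectrum R)} {p : HeightOneSpectrum R} (hp : p ∉ S) :
    siftedSum F (insert p S) = (1 - F p.asIdeal) * siftedSum F S := by
  classical
  have hind : ∀ (P : Ideal R → Prop) [DecidablePred P],
      Summable fun I => if P I then F I else 0 := fun P _ => by
    refine (hF.indicator {I | P I}).congr fun I => ?_
    by_cases h : P I <;> simp [h]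
  have hp0 : p.asIdeal ≠ 0 := p.ne_bot
  have h1 : ∀ I : Ideal R, (if ∀ q ∈ insert p S, ¬q.asIdeal ∣ I then F I else 0) =
      (if ∀ q ∈ S, ¬q.asIdeal ∣ I then F I else 0) -
        if p.asIdeal ∣ I ∧ ∀ q ∈ S, ¬q.asIdeal ∣ I then F I else 0 := by
    intro I
    simp only [Finset.forall_mem_insert]
    by_cases h : p.asIdeal ∣ I <;> simp [h]
  have h2 : ∑' I : Ideal R, (if p.asIdeal ∣ I ∧ ∀ q ∈ S, ¬q.asIdeal ∣ I then F I else 0) =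
      F p.asIdeal * siftedSum F S := by
    rw [siftedSum, ← tsum_mul_left, ← (mul_right_injective₀ hp0).tsum_eq]
    · refine tsum_congr fun J => ?_
      have h3 : (p.asIdeal ∣ p.asIdeal * J ∧ ∀ q ∈ S, ¬q.asIdeal ∣ p.asIdeal * J) ↔
          ∀ q ∈ S, ¬q.asIdeal ∣ J := by
        refine ⟨fun h q hq hJ => h.2 q hq (hJ.mul_left _), fun h => ⟨dvd_mul_right _ _,
          fun q hq hJ => ?_⟩⟩
        rcases (Ideal.prime_of_isPrime q.ne_bot q.isPrime).dvd_or_dvd hJ with h4 | h4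
        · rw [(Ideal.prime_of_isPrime q.ne_bot q.isPrime).dvd_prime_iff_associated
            (Ideal.prime_of_isPrime p.ne_bot p.isPrime), associated_iff_eq] at h4
          exact hp (HeightOneSpectrum.ext h4 ▸ hq)
        · exact h q hq h4
      simp only [h3, map_mul]
      split_ifs <;> simp
    · intro I hI
      rw [Function.mem_support] at hI
      obtain ⟨⟨J, rfl⟩, -⟩ := (ite_ne_right_iff.1 hI).1
      exact ⟨J, rfl⟩
  rw [siftedSum, tsum_congr h1, (hind fun I => ∀ q ∈ S, ¬q.asIdeal ∣ I).tsum_sub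
    (hind fun I => p.asIdeal ∣ I ∧ ∀ q ∈ S, ¬q.asIdeal ∣ I), h2, siftedSum]
  ring

theorem siftedSum_eq (hF : Summable F) (S : Finset (HeightOneSpectrum R)) :
    siftedSum F S = (∏ p ∈ S, (1 - F p.asIdeal)) * ∑' I, F I := by
  classical
  induction S using Finset.induction_on with
  | empty => simp [siftedSum]
  | insert p S hp ih => rw [siftedSum_insert hF hp, ih, Finset.prod_insert hp, mul_assoc]

/-- A non-zero ideal other than 1 has a prime divisor and is eventually sieved out, while F vanishes
at the zero ideal; only F(1) = 1 survives, by dominated convergence. -/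
theorem tendsto_siftedSum (hF : Summable F) (h0 : ∀ I, 0 ≤ F I) :
    Tendsto (siftedSum F) atTop (𝓝 1) := by
  classical
  have h1 : ∑' I : Ideal R, (if I = 1 then (1 : ℝ) else 0) = 1 := tsum_ite_eq 1 (fun _ => 1)
  rw [← h1]
  refine tendsto_tsum_of_dominated_convergence hF (fun I => ?_)
    (Eventually.of_forall fun S I => ?_)
  · by_cases hI : I = 1
    · refine tendsto_const_nhds.congr fun S => ?_
      rw [if_pos hI, if_pos, hI, map_one]
      intro p _ hp
      rw [hI, Ideal.one_eq_top, Ideal.dvd_iff_le, top_le_iff] at hp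
      exact p.isPrime.ne_top hp
    · rw [if_neg hI]
      by_cases hI0 : I = 0
      · have h2 : F I = 0 := by rw [hI0, map_zero]
        simp [h2]
      · obtain ⟨P, hP, hPI⟩ := Ideal.exists_le_maximal I (Ideal.one_eq_top (R := R) ▸ hI)
        have hP0 : P ≠ ⊥ := fun h => hI0 (le_bot_iff.1 (h ▸ hPI))
        refine tendsto_const_nhds.congr' ?_
        filter_upwards [eventually_ge_atTop {(⟨P, hP.isPrime, hP0⟩ : HeightOneSpectrum R)}]
          with S hS
        rw [if_neg]
        intro h
        exact h _ (hS (Finset.mem_singleton_self _)) (Ideal.dvd_iff_le.2 hPI)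
  · split_ifs
    · rw [Real.norm_of_nonneg (h0 I)]
    · rw [norm_zero]
      exact h0 I

omit [IsDedekindDomain R] in
theorem one_le_tsum_ideal (hF : Summable F) (h0 : ∀ I, 0 ≤ F I) : 1 ≤ ∑' I, F I := by
  have h := hF.le_tsum 1 fun I _ => h0 I
  rwa [map_one] at h

theorem hasProd_one_sub (hF : Summable F) (h0 : ∀ I, 0 ≤ F I) :
    HasProd (fun p : HeightOneSpectrum R => 1 - F p.asIdeal) (∑' I, F I)⁻¹ := by
  have hZ : ∑' I, F I ≠ 0 := (one_pos.trans_le (one_le_tsum_ideal hF h0)).ne'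
  have h := (tendsto_siftedSum hF h0).mul_const (∑' I, F I)⁻¹
  rw [one_mul] at h
  refine h.congr fun S => ?_
  rw [siftedSum_eq hF, mul_inv_cancel_right₀ hZ]

theorem hasProd_one_sub_inv (hF : Summable F) (h0 : ∀ I, 0 ≤ F I) :
    HasProd (fun p : HeightOneSpectrum R => (1 - F p.asIdeal)⁻¹) (∑' I, F I) := by
  have hZ : ∑' I, F I ≠ 0 := (one_pos.trans_le (one_le_tsum_ideal hF h0)).ne'
  have h := Tendsto.inv₀ (hasProd_one_sub hF h0) (inv_ne_zero hZ)
  rw [inv_inv] at h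
  refine h.congr fun S => ?_
  rw [Finset.prod_inv_distrib]

end EulerProduct

/-! ### The Dedekind zeta function on the real half-line s > 1 -/

section DedekindZeta

open NumberField IsDedekindDomain

variable (K : Type*) [Field K] [NumberField K]

/-- The function `N(I) ^ (-s)` of an ideal `I`. -/
def normPow {s : ℝ} (hs : s ≠ 0) : Ideal (𝓞 K) →*₀ ℝ where
  toFun I := (Ideal.absNorm I : ℝ) ^ (-s)
  map_zero' := by
    rw [map_zero, Nat.cast_zero, Real.zero_rpow (neg_ne_zero.2 hs)]
  map_one' := by
    rw [map_one, Nat.cast_one, Real.one_rpow]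
  map_mul' I J := by
    rw [map_mul, Nat.cast_mul, Real.mul_rpow (Nat.cast_nonneg _) (Nat.cast_nonneg _)]

variable {K}

theorem normPow_nonneg {s : ℝ} (hs : s ≠ 0) (I : Ideal (𝓞 K)) : 0 ≤ normPow K hs I :=
  Real.rpow_nonneg (Nat.cast_nonneg _) _

variable (K)

/-- The number of non-zero ideals of norm at most n grows like a constant times n, which gives
convergence for s > 1. -/
theorem lSeriesSummable_dedekindZeta {s : ℝ} (hs : 1 < s) :
    LSeriesSummable (fun n ↦ ((Nat.card {I : Ideal (𝓞 K) // Ideal.absNorm I = n} : ℝ) : ℂ)) s := by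
  refine LSeriesSummable_of_sum_norm_bigO_and_nonneg (r := 1)
    (f := fun n => (Nat.card {I : Ideal (𝓞 K) // Ideal.absNorm I = n} : ℝ)) ?_
    (fun n => Nat.cast_nonneg _) zero_le_one (by simpa using hs)
  have h1 : Tendsto (fun n : ℕ ↦ (∑ k ∈ Finset.Icc 1 n,
      (Nat.card {I : Ideal (𝓞 K) // Ideal.absNorm I = k} : ℝ)) / (n : ℝ)) atTop
        (𝓝 (dedekindZeta_residue K)) := by
    refine ((Ideal.tendsto_norm_le_div_atTop₀ K).comp tendsto_natCast_atTop_atTop).congr fun n ↦ ?_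
    simp only [Function.comp_apply, Nat.cast_le, ← Nat.cast_sum]
    congr
    -- The added 1 accounts for the zero ideal, the only ideal of norm 0.
    rw [← add_left_inj 1, ← Ideal.card_norm_le_eq_card_norm_le_add_one,
      show Finset.Icc 1 n = Finset.Ioc 0 n from Finset.Icc_succ_left_eq_Ioc _ _,
      show 1 = Nat.card {I : Ideal (𝓞 K) // Ideal.absNorm I = 0} by simp [Ideal.absNorm_eq_zero_iff],
      Finset.sum_Ioc_add_eq_sum_Icc (n.zero_le),
      ← Finset.card_preimage_eq_sum_card_image_eq
        (fun k _ ↦ Ideal.finite_setOfPred_absNorm_eq k)]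
    simp [Set.coe_eq_subtype]
  simp only [Real.rpow_one]
  refine Asymptotics.isBigO_of_div_tendsto_nhds ?_ _ h1
  filter_upwards [eventually_ne_atTop 0] with n hn h
  exact absurd h (Nat.cast_ne_zero.2 hn)

/-- Grouping the ideals by their norm, with finite fibres, identifies the sum over ideals with the
Dirichlet series. -/
theorem hasSum_normPow {s : ℝ} (hs : 1 < s) :
    ∃ Z : ℝ, HasSum (normPow K (zero_lt_one.trans hs).ne') Z ∧ dedekindZeta K s = Z := by
  set a : ℕ → ℝ := fun n => Nat.card {I : Ideal (𝓞 K) // Ideal.absNorm I = n} with ha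
  have hterm : ∀ n, LSeries.term (fun n => (a n : ℂ)) s n = ((a n * (n : ℝ) ^ (-s) : ℝ) : ℂ) := by
    intro n
    rcases eq_or_ne n 0 with rfl | hn
    · rw [LSeries.term_zero, Nat.cast_zero, Real.zero_rpow (by linarith), mul_zero,
        Complex.ofReal_zero]
    · rw [LSeries.term_of_ne_zero hn, Complex.ofReal_mul, Complex.ofReal_cpow (Nat.cast_nonneg _),
        Complex.ofReal_neg, Complex.cpow_neg, div_eq_mul_inv]
      simp only [Complex.ofReal_natCast]
  have hsum : Summable fun n : ℕ => a n * (n : ℝ) ^ (-s) := by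
    have h := lSeriesSummable_dedekindZeta K hs
    rw [LSeriesSummable, funext hterm] at h
    exact Complex.summable_ofReal.1 h
  have hfib : ∀ n : ℕ, HasSum (fun I : {I : Ideal (𝓞 K) // Ideal.absNorm I = n} =>
      normPow K (zero_lt_one.trans hs).ne' I) (a n * (n : ℝ) ^ (-s)) := by
    intro n
    have : Finite {I : Ideal (𝓞 K) // Ideal.absNorm I = n} :=
      Ideal.finite_setOfPred_absNorm_eq n
    let _ := Fintype.ofFinite {I : Ideal (𝓞 K) // Ideal.absNorm I = n}
    convert hasSum_fintype _ using 1
    rw [Finset.sum_congr rfl fun I _ => (show normPow K _ I.1 = (n : ℝ) ^ (-s) by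
      exact congrArg (fun m : ℕ => (m : ℝ) ^ (-s)) I.2), Finset.sum_const, Finset.card_univ,
      ← Nat.card_eq_fintype_card, nsmul_eq_mul]
  have hS : Summable (normPow K (zero_lt_one.trans hs).ne') := by
    rw [← (Equiv.sigmaFiberEquiv (Ideal.absNorm : Ideal (𝓞 K) → ℕ)).summable_iff]
    refine (summable_sigma_of_nonneg fun x => normPow_nonneg _ _).2
      ⟨fun n => (hfib n).summable, ?_⟩
    refine hsum.congr fun n => ?_
    exact (hfib n).tsum_eq.symm
  refine ⟨_, hS.hasSum, ?_⟩
  have h1 := ((Equiv.sigmaFiberEquiv (Ideal.absNorm : Ideal (𝓞 K) → ℕ)).hasSum_iff.2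
    hS.hasSum).sigma hfib
  rw [dedekindZeta, ← h1.tsum_eq, Complex.ofReal_tsum, LSeries]
  refine tsum_congr fun n => ?_
  rw [← hterm, ha]
  simp only [Complex.ofReal_natCast]

theorem hasProd_eulerFactor {s : ℝ} (hs : 1 < s) :
    ∃ Z : ℝ, 1 ≤ Z ∧ dedekindZeta K s = Z ∧
      HasProd (fun v : HeightOneSpectrum (𝓞 K) => 1 - (Ideal.absNorm v.asIdeal : ℝ) ^ (-s)) Z⁻¹ ∧
      HasProd (fun v : HeightOneSpectrum (𝓞 K) =>
        (1 - (Ideal.absNorm v.asIdeal : ℝ) ^ (-s))⁻¹) Z := by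
  obtain ⟨Z, hZ, hz⟩ := hasSum_normPow K hs
  have h0 := normPow_nonneg (K := K) (zero_lt_one.trans hs).ne'
  refine ⟨Z, ?_, hz, ?_, ?_⟩
  · rw [← hZ.tsum_eq]
    exact one_le_tsum_ideal hZ.summable h0
  · rw [← hZ.tsum_eq]
    exact hasProd_one_sub hZ.summable h0
  · rw [← hZ.tsum_eq]
    exact hasProd_one_sub_inv hZ.summable h0

/-- For s > 1 the Euler product is the zeta function; the limit is the class number formula. -/
theorem tendsto_eulerProduct :
    Tendsto (fun s : ℝ => (s - 1) * ∏' v : HeightOneSpectrum (𝓞 K),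
      (1 - (Ideal.absNorm v.asIdeal : ℝ) ^ (-s))⁻¹) (𝓝[>] 1) (𝓝 (dedekindZeta_residue K)) := by
  have h := (Complex.continuous_re.tendsto _).comp (tendsto_sub_one_mul_dedekindZeta_nhdsGT K)
  rw [Complex.ofReal_re] at h
  refine h.congr' ?_
  filter_upwards [self_mem_nhdsWithin] with s hs
  obtain ⟨Z, -, hz, -, hZ⟩ := hasProd_eulerFactor K hs
  rw [Function.comp_apply, hZ.tprod_eq, hz, ← Complex.ofReal_one, ← Complex.ofReal_sub,
    ← Complex.ofReal_mul, Complex.ofReal_re]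

end DedekindZeta

/-! ## Heights and the masses of the local Tamagawa measures -/

theorem norm_eq_iSup {E ι : Type*} [NormedField E] [Fintype ι] [Nonempty ι] (x : ι → E) :
    ‖x‖ = ⨆ r, ‖x r‖ :=
  le_antisymm ((pi_norm_le_iff_of_nonneg (Real.iSup_nonneg fun _ => norm_nonneg _)).2
    fun r => le_ciSup (f := fun r => ‖x r‖) (Set.finite_range _).bddAbove r)
    (ciSup_le fun r => norm_le_pi_norm x r)

section Heights

open NumberField IsDedekindDomain

variable {K : Type*} [Field K] [NumberField K]

/-- The product formula, split into its finite and infinite parts. Positivity of the finite part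
allows N-th roots to be taken. -/
theorem exists_hasProd_norm {a : K} (ha : a ≠ 0) :
    ∃ p : ℝ, 0 < p ∧ HasProd (fun v : HeightOneSpectrum (𝓞 K) => ‖FinitePlace.embedding (K := K) v a‖) p ∧
      (∏ v : InfinitePlace K, v a ^ v.mult) * p = 1 := by
  have hf := FinitePlace.hasFiniteMulSupport ha
  have h1 : HasProd (fun w : FinitePlace K => w a) (∏ᶠ w : FinitePlace K, w a) := by
    rw [← tprod_eq_finprod (L := SummationFilter.unconditional _) hf]
    exact (multipliable_of_hasFiniteMulSupport hf).hasProd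
  refine ⟨∏ᶠ w : FinitePlace K, w a, finprod_induction (0 < ·) one_pos (fun _ _ => mul_pos)
    fun w => FinitePlace.pos_iff.2 ha, ?_,
    prod_abs_eq_one ha⟩
  rw [← FinitePlace.equivHeightOneSpectrum.symm.hasProd_iff] at h1
  exact h1.congr fun S => Finset.prod_congr rfl fun v _ => by
    rw [Function.comp_apply, FinitePlace.equivHeightOneSpectrum_symm_apply]

theorem exists_hasProd_height {ι : Type*} [Finite ι] {x : ι → K} (hx : x ≠ 0) :
    ∃ p : ℝ, 0 < p ∧ HasProd (fun v : HeightOneSpectrum (𝓞 K) => ⨆ r, ‖FinitePlace.embedding (K := K) v (x r)‖) p ∧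
      (∏ v : InfinitePlace K, (⨆ r, v (x r)) ^ v.mult) * p = Height.mulHeight x := by
  obtain ⟨r₀, hr₀⟩ := Function.ne_iff.1 hx
  have : Nonempty ι := ⟨r₀⟩
  have hpos : ∀ w : FinitePlace K, 0 < ⨆ r, w (x r) := fun w =>
    (FinitePlace.pos_iff.2 hr₀).trans_le
      (le_ciSup (f := fun r => w (x r)) (Set.finite_range _).bddAbove r₀)
  -- The maximum is 1 at all places where the non-zero coordinates are units, hence at all but
  -- finitely many.
  have hf : (fun w : FinitePlace K => ⨆ r, w (x r)).HasFiniteMulSupport := by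
    refine (Set.finite_iUnion fun r : {r // x r ≠ 0} =>
      FinitePlace.hasFiniteMulSupport r.2).subset fun w hw => ?_
    rw [Set.mem_iUnion]
    by_contra! h
    refine hw (le_antisymm (ciSup_le fun r => ?_) ?_)
    · by_cases hr : x r = 0
      · rw [hr, map_zero]
        exact zero_le_one
      · exact (Function.notMem_mulSupport.1 (h ⟨r, hr⟩)).le
    · rw [← Function.notMem_mulSupport.1 (h ⟨r₀, hr₀⟩)]
      exact le_ciSup (f := fun r => w (x r)) (Set.finite_range _).bddAbove r₀
  have h1 : HasProd (fun w : FinitePlace K => ⨆ r, w (x r))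
      (∏ᶠ w : FinitePlace K, ⨆ r, w (x r)) := by
    rw [← tprod_eq_finprod (L := SummationFilter.unconditional _) hf]
    exact (multipliable_of_hasFiniteMulSupport hf).hasProd
  rw [← FinitePlace.equivHeightOneSpectrum.symm.hasProd_iff] at h1
  exact ⟨_, finprod_induction (0 < ·) one_pos (fun _ _ => mul_pos) hpos,
    h1.congr fun S => Finset.prod_congr rfl fun v _ => by
      simp only [Function.comp_apply, FinitePlace.equivHeightOneSpectrum_symm_apply],
    (NumberField.mulHeight_eq hx).symm⟩

end Heights

namespace QuasiProj

namespace IsLine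

open NumberField IsDedekindDomain

universe u

variable {K : Type u} [Field K] [NumberField K] {n : ℕ} {V : QuasiProj K n} {i j : Fin (n + 1)}
  {c d : Fin (n + 1) → K}

/-- The total mass of the Tamagawa measure at an infinite place of a line of height one. -/
def infMass (v : InfinitePlace K) : ℝ :=
  open Classical in
  ((if v.IsReal then 2 else ENNReal.ofReal (2 * Real.pi)) +
    haarBall v.Completion (if v.IsReal then 2 else ENNReal.ofReal (2 * Real.pi))
      (Metric.ball 0 1)).toReal

theorem measure_ball_haarBall_ne_top {E : Type*} [NormedField E] [ProperSpace E] {vol : ENNReal}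
    (h : vol ≠ ⊤) : haarBall E vol (Metric.ball 0 1) ≠ ⊤ :=
  ne_top_of_le_ne_top ((haarBall_closedBall E vol).trans_ne h) (measure_mono Metric.ball_subset_closedBall)

variable (hV : V.IsLine i j c d) [V.IsIrred] {g : V.AdjointSection} {f : V.FunField} {a : K}
  (ha : a ≠ 0)
  (hdiff : g.diff = f • KaehlerDifferential.D (AlgebraicClosure K) V.FunField (V.ratio i j))
  (hsec : g.sec * (f : V.Frac) ^ g.N = algebraMap K V.Frac a * V.coord j ^ (2 * g.N))

include hV

omit [NumberField K] [V.IsIrred] in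
theorem c_ne_zero : c ≠ 0 := fun h => by
  have := hV.c_j
  rw [h] at this
  exact zero_ne_one this

omit [NumberField K] [V.IsIrred] in
theorem d_ne_zero : d ≠ 0 := fun h => by
  have := hV.d_i
  rw [h] at this
  exact zero_ne_one this

include ha hdiff hsec

theorem measureInf_univ (v : InfinitePlace K) :
    (g.measureInf v Set.univ ≠ 0 ∧ g.measureInf v Set.univ ≠ ⊤) ∧
      (g.measureInf v Set.univ).toReal = (v a ^ v.mult) ^ (g.N : ℝ)⁻¹ *
        ((⨆ r, v (c r)) ^ v.mult * (⨆ r, v (d r)) ^ v.mult)⁻¹ * infMass v := by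
  classical
  set vol : ENNReal := if v.IsReal then 2 else ENNReal.ofReal (2 * Real.pi) with hvol
  have h0 : vol ≠ 0 := by
    rw [hvol]
    split_ifs
    · exact two_ne_zero
    · exact (ENNReal.ofReal_pos.2 Real.two_pi_pos).ne'
  have h1 : vol ≠ ⊤ := by
    rw [hvol]
    split_ifs
    · exact ENNReal.ofNat_ne_top
    · exact ENNReal.ofReal_ne_top
  have hm := hV.measure_univ (hV.isLineOver (algebraMap K v.Completion)) hdiff hsec h0 h1
    (isModulus_infinite v h0 h1)
  have hm' : g.measureInf v Set.univ = _ := hm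
  simp only [norm_eq_iSup, norm_algebraMap_infinite] at hm'
  have hpos : ∀ x : Fin (n + 1) → K, x ≠ 0 → 0 < ⨆ r, v (x r) := fun x hx => by
    obtain ⟨r₀, hr₀⟩ := Function.ne_iff.1 hx
    exact (v.pos_iff.2 hr₀).trans_le
      (le_ciSup (f := fun r => v (x r)) (Set.finite_range _).bddAbove r₀)
  have hva : 0 < v a := v.pos_iff.2 ha
  have hA := hpos c hV.c_ne_zero
  have hB := hpos d hV.d_ne_zero
  have hx : 0 < v a ^ ((v.mult : ℝ) / g.N) *
      (((⨆ r, v (c r)) * ⨆ r, v (d r)) ^ v.mult)⁻¹ := by positivity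
  have htop := measure_ball_haarBall_ne_top (E := v.Completion) h1
  rw [hm']
  refine ⟨⟨mul_ne_zero (ENNReal.ofReal_pos.2 hx).ne' ?_, ENNReal.mul_ne_top ENNReal.ofReal_ne_top
    (ENNReal.add_ne_top.2 ⟨h1, htop⟩)⟩, ?_⟩
  · exact fun h => h0 (add_eq_zero.1 h).1
  · rw [ENNReal.toReal_mul, ENNReal.toReal_ofReal hx.le, mul_pow, div_eq_mul_inv,
      Real.rpow_mul hva.le, Real.rpow_natCast]
    rfl

/-- The factor 1 + 1/q adds the masses of the integers and of the maximal ideal; it is the number of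
points of the projective line over the residue field, divided by q. -/
theorem measureFin_univ (v : HeightOneSpectrum (𝓞 K)) :
    (g.measureFin v Set.univ ≠ 0 ∧ g.measureFin v Set.univ ≠ ⊤) ∧
      (g.measureFin v Set.univ).toReal = ‖FinitePlace.embedding (K := K) v a‖ ^ (g.N : ℝ)⁻¹ *
        ((⨆ r, ‖FinitePlace.embedding (K := K) v (c r)‖) *
          ⨆ r, ‖FinitePlace.embedding (K := K) v (d r)‖)⁻¹ *
            (1 + (Ideal.absNorm v.asIdeal : ℝ)⁻¹) := by
  have hm := hV.measure_univ (hV.isLineOver (FinitePlace.embedding (K := K) v)) hdiff hsec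
    one_ne_zero ENNReal.one_ne_top (isModulus_finite v)
  have hm' : g.measureFin v Set.univ = _ := hm
  rw [haarBall_ball_finite, norm_eq_iSup, norm_eq_iSup] at hm'
  have hpos : ∀ x : Fin (n + 1) → K, x ≠ 0 →
      0 < ⨆ r, ‖FinitePlace.embedding (K := K) v (x r)‖ := fun x hx => by
    obtain ⟨r₀, hr₀⟩ := Function.ne_iff.1 hx
    exact (norm_pos_iff.2 ((map_ne_zero _).2 hr₀)).trans_le
      (le_ciSup (f := fun r => ‖FinitePlace.embedding (K := K) v (x r)‖)
        (Set.finite_range _).bddAbove r₀)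
  have hva : 0 < ‖FinitePlace.embedding (K := K) v a‖ := norm_pos_iff.2 ((map_ne_zero _).2 ha)
  have hA := hpos c hV.c_ne_zero
  have hB := hpos d hV.d_ne_zero
  have hx : 0 < ‖FinitePlace.embedding (K := K) v a‖ ^ (((1 : ℕ) : ℝ) / g.N) *
      (((⨆ r, ‖FinitePlace.embedding (K := K) v (c r)‖) *
        ⨆ r, ‖FinitePlace.embedding (K := K) v (d r)‖) ^ 1)⁻¹ := by positivity
  rw [hm']
  refine ⟨⟨mul_ne_zero (ENNReal.ofReal_pos.2 hx).ne' ?_, ENNReal.mul_ne_top ENNReal.ofReal_ne_top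
    (ENNReal.add_ne_top.2 ⟨ENNReal.one_ne_top, ENNReal.ofReal_ne_top⟩)⟩, ?_⟩
  · exact fun h => one_ne_zero (add_eq_zero.1 h).1
  · rw [ENNReal.toReal_mul, ENNReal.toReal_ofReal hx.le,
      ENNReal.toReal_add ENNReal.one_ne_top ENNReal.ofReal_ne_top, ENNReal.toReal_one,
      ENNReal.toReal_ofReal (by positivity), pow_one, Nat.cast_one, one_div]

/-- The product of the masses of the local Tamagawa measures of a line, in terms of its height. -/
theorem exists_hasProd_measureFin : ∃ m : ℝ,
    HasProd (fun v => (V.localL v 1)⁻¹ * (g.measureFin v Set.univ).toReal) m ∧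
      (∏ v, (g.measureInf v Set.univ).toReal) * m = ((∏ v : InfinitePlace K, infMass v) *
        ∏' v : HeightOneSpectrum (𝓞 K), (1 - (Ideal.absNorm v.asIdeal : ℝ) ^ (-2 : ℝ))) /
          (Height.mulHeight c * Height.mulHeight d) := by
  obtain ⟨p, hp, hp1, hp2⟩ := exists_hasProd_norm ha
  obtain ⟨A, hA, hA1, hA2⟩ := exists_hasProd_height hV.c_ne_zero
  obtain ⟨B, hB, hB1, hB2⟩ := exists_hasProd_height hV.d_ne_zero
  obtain ⟨Z, -, -, hZ, -⟩ := hasProd_eulerFactor K one_lt_two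
  have hpN : HasProd (fun v : HeightOneSpectrum (𝓞 K) => ‖FinitePlace.embedding (K := K) v a‖ ^ (g.N : ℝ)⁻¹)
      (p ^ (g.N : ℝ)⁻¹) := by
    refine (Tendsto.rpow_const hp1 (p := (g.N : ℝ)⁻¹) (Or.inl hp.ne')).congr fun S => ?_
    rw [Real.finsetProd_rpow _ _ fun v _ => norm_nonneg _]
  have hAB : HasProd (fun v : HeightOneSpectrum (𝓞 K) => ((⨆ r, ‖FinitePlace.embedding (K := K) v (c r)‖) *
      ⨆ r, ‖FinitePlace.embedding (K := K) v (d r)‖)⁻¹) (A * B)⁻¹ := by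
    refine (Tendsto.inv₀ (hA1.mul hB1) (mul_pos hA hB).ne').congr fun S => ?_
    rw [Finset.prod_inv_distrib]
  refine ⟨_, ((hpN.mul hAB).mul hZ).congr fun S => Finset.prod_congr rfl fun v _ => ?_, ?_⟩
  · beta_reduce
    -- The convergence factor 1 - 1/q turns 1 + 1/q into 1 - q^(-2), the inverse of the Euler factor
    -- at s = 2.
    rw [(hV.measureFin_univ ha hdiff hsec v).2, hV.localL_eq, inv_inv, Real.rpow_neg_one,
      Real.rpow_neg (Nat.cast_nonneg _), Real.rpow_two]
    ring
  · simp only [fun v => (hV.measureInf_univ ha hdiff hsec v).2]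
    rw [Finset.prod_mul_distrib, Finset.prod_mul_distrib, Finset.prod_inv_distrib,
      Finset.prod_mul_distrib, hZ.tprod_eq, Real.finsetProd_rpow _ _ fun v _ => by positivity,
      ← hA2, ← hB2]
    -- By the product formula the constant of the adjoint section drops out; this is the
    -- independence of the choice of section.
    have h1 : (∏ v : InfinitePlace K, v a ^ v.mult) ^ (g.N : ℝ)⁻¹ * p ^ (g.N : ℝ)⁻¹ = 1 := by
      rw [← Real.mul_rpow (Finset.prod_nonneg fun v _ => by positivity) hp.le, hp2, Real.one_rpow]
    rw [mul_inv, mul_inv, div_eq_mul_inv, mul_inv, mul_inv, mul_inv]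
    linear_combination ((∏ v : InfinitePlace K, (⨆ r, v (c r)) ^ v.mult)⁻¹ *
      (∏ v : InfinitePlace K, (⨆ r, v (d r)) ^ v.mult)⁻¹ * (∏ v : InfinitePlace K, infMass v) *
        A⁻¹ * B⁻¹ * Z⁻¹) * h1

end IsLine

end QuasiProj

/-! ## Weak approximation -/

section WeakApproximation

open NumberField IsDedekindDomain

variable (K : Type*) [Field K] [NumberField K]

theorem exists_approx {F ι : Type*} [Field F] [Finite ι] {v : ι → AbsoluteValue F ℝ}
    (h : ∀ i, (v i).IsNontrivial) (hv : Pairwise fun i j ↦ ¬(v i).IsEquiv (v j)) (k : ι → F)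
    {ε : ι → ℝ} (hε : ∀ i, 0 < ε i) : ∃ t, ∀ i, v i (t - k i) < ε i := by
  have := Fintype.ofFinite ι
  obtain ⟨t, ht⟩ := (AbsoluteValue.denseRange_algebraMap_pi h hv).exists_mem_open
    (isOpen_set_pi (s := fun i => Metric.ball (algebraMap F (WithAbs (v i)) (k i)) (ε i))
      Set.finite_univ fun i _ => Metric.isOpen_ball)
    ⟨fun i => algebraMap F (WithAbs (v i)) (k i), fun i _ => Metric.mem_ball_self (hε i)⟩
  refine ⟨t, fun i => ?_⟩
  have := ht i trivial
  rw [mem_ball_iff_norm] at this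
  exact this

/-- The absolute values of a number field. -/
def placeAbs : InfinitePlace K ⊕ HeightOneSpectrum (𝓞 K) → AbsoluteValue K ℝ :=
  Sum.elim (fun v => v.1) fun v => (FinitePlace.mk v).1

theorem placeAbs_isNontrivial (v : InfinitePlace K ⊕ HeightOneSpectrum (𝓞 K)) :
    (placeAbs K v).IsNontrivial := by
  rcases v with v | v
  · exact v.isNontrivial
  · obtain ⟨x, hx, hx0⟩ := Submodule.exists_mem_ne_zero_of_ne_bot v.ne_bot
    exact ⟨algebraMap (𝓞 K) K x, by simpa using hx0,
      ((FinitePlace.norm_lt_one_iff_mem K v x).2 hx).ne⟩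

/-- The element 2 separates infinite from finite places, and an integer in one prime but not in the
other separates two finite places. -/
theorem placeAbs_not_isEquiv :
    Pairwise fun v w => ¬(placeAbs K v).IsEquiv (placeAbs K w) := by
  have h2 : ∀ (v : InfinitePlace K) (w : HeightOneSpectrum (𝓞 K)),
      ¬(placeAbs K (Sum.inl v)).IsEquiv (placeAbs K (Sum.inr w)) := by
    intro v w h
    have h1 : placeAbs K (Sum.inr w) 2 ≤ placeAbs K (Sum.inr w) 1 := by
      have := FinitePlace.norm_le_one K w 2
      rw [map_ofNat] at this
      rw [map_one]
      exact this
    have h3 := (h 2 1).2 h1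
    rw [map_one] at h3
    have h4 : placeAbs K (Sum.inl v) 2 = 2 := by
      have := v.norm_embedding_eq 2
      rw [map_ofNat] at this
      exact this.symm.trans (by norm_num)
    rw [h4] at h3
    norm_num at h3
  rintro (v | v) (w | w) hvw h
  · exact hvw (congrArg Sum.inl (InfinitePlace.eq_iff_isEquiv.2 h))
  · exact h2 v w h
  · exact h2 w v h.symm
  · have hle : ¬w.asIdeal ≤ v.asIdeal := fun hle => hvw (congrArg Sum.inr
      (HeightOneSpectrum.ext (w.isMaximal.eq_of_le v.isPrime.ne_top hle).symm))
    obtain ⟨x, hx, hxv⟩ := Set.not_subset.1 hle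
    have h3 := (FinitePlace.norm_lt_one_iff_mem K w x).2 hx
    have h4 := (FinitePlace.norm_eq_one_iff_notMem K v x).2 hxv
    have h5 := (AbsoluteValue.isEquiv_iff_lt_one_iff.1 h (algebraMap (𝓞 K) K x)).2 h3
    exact h5.ne h4

/-- The diagonal embedding of a number field in the product of all its completions. -/
def diagEmb (k : K) : (∀ v : InfinitePlace K, v.Completion) ×
    ∀ v : HeightOneSpectrum (𝓞 K), v.adicCompletion K :=
  (fun v => algebraMap K v.Completion k, fun v => FinitePlace.embedding (K := K) v k)

/-- A neighbourhood in the product restricts only finitely many places. At these the local targets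
are first replaced by elements of K, which weak approximation then matches simultaneously. -/
theorem denseRange_diagEmb : DenseRange (diagEmb K) := by
  intro z
  rw [mem_closure_iff_nhds]
  intro U hU
  rw [nhds_prod_eq, mem_prod_iff] at hU
  obtain ⟨U₁, hU₁, U₂, hU₂, hU⟩ := hU
  rw [nhds_pi, mem_pi] at hU₁ hU₂
  obtain ⟨I₁, -, t₁, ht₁, hI₁⟩ := hU₁
  obtain ⟨I₂, hfin, t₂, ht₂, hI₂⟩ := hU₂
  have h1 : ∀ v, ∃ ε > 0, Metric.ball (z.1 v) ε ⊆ t₁ v := fun v => Metric.mem_nhds_iff.1 (ht₁ v)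
  have h2 : ∀ v, ∃ ε > 0, Metric.ball (z.2 v) ε ⊆ t₂ v := fun v => Metric.mem_nhds_iff.1 (ht₂ v)
  choose ε₁ hε₁ hb₁ using h1
  choose ε₂ hε₂ hb₂ using h2
  have h3 : ∀ v, ∃ k : K, dist (z.1 v) (algebraMap K v.Completion k) < ε₁ v / 2 := fun v =>
    Metric.denseRange_iff.1 (denseRange_algebraMap_infinite v) _ _ (half_pos (hε₁ v))
  have h4 : ∀ v, ∃ k : K, dist (z.2 v) (FinitePlace.embedding (K := K) v k) < ε₂ v / 2 := fun v =>
    Metric.denseRange_iff.1 (denseRange_embedding v) _ _ (half_pos (hε₂ v))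
  choose k₁ hk₁ using h3
  choose k₂ hk₂ using h4
  have := hfin.to_subtype
  let π : InfinitePlace K ⊕ I₂ → InfinitePlace K ⊕ HeightOneSpectrum (𝓞 K) :=
    Sum.map id Subtype.val
  have hπ : Function.Injective π := Sum.map_injective.2 ⟨Function.injective_id,
    Subtype.val_injective⟩
  obtain ⟨t, ht⟩ := exists_approx (v := fun v => placeAbs K (π v))
    (fun v => placeAbs_isNontrivial K (π v))
    (fun v w hvw => placeAbs_not_isEquiv K (hπ.ne hvw))
    (Sum.elim k₁ fun v => k₂ v) (ε := Sum.elim (fun v => ε₁ v / 2) fun v => ε₂ v / 2)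
    (by rintro (v | v); exacts [half_pos (hε₁ v), half_pos (hε₂ v)])
  refine ⟨diagEmb K t, hU ⟨hI₁ fun v _ => hb₁ v ?_, hI₂ fun v hv => hb₂ v ?_⟩, t, rfl⟩
  · have h5 := hk₁ v
    have h6 : ‖algebraMap K v.Completion (t - k₁ v)‖ < ε₁ v / 2 := by
      rw [norm_algebraMap_infinite]
      exact ht (Sum.inl v)
    rw [map_sub, ← dist_eq_norm] at h6
    rw [Metric.mem_ball]
    calc _ ≤ _ := dist_triangle_right _ _ (algebraMap K v.Completion (k₁ v))
      _ < ε₁ v / 2 + ε₁ v / 2 := add_lt_add h6 h5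
      _ = ε₁ v := add_halves _
  · have h5 := hk₂ v
    have h6 : ‖FinitePlace.embedding (K := K) v (t - k₂ v)‖ < ε₂ v / 2 := ht (Sum.inr ⟨v, hv⟩)
    rw [map_sub, ← dist_eq_norm] at h6
    rw [Metric.mem_ball]
    calc _ ≤ _ := dist_triangle_right _ _ (FinitePlace.embedding (K := K) v (k₂ v))
      _ < ε₂ v / 2 + ε₂ v / 2 := add_lt_add h6 h5
      _ = ε₂ v := add_halves _

end WeakApproximation

namespace QuasiProj

section Local

variable {K : Type*} [Field K] {n : ℕ} {V : QuasiProj K n} {i j : Fin (n + 1)}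
  {c d : Fin (n + 1) → K} {E : Type*} [NormedField E] {φ : K →+* E}

/-- The affine part of a line is dense. -/
theorem IsLineOver.denseRange_affPt (h : V.IsLineOver i j c d φ)
    (hE : ∃ x : E, x ≠ 0 ∧ ‖x‖ < 1) : DenseRange h.affPt := by
  obtain ⟨π, hπ0, hπ⟩ := hE
  intro P
  by_cases hP : P.1.rep j ≠ 0
  · exact subset_closure ⟨_, h.affPt_affineCoord hP⟩
  rw [not_not] at hP
  set t := P.1.rep i with ht
  have hrep : P.1.rep = lineVec c d φ 0 t := by rw [h.rep_eq, hP]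
  have hzero : lineVec c d φ 0 t ≠ 0 := hrep ▸ P.1.rep_nonzero
  have hne : ∀ s : E, lineVec c d φ s t ≠ 0 := fun s => by
    by_cases hs : s = 0
    · rwa [hs]
    · exact (h.mem_cone s t hs).1
  have hcurve : Continuous fun s : E =>
      (⟨lineVec c d φ s t, hne s⟩ : {x : Fin (n + 1) → E // x ≠ 0}) := by
    refine Continuous.subtype_mk (continuous_pi fun r => ?_) _
    simp only [lineVec]
    fun_prop
  rw [mem_closure_iff]
  rintro U hU hPU
  obtain ⟨W, hW, rfl⟩ := (@isOpen_induced_iff _ _ (_) _ _).1 hU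
  rw [isOpen_coinduced] at hW
  have h0 : Projectivization.mk E (lineVec c d φ 0 t) (hne 0) ∈ W := by
    have : Projectivization.mk E (lineVec c d φ 0 t) (hne 0) = P.1 := by
      rw [← P.1.mk_rep]
      congr 1
      exact hrep.symm
    rw [this]
    exact hPU
  -- A point outside the affine part has s = 0; it is the limit of the points with s = π^m and the
  -- same t.
  have hlim : Tendsto (fun m : ℕ => π ^ m) atTop (𝓝 0) :=
    tendsto_pow_atTop_nhds_zero_of_norm_lt_one hπ
  have hmem := hlim.eventually ((hW.preimage hcurve).mem_nhds h0)
  obtain ⟨m, hm⟩ := hmem.exists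
  have hs := pow_ne_zero m hπ0
  refine ⟨h.affPt (t / π ^ m), ?_, ⟨_, rfl⟩⟩
  have heq : (h.affPt (t / π ^ m)).1 =
      Projectivization.mk E (lineVec c d φ (π ^ m) t) (hne (π ^ m)) := by
    change Projectivization.mk E _ _ = _
    rw [Projectivization.mk_eq_mk_iff']
    refine ⟨(π ^ m)⁻¹, ?_⟩
    funext r
    simp only [lineVec, Pi.smul_apply, smul_eq_mul]
    field_simp
  rw [Set.mem_preimage, heq]
  exact hm

end Local

namespace IsLine

open NumberField IsDedekindDomain

universe u

variable {K : Type u} [Field K] [NumberField K] {n : ℕ} {V : QuasiProj K n} {i j : Fin (n + 1)}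
  {c d : Fin (n + 1) → K} (hV : V.IsLine i j c d)

include hV

/-- The rational points of a line are dense in the product of all its local points. -/
theorem closure_diagonal : closure V.diagonal = Set.univ := by
  have h1 : ∀ v : InfinitePlace K, V.IsLineOver i j c d (algebraMap K v.Completion) := fun v =>
    hV.isLineOver _
  have h2 : ∀ v : HeightOneSpectrum (𝓞 K),
      V.IsLineOver i j c d (FinitePlace.embedding (K := K) v) := fun v => hV.isLineOver _
  -- The affine parametrizations of all local lines have dense image together, and they send the
  -- diagonal copy of K, dense by weak approximation, to rational points of V.
  let Ψ : (∀ v : InfinitePlace K, v.Completion) ×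
      (∀ v : HeightOneSpectrum (𝓞 K), v.adicCompletion K) →
        (∀ v, V.PointsInf v) × ∀ v, V.PointsFin v :=
    Prod.map (Pi.map fun v => (h1 v).affPt) (Pi.map fun v => (h2 v).affPt)
  have hΨ : Continuous Ψ := Continuous.prodMap
    (Continuous.piMap fun v => (h1 v).continuous_affPt)
    (Continuous.piMap fun v => (h2 v).continuous_affPt)
  have hd : DenseRange Ψ := DenseRange.prodMap
    (DenseRange.piMap fun v => (h1 v).denseRange_affPt
      (isModulus_infinite v one_ne_zero ENNReal.one_ne_top).exists_lt_one)
    (DenseRange.piMap fun v => (h2 v).denseRange_affPt (isModulus_finite v).exists_lt_one)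
  have h3 := hd.comp (denseRange_diagEmb K) hΨ
  refine Set.eq_univ_of_univ_subset (h3.closure_eq ▸ closure_mono ?_)
  rintro _ ⟨t, rfl⟩
  have h4 := hV.isLineOver (RingHom.id K)
  have hvec : ∀ {E : Type u} [Field E] (φ : K →+* E),
      (fun r => φ (lineVec c d (RingHom.id K) 1 t r)) = lineVec c d φ 1 (φ t) := by
    intro E _ φ
    funext r
    simp [lineVec]
  refine ⟨lineVec c d (RingHom.id K) 1 t, h4.mem_cone 1 t one_ne_zero, fun v => ?_, fun v => ?_⟩
  · refine ⟨?_, ?_⟩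
    · rw [hvec]
      exact ((h1 v).mem_cone 1 _ one_ne_zero).1
    · change Projectivization.mk _ _ _ = _
      congr 1
      exact (hvec _).symm
  · refine ⟨?_, ?_⟩
    · rw [hvec]
      exact ((h2 v).mem_cone 1 _ one_ne_zero).1
    · change Projectivization.mk _ _ _ = _
      congr 1
      exact (hvec _).symm

end IsLine

end QuasiProj

/-! ## The expected constant of a line -/

namespace QuasiProj

namespace IsLine

open NumberField IsDedekindDomain

universe u

variable (K : Type u) [Field K] [NumberField K]

/-- The expected constant of the projective line over `K`. -/
def expectedConstant : ℝ :=
  1 / 2 * (dedekindZeta_residue K * (Real.sqrt |(NumberField.discr K : ℝ)|)⁻¹ *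
    ((∏ v : InfinitePlace K, infMass v) *
      ∏' v : HeightOneSpectrum (𝓞 K), (1 - (Ideal.absNorm v.asIdeal : ℝ) ^ (-2 : ℝ))))

variable {K} {n : ℕ} {V : QuasiProj K n} {i j : Fin (n + 1)} {c d : Fin (n + 1) → K}
  (hV : V.IsLine i j c d) [V.IsIrred]

include hV

theorem probability_closure_diagonal {g : V.AdjointSection} (hg : g.IsRational) :
    g.probability (closure V.diagonal) = 1 := by
  obtain ⟨f, a, -, ha, hdiff, hsec⟩ := hV.exists_rational_const g hg
  have h1 : ∀ v, IsProbabilityMeasure ((g.measureInf v Set.univ)⁻¹ • g.measureInf v) := fun v => by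
    obtain ⟨h0, h1⟩ := (hV.measureInf_univ ha hdiff hsec v).1
    exact ⟨by rw [Measure.smul_apply, smul_eq_mul, ENNReal.inv_mul_cancel h0 h1]⟩
  have h2 : ∀ v, IsProbabilityMeasure ((g.measureFin v Set.univ)⁻¹ • g.measureFin v) := fun v => by
    obtain ⟨h0, h1⟩ := (hV.measureFin_univ ha hdiff hsec v).1
    exact ⟨by rw [Measure.smul_apply, smul_eq_mul, ENNReal.inv_mul_cancel h0 h1]⟩
  rw [hV.closure_diagonal]
  unfold AdjointSection.probability
  exact MeasureTheory.measure_univ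

/-- The Tamagawa number of a line. -/
theorem hasTamagawaNumber : V.HasTamagawaNumber
    (2 * expectedConstant K / (Height.mulHeight c * Height.mulHeight d)) := by
  refine ⟨hV.exists_adjointSection, dedekindZeta_residue K, fun s hs => ?_, ?_, fun g hg => ?_⟩
  · obtain ⟨Z, -, -, -, hZ⟩ := hasProd_eulerFactor K hs
    simp only [hV.localL_eq]
    exact hZ.multipliable
  · simp only [hV.localL_eq, hV.b_eq, pow_one]
    exact tendsto_eulerProduct K
  · obtain ⟨f, a, -, ha, hdiff, hsec⟩ := hV.exists_rational_const g hg
    obtain ⟨m, hm, hm'⟩ := hV.exists_hasProd_measureFin ha hdiff hsec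
    refine ⟨fun v => (hV.measureInf_univ ha hdiff hsec v).1,
      fun v => (hV.measureFin_univ ha hdiff hsec v).1, m, hm, ?_⟩
    -- The factor 2 cancels the 1/2 = 1/a that is part of `expectedConstant`.
    rw [hV.probability_closure_diagonal hg, hm', ENNReal.toReal_one, expectedConstant]
    ring

theorem hasExpectedConstant : V.HasExpectedConstant
    (expectedConstant K / (Height.mulHeight c * Height.mulHeight d)) := by
  refine ⟨_, hV.hasTamagawaNumber, ?_⟩
  rw [hV.a_eq, hV.b_eq, hV.gamma_eq, hV.delta_eq, Nat.sub_self, Nat.factorial_zero, Nat.cast_one]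
  ring

end IsLine

end QuasiProj

/-! ## The projective line and the lines on the cubic surface -/

section Lines

universe u

variable (K : Type u) [Field K]

theorem isLineOver_projLine {E : Type*} [Field E] (φ : K →+* E) :
    (projLine K).IsLineOver 1 0 ![1, 0] ![0, 1] φ where
  eq_lineVec x _ := by
    funext r
    fin_cases r <;> simp [QuasiProj.lineVec]
  mem_cone s t hs := by
    refine ⟨fun h => hs ?_, fun f hf => hf.elim, 1, rfl, by simp⟩
    simpa [QuasiProj.lineVec] using congrFun h 0

theorem isLine_projLine : (projLine K).IsLine 1 0 ![1, 0] ![0, 1] where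
  c_j := rfl
  d_j := rfl
  c_i := rfl
  d_i := rfl
  c_or_d r := by fin_cases r <;> simp
  isLineOver := isLineOver_projLine K
  isLineOver_complex := isLineOver_projLine K

theorem isLineOver_baseLine {E : Type*} [Field E] (φ : K →+* E) :
    (baseLine K).IsLineOver 1 0 ![1, 0, 0, 0] ![0, 1, 0, 0] φ where
  eq_lineVec := by
    rintro x ⟨-, hx, -⟩
    have h2 := hx (X 2) (Or.inr (Or.inl rfl))
    have h3 := hx (X 3) (Or.inr (Or.inr rfl))
    rw [eval₂_X] at h2 h3
    funext r
    fin_cases r <;> simp [QuasiProj.lineVec, h2, h3]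
  mem_cone s t hs := by
    refine ⟨fun h => hs ?_, ?_, X 0, Or.inl rfl, ?_⟩
    · simpa [QuasiProj.lineVec] using congrFun h 0
    · rintro f (rfl | rfl | rfl) <;> simp [QuasiProj.lineVec]
    · simpa [QuasiProj.lineVec] using hs

theorem isLine_baseLine : (baseLine K).IsLine 1 0 ![1, 0, 0, 0] ![0, 1, 0, 0] where
  c_j := rfl
  d_j := rfl
  c_i := rfl
  d_i := rfl
  c_or_d r := by fin_cases r <;> simp
  isLineOver := isLineOver_baseLine K
  isLineOver_complex := isLineOver_baseLine K

variable {K} {y : ℙ K (Fin 2 → K)}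

theorem mem_cone_fibre {E : Type*} [Field E] {φ : K →+* E} {x : Fin 4 → E} :
    x ∈ (fibre y).cone φ ↔ x 0 ^ 2 * x 2 = x 1 ^ 2 * x 3 ∧
      φ (y.rep 1) * x 0 = φ (y.rep 0) * x 1 ∧ (x 0 ≠ 0 ∨ x 1 ≠ 0) := by
  constructor
  · rintro ⟨-, hx, hx'⟩
    have e1 := hx _ (Or.inl rfl)
    have e2 := hx _ (Or.inr rfl)
    simp only [eval₂_sub, eval₂_mul, eval₂_pow, eval₂_X, eval₂_C] at e1 e2
    refine ⟨sub_eq_zero.1 e1, sub_eq_zero.1 e2, ?_⟩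
    obtain ⟨g, (rfl | rfl), hg⟩ := hx'
    · exact Or.inl (by simpa using hg)
    · exact Or.inr (by simpa using hg)
  · rintro ⟨e1, e2, e3⟩
    refine ⟨?_, ?_, ?_⟩
    · rintro rfl
      simp at e3
    · rintro f (rfl | rfl)
      · simp only [eval₂_sub, eval₂_mul, eval₂_pow, eval₂_X]
        exact sub_eq_zero.2 e1
      · simp only [eval₂_sub, eval₂_mul, eval₂_X, eval₂_C]
        exact sub_eq_zero.2 e2
    · rcases e3 with h | h
      · exact ⟨X 0, Or.inl rfl, by simpa using h⟩
      · exact ⟨X 1, Or.inr rfl, by simpa using h⟩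

/-- With u = y₁ / y₀ the points satisfy x₁ = u x₀ and x₀ ≠ 0, so the cubic equation becomes x₂ = u²
x₃; the parameters are x₀ and x₃. -/
theorem isLineOver_fibre (hy : y.rep 0 ≠ 0) {E : Type*} [Field E] (φ : K →+* E) :
    (fibre y).IsLineOver 3 0 ![1, y.rep 1 / y.rep 0, 0, 0] ![0, 0, (y.rep 1 / y.rep 0) ^ 2, 1]
      φ := by
  have hφ : φ (y.rep 0) ≠ 0 := (map_ne_zero φ).2 hy
  refine ⟨fun x hx => ?_, fun s t hs => mem_cone_fibre.2 ⟨?_, ?_, Or.inl ?_⟩⟩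
  · obtain ⟨e1, e2, e3⟩ := mem_cone_fibre.1 hx
    have hx1 : x 1 = φ (y.rep 1) / φ (y.rep 0) * x 0 := by
      rw [div_mul_eq_mul_div, eq_div_iff hφ, e2, mul_comm]
    have hx0 : x 0 ≠ 0 := by
      intro h
      rw [h, mul_zero] at hx1
      simp [h, hx1] at e3
    have hx2 : x 2 = (φ (y.rep 1) / φ (y.rep 0)) ^ 2 * x 3 := by
      refine mul_left_cancel₀ (pow_ne_zero 2 hx0) ?_
      rw [e1, hx1]
      ring
    funext r
    fin_cases r
    · simp [QuasiProj.lineVec]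
    · simpa [QuasiProj.lineVec] using hx1
    · simpa [QuasiProj.lineVec] using hx2
    · simp [QuasiProj.lineVec]
  · simp [QuasiProj.lineVec]
    ring
  · simp [QuasiProj.lineVec]
    field_simp
  · simpa [QuasiProj.lineVec] using hs

theorem isLine_fibre (hy : y.rep 0 ≠ 0) : (fibre y).IsLine 3 0
    ![1, y.rep 1 / y.rep 0, 0, 0] ![0, 0, (y.rep 1 / y.rep 0) ^ 2, 1] where
  c_j := rfl
  d_j := rfl
  c_i := rfl
  d_i := rfl
  c_or_d r := by fin_cases r <;> simp
  isLineOver := isLineOver_fibre hy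
  isLineOver_complex := isLineOver_fibre hy

theorem rep_one_ne_zero (hy : y.rep 0 = 0) : y.rep 1 ≠ 0 := by
  intro h
  apply y.rep_nonzero
  funext r
  fin_cases r
  · exact hy
  · exact h

/-- Over (0 : 1) the equations force x₀ = 0 and then x₃ = 0, so the parameters are x₁ and x₂. -/
theorem isLineOver_fibre_infty (hy : y.rep 0 = 0) {E : Type*} [Field E] (φ : K →+* E) :
    (fibre y).IsLineOver 2 1 ![0, 1, 0, 0] ![0, 0, 1, 0] φ := by
  have hφ : φ (y.rep 1) ≠ 0 := (map_ne_zero φ).2 (rep_one_ne_zero hy)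
  refine ⟨fun x hx => ?_, fun s t hs => mem_cone_fibre.2 ⟨?_, ?_, Or.inr ?_⟩⟩
  · obtain ⟨e1, e2, e3⟩ := mem_cone_fibre.1 hx
    rw [hy, map_zero, zero_mul] at e2
    have hx0 : x 0 = 0 := (mul_eq_zero.1 e2).resolve_left hφ
    have hx1 : x 1 ≠ 0 := e3.resolve_left fun h => h hx0
    have hx3 : x 3 = 0 := by
      rw [hx0, zero_pow two_ne_zero, zero_mul] at e1
      exact (mul_eq_zero.1 e1.symm).resolve_left (pow_ne_zero 2 hx1)
    funext r
    fin_cases r <;> simp [QuasiProj.lineVec, hx0, hx3]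
  · simp [QuasiProj.lineVec]
  · simp [QuasiProj.lineVec, hy]
  · simpa [QuasiProj.lineVec] using hs

theorem isLine_fibre_infty (hy : y.rep 0 = 0) :
    (fibre y).IsLine 2 1 ![0, 1, 0, 0] ![0, 0, 1, 0] where
  c_j := rfl
  d_j := rfl
  c_i := rfl
  d_i := rfl
  c_or_d r := by fin_cases r <;> simp
  isLineOver := isLineOver_fibre_infty hy
  isLineOver_complex := isLineOver_fibre_infty hy

variable [NumberField K]

/-- The first vector has the height of y. The second is the coordinatewise square of (u, 1) up to
zeros, so its height is the square of that of y. -/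
theorem mulHeight_fibre (hy : y.rep 0 ≠ 0) : y.mulHeight ^ 3 =
    Height.mulHeight ![1, y.rep 1 / y.rep 0, 0, 0] *
      Height.mulHeight ![0, 0, (y.rep 1 / y.rep 0) ^ 2, 1] := by
  have h1 : y.mulHeight = Height.mulHeight ![1, y.rep 1 / y.rep 0] := by
    conv_lhs => rw [← y.mk_rep]
    rw [Projectivization.mulHeight_mk, ← Height.mulHeight_smul_eq_mulHeight ![1, y.rep 1 / y.rep 0] hy]
    congr 1
    funext r
    fin_cases r
    · simp
    · simp [mul_div_cancel₀ _ hy]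
  have h2 : ![(y.rep 1 / y.rep 0) ^ 2, 1] = ![y.rep 1 / y.rep 0, 1] ^ 2 := by
    funext r
    fin_cases r <;> simp
  rw [Height.mulHeight_cons_zero, Height.mulHeight_cons_zero, h2, Height.mulHeight_pow,
    Height.mulHeight_swap (y.rep 1 / y.rep 0) 1, Height.mulHeight_cons_cons_cons_zero,
    Height.mulHeight_cons_cons_cons_zero, ← h1]
  ring

theorem mulHeight_fibre_infty (hy : y.rep 0 = 0) : y.mulHeight ^ 3 =
    Height.mulHeight (K := K) ![0, 1, 0, 0] * Height.mulHeight (K := K) ![0, 0, 1, 0] := by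
  have h1 : y.mulHeight = 1 := by
    conv_lhs => rw [← y.mk_rep]
    rw [Projectivization.mulHeight_mk]
    have : y.rep = ![0, y.rep 1] := by
      funext r
      fin_cases r
      · exact hy
      · rfl
    rw [this]
    simp
  rw [h1]
  simp

end Lines

end BatyrevTschinkel

end

/-! ### The invariants of the projective line, the base line and the fibres -/

theorem proposition3p2 (K : Type*) [Field K] [NumberField K] :
    (∀ y : Projectivization K (Fin 2 → K), (BatyrevTschinkel.fibre y).a = 2) ∧
    (BatyrevTschinkel.baseLine K).a = 2 ∧
    (BatyrevTschinkel.projLine K).a = 2 ∧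
    (∀ y : Projectivization K (Fin 2 → K), (BatyrevTschinkel.fibre y).b = 1) ∧
    (BatyrevTschinkel.baseLine K).b = 1 ∧
    (BatyrevTschinkel.projLine K).b = 1 ∧
    ∃ c : ℝ,
      (BatyrevTschinkel.projLine K).HasExpectedConstant c ∧
      (BatyrevTschinkel.baseLine K).HasExpectedConstant c ∧
      ∀ y : Projectivization K (Fin 2 → K),
        (BatyrevTschinkel.fibre y).HasExpectedConstant (c / y.mulHeight ^ 3) := by
  have hproj := BatyrevTschinkel.isLine_projLine K
  have hbase := BatyrevTschinkel.isLine_baseLine K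
  refine ⟨fun y => ?_, hbase.a_eq, hproj.a_eq, fun y => ?_, hbase.b_eq, hproj.b_eq,
    BatyrevTschinkel.QuasiProj.IsLine.expectedConstant K, ?_, ?_, fun y => ?_⟩
  · by_cases hy : y.rep 0 = 0
    · exact (BatyrevTschinkel.isLine_fibre_infty hy).a_eq
    · exact (BatyrevTschinkel.isLine_fibre hy).a_eq
  · by_cases hy : y.rep 0 = 0
    · exact (BatyrevTschinkel.isLine_fibre_infty hy).b_eq
    · exact (BatyrevTschinkel.isLine_fibre hy).b_eq
  -- Unit vectors have height 1, so for the projective line and the base line the denominator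
  -- disappears.
  · simpa using hproj.hasExpectedConstant
  · simpa using hbase.hasExpectedConstant
  · by_cases hy : y.rep 0 = 0
    · rw [BatyrevTschinkel.mulHeight_fibre_infty hy]
      exact (BatyrevTschinkel.isLine_fibre_infty hy).hasExpectedConstant
    · rw [BatyrevTschinkel.mulHeight_fibre hy]
      exact (BatyrevTschinkel.isLine_fibre hy).hasExpectedConstant
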